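/- Let $S$ be a Noetherian scheme (for instance $S=\operatorname{Spec} k$ for a field $k$) and let $n\in\{0,1,2,\dots\}\cup\{\infty\}$. Consider the reduced schemes of finite type over $S$ of Krull dimension at most $n$. (1) Let $\mathrm{Sch}^n_{rfw}$ be the SW-category (subtractive Waldhausen category) of these schemes and all $S$-morphisms between them: cofibrations are closed immersions, subtraction sequences are the sequences $X\hookrightarrow Y\leftarrow Y\smallsetminus X$ consisting of a closed immersion and the complementary open immersion, and weak equivalences are the piecewise isomorphisms, i.e. the morphisms $f:X\to Y$ for which there is a filtration $\emptyset=Y_0\subseteq Y_1\subseteq\dots\subseteq Y_m=Y$ by closed subsets such that $f$ restricts to an isomorphism $f^{-1}(Y_i\smallsetminus Y_{i-1})\to Y_i\smallsetminus Y_{i-1}$ of reduced locally closed subschemes for all $i$. Its $K$-theory spectrum $K^C(\mathrm{Sch}^n_{rfw})$ has as $k$-th space the realization $|wS^{(k)}_{\bullet}|$ of the $k$-fold iterated $S_\bullet$-construction; here $S_m$ consists of the diagrams $(X_{ij})_{0\le i\le j\le m}$ with $X_{ii}=\emptyset$ in which $X_{ij}\hookrightarrow X_{il}\leftarrow X_{jl}$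 is a subtraction sequence for all $i\le j\le l$, and the $k$-fold construction consists of the diagrams indexed by $k$-tuples of intervals $[i,j]$ that have this property in each coordinate separately; the morphisms of $wS^{(k)}$ are the natural transformations by weak equivalences. (So the $K$-theory space is $\Omega|wS_\bullet|$.) (2) Let $\mathrm{Sch}^n_{rf}$ be the assembler with the same objects, with locally closed immersions as morphisms, and with the Grothendieck topology generated by the families $\{Z\to X,\ X\smallsetminus Z\to X\}$ for $Z$ closed in $X$ and the empty family over $\emptyset$. For an assembler $\mathcal A$ let $\mathcal W(\mathcal A)$ be the category of finite families $\{A_i\}_{i\in I}$ of non-initial objects, in which a morphism $\{A_i\}_{i\in I}\to\{B_j\}_{j\in J}$ is a map $\varphi:I\to J$ with morphisms $A_i\to B_{\varphi(i)}$ such that $\{A_i\to B_j\}_{i\in \varphi^{-1}(j)}$ is a disjoint covering family for every $j$. For a pointed set $X$ let $X\wedge\mathcal A$ be the wedge of copies of $\mathcal A$ indexed by the points of $X$ other than the base point. The assembler $K$-theory spectrum $K^Z(\mathcal A)$ has as $k$-th space the realization $|\mathcal W((S^1_\bullet)^{\wedge k}\wedge\mathcal A)|$, where $S^1_\bullet=\Delta[1]/\partial\Delta[1]$.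 Then the spectra $K^C(\mathrm{Sch}^n_{rfw})$ and $K^Z(\mathrm{Sch}^n_{rf})$ are equivalent: \[K^C(\mathrm{Sch}^n_{rfw})\simeq K^Z(\mathrm{Sch}^n_{rf}).\] More precisely, they are connected by a zigzag of maps of spectra that are weak homotopy equivalences in every level (so that they are in particular stably equivalent, and the spaces $|wS_\bullet\mathrm{Sch}^n_{rfw}|$ and $|\mathcal W(S^1_\bullet\wedge \mathrm{Sch}^n_{rf})|$ are weakly equivalent). -/

import Mathlib

universe w v u

namespace KTheory

open CategoryTheory Limits Simplicial Opposite

set_option linter.unusedVariables false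
set_option linter.checkUnivs false

/-! ### Simplicial sets and spectra -/

/-- Weak homotopy equivalences of simplicial sets: `f : X ⟶ Y` is one if and only if for every Kan
complex `K` composition with `f` is a bijection `[Y, K] → [X, K]` of simplicial homotopy classes
(simplicial homotopy is an equivalence relation on maps into a Kan complex). -/
def IsWeakEquiv {X Y : SSet.{w}} (f : X ⟶ Y) : Prop :=
  ∀ (K : SSet.{w}) [SSet.KanComplex K],
    (∀ g : X ⟶ K, ∃ h : Y ⟶ K, Nonempty (SSet.Homotopy (f ≫ h) g)) ∧
    ∀ h h' : Y ⟶ K, Nonempty (SSet.Homotopy (f ≫ h) (f ≫ h')) → Nonempty (SSet.Homotopy h h')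

/-- A simplex of `Δ[1]` that lies in `∂Δ[1]`, that is, a constant monotone map `[m] → [1]`. -/
def IsConst {m : SimplexCategory} (s : m ⟶ ⦋1⦌) : Prop :=
  ∀ i j, s.toOrderHom i = s.toOrderHom j

/-- Sequential spectra of simplicial sets: pointed simplicial sets `space k` together with pointed maps
`S¹ ∧ space k ⟶ space (k + 1)`, where `S¹ = Δ[1] / ∂Δ[1]`. The structure map is written as a
simplicial map `susp k : Δ[1] × space k ⟶ space (k + 1)` that sends `∂Δ[1] × space k` and
`Δ[1] × {pt}` to the base point. -/
structure Spectrum where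
  space : ℕ → SSet.{w}
  pt : ∀ k m, (space k).obj m
  map_pt : ∀ k {m m' : SimplexCategoryᵒᵖ} (θ : m ⟶ m'), (space k).map θ (pt k m) = pt k m'
  susp : ∀ k {m : SimplexCategoryᵒᵖ}, (m.unop ⟶ ⦋1⦌) → (space k).obj m → (space (k + 1)).obj m
  map_susp : ∀ k {m m' : SimplexCategoryᵒᵖ} (θ : m ⟶ m') (s : m.unop ⟶ ⦋1⦌) (x : (space k).obj m),
    (space (k + 1)).map θ (susp k s x) = susp k (θ.unop ≫ s) ((space k).map θ x)
  susp_const : ∀ k {m : SimplexCategoryᵒᵖ} (s : m.unop ⟶ ⦋1⦌) (x : (space k).obj m),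
    IsConst s → susp k s x = pt (k + 1) m
  susp_pt : ∀ k {m : SimplexCategoryᵒᵖ} (s : m.unop ⟶ ⦋1⦌), susp k s (pt k m) = pt (k + 1) m

/-- Maps of spectra: pointed maps in all levels that commute with the structure maps. -/
structure Spectrum.Hom (E F : Spectrum.{w}) where
  map : ∀ k, E.space k ⟶ F.space k
  map_pt : ∀ k m, (map k).app m (E.pt k m) = F.pt k m
  map_susp : ∀ k {m : SimplexCategoryᵒᵖ} (s : m.unop ⟶ ⦋1⦌) (x : (E.space k).obj m),
    (map (k + 1)).app m (E.susp k s x) = F.susp k s ((map k).app m x)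

/-- Two spectra are equivalent: they are connected by a zigzag of maps of spectra which are weak
homotopy equivalences in every level. Such maps are in particular stable equivalences. -/
def Spectrum.LevelEquivalent : Spectrum.{w} → Spectrum.{w} → Prop :=
  Relation.EqvGen fun E F => ∃ f : E.Hom F, ∀ k, IsWeakEquiv (f.map k)

/-- The diagonal of a bisimplicial set. -/
def diag (B : SimplexCategoryᵒᵖ ⥤ SSet.{w}) : SSet.{w} where
  obj m := (B.obj m).obj m
  map {m m'} θ := (B.map θ).app m ≫ (B.obj m').map θ

/-- A sequence of pointed simplicial categories `cat k` with pointed simplicial structure functors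
indexed by the simplices of `S¹ = Δ[1] / ∂Δ[1]`. -/
structure SimplicialCatSpectrum where
  cat : ℕ → SimplexCategoryᵒᵖ ⥤ Cat.{v, u}
  pt : ∀ k m, (cat k).obj m
  map_pt : ∀ k {m m' : SimplexCategoryᵒᵖ} (θ : m ⟶ m'),
    ((cat k).map θ).toFunctor.obj (pt k m) = pt k m'
  susp : ∀ k {m : SimplexCategoryᵒᵖ}, (m.unop ⟶ ⦋1⦌) → ((cat k).obj m ⥤ (cat (k + 1)).obj m)
  map_susp : ∀ k {m m' : SimplexCategoryᵒᵖ} (θ : m ⟶ m') (s : m.unop ⟶ ⦋1⦌),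
    susp k s ⋙ ((cat (k + 1)).map θ).toFunctor =
      ((cat k).map θ).toFunctor ⋙ susp k (θ.unop ≫ s)
  susp_const : ∀ k {m : SimplexCategoryᵒᵖ} (s : m.unop ⟶ ⦋1⦌),
    IsConst s → susp k s = (Functor.const _).obj (pt (k + 1) m)
  susp_pt : ∀ k {m : SimplexCategoryᵒᵖ} (s : m.unop ⟶ ⦋1⦌),
    (susp k s).obj (pt k m) = pt (k + 1) m

lemma const_comp_eq {J A B : Type*} [Category J] [Category A] [Category B] (F : A ⥤ B)
    {a : A} {b : B} (h : F.obj a = b) :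
    (Functor.const J).obj a ⋙ F = (Functor.const J).obj b := by
  subst h
  exact CategoryTheory.Functor.ext (fun _ => rfl) (by simp)

/-- The spectrum whose `k`-th space is the diagonal of the levelwise nerve of the simplicial category
`cat k`; it is a model of the geometric realization `|N cat k|`. -/
def SimplicialCatSpectrum.toSpectrum (T : SimplicialCatSpectrum.{v, u}) :
    Spectrum.{max u v} where
  space k := diag (T.cat k ⋙ nerveFunctor)
  pt k m := (Functor.const (Fin (m.unop.len + 1))).obj (T.pt k m)
  map_pt k m m' θ := by
    have := const_comp_eq (J := Fin (m'.unop.len + 1)) ((T.cat k).map θ).toFunctor (T.map_pt k θ)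
    exact this
  susp k m s x := Functor.comp (C := Fin (m.unop.len + 1)) x (T.susp k s)
  map_susp k m m' θ s x := by
    have := congrArg (fun F => (SimplexCategory.toCat.map θ.unop).toFunctor ⋙
      Functor.comp (C := Fin (m.unop.len + 1)) x F) (T.map_susp k θ s)
    exact this
  susp_const k m s x h := by
    change Functor.comp (C := Fin (m.unop.len + 1)) x (T.susp k s) = _
    rw [T.susp_const k s h]
    rfl
  susp_pt k m s := const_comp_eq (J := Fin (m.unop.len + 1)) (T.susp k s) (T.susp_pt k s)

/-! ### SW-categories -/

/-- The data of a subtractive category with weak equivalences that enter its `K`-theory: a chosen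
initial object, the subtraction sequences `X ↪ Y ← Y ∖ X` (the cofibrations and the complement maps
are the two kinds of legs), and the subcategory of weak equivalences. -/
structure SWData (C : Type u) [Category.{v} C] where
  zero : C
  isInitial : IsInitial zero
  IsSub : ∀ {X Y Z : C}, (X ⟶ Y) → (Z ⟶ Y) → Prop
  weq : MorphismProperty C
  weq_mult : weq.IsMultiplicative
  sub_id_zero : ∀ X : C, IsSub (𝟙 X) (isInitial.to X)
  sub_zero_id : ∀ X : C, IsSub (isInitial.to X) (𝟙 X)

/-- The `k`-fold product of the poset of intervals `[i, j]`, `0 ≤ i ≤ j ≤ m`, ordered by inclusion.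
(For `k = 1` this is the indexing category of the `S`-construction, with arrows
`(i, j) → (i, l) ← (j, l)` for `i ≤ j ≤ l`.) -/
def Box (k m : ℕ) : Type := Fin k → NonemptyInterval (Fin (m + 1))

instance (k m : ℕ) : Preorder (Box k m) :=
  inferInstanceAs (Preorder (Fin k → NonemptyInterval (Fin (m + 1))))

/-- A monotone map `[m] → [m']` acts on intervals by `[i, j] ↦ [θ i, θ j]`, in each coordinate. -/
def boxMap (k : ℕ) {m m' : SimplexCategory} (θ : m ⟶ m') : Box k m.len ⥤ Box k m'.len :=
  Monotone.functor (f := fun (I : Box k m.len) a => (I a).map θ.toOrderHom) fun _ _ h a =>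
    ⟨θ.toOrderHom.monotone (h a).1, θ.toOrderHom.monotone (h a).2⟩

/-- Forget the first interval. -/
def Box.tail {k m : ℕ} (I : Box (k + 1) m) : Box k m := fun a => I a.succ

lemma Box.tail_mono {k m : ℕ} {I J : Box (k + 1) m} (h : I ≤ J) : I.tail ≤ J.tail :=
  fun a => h (Fin.succ a)

namespace SWData

variable {C : Type u} [Category.{v} C] (D : SWData C)

/-- Objects of the `k`-fold iterated `S`-construction in multidegree `(m, …, m)`: diagrams of objects
`X_I`, indexed by `k`-tuples `I` of intervals, that are in each coordinate separately an object of
the `S`-construction: `X_{[i,i]}` is the chosen initial object, and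
`X_{[i,j]} ↪ X_{[i,l]} ← X_{[j,l]}` is a subtraction sequence for all `i ≤ j ≤ l`. (Choices of all
the differences are part of the data.) For `k = 0` this is just an object of the category. -/
structure SObj (k m : ℕ) where
  toFunctor : Box k m ⥤ C
  obj_eq_zero : ∀ (I : Box k m) (a : Fin k), (I a).fst = (I a).snd → toFunctor.obj I = D.zero
  isSub : ∀ (a : Fin k) (P Q R : Box k m) (hP : P ≤ Q) (hR : R ≤ Q),
    (∀ b, b ≠ a → P b = Q b ∧ R b = Q b) →
    (P a).fst = (Q a).fst → (P a).snd = (R a).fst → (R a).snd = (Q a).snd →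
    D.IsSub (toFunctor.map (homOfLE hP)) (toFunctor.map (homOfLE hR))

/-- Morphisms of the category `wS`: natural transformations whose components are weak equivalences. -/
@[ext]
structure SHom {k m : ℕ} (X Y : D.SObj k m) where
  nat : X.toFunctor ⟶ Y.toFunctor
  weq : ∀ I, D.weq (nat.app I)

instance (k m : ℕ) : Category (D.SObj k m) where
  Hom X Y := D.SHom X Y
  id X := ⟨𝟙 _, fun _ => D.weq_mult.id_mem _⟩
  comp f g := ⟨f.nat ≫ g.nat, fun I => D.weq_mult.comp_mem _ _ (f.weq I) (g.weq I)⟩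

lemma SObj.hom_ext {k m : ℕ} {X Y : D.SObj k m} {f g : X ⟶ Y}
    (h : ∀ I, (SHom.nat f).app I = (SHom.nat g).app I) : f = g :=
  SHom.ext (NatTrans.ext (funext h))

/-- The simplicial structure of the iterated `S`-construction: restriction along `[m] → [m']`. -/
def restrict (k : ℕ) {m m' : SimplexCategory} (θ : m ⟶ m') :
    D.SObj k m'.len ⥤ D.SObj k m.len where
  obj X :=
    { toFunctor := boxMap k θ ⋙ X.toFunctor
      obj_eq_zero := fun I a h => X.obj_eq_zero _ a (congrArg θ.toOrderHom h)
      isSub := fun a P Q R hP hR h h1 h2 h3 =>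
        X.isSub a _ _ _ ((boxMap k θ).map (homOfLE hP)).le ((boxMap k θ).map (homOfLE hR)).le
          (fun b hb => ⟨congrArg (NonemptyInterval.map θ.toOrderHom) (h b hb).1,
            congrArg (NonemptyInterval.map θ.toOrderHom) (h b hb).2⟩)
          (congrArg θ.toOrderHom h1) (congrArg θ.toOrderHom h2) (congrArg θ.toOrderHom h3) }
  map f := ⟨Functor.whiskerLeft _ (SHom.nat f), fun _ => SHom.weq f _⟩

/-- The simplicial category `m ↦ wS⁽ᵏ⁾_{m,…,m}`, the multidiagonal of the `k`-fold iterated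
`S`-construction. -/
def sCat (k : ℕ) : SimplexCategoryᵒᵖ ⥤ Cat.{v, max u v} where
  obj m := Cat.of (D.SObj k m.unop.len)
  map θ := (D.restrict k θ.unop).toCatHom

/-- The base point: the constant diagram on the initial object. -/
def sPt (k m : ℕ) : D.SObj k m where
  toFunctor := (Functor.const _).obj D.zero
  obj_eq_zero _ _ _ := rfl
  isSub _ _ _ _ _ _ _ _ _ _ := by
    have := D.sub_id_zero D.zero
    rwa [D.isInitial.hom_ext (D.isInitial.to D.zero) (𝟙 _)] at this

/-- The image of the first interval of `I` under `s : [m] → [1]` is the interval `[0, 1]` of `[1]`, and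
not a degenerate one. -/
def IsActive {k : ℕ} {m : SimplexCategory} (s : m ⟶ ⦋1⦌) (I : Box (k + 1) m.len) : Prop :=
  s.toOrderHom (I 0).fst = 0 ∧ s.toOrderHom (I 0).snd = 1

lemma IsActive.mono {k : ℕ} {m : SimplexCategory} {s : m ⟶ ⦋1⦌} {I J : Box (k + 1) m.len}
    (h : IsActive s I) (hIJ : I ≤ J) : IsActive s J := by
  have h1 : s.toOrderHom (J 0).fst ≤ s.toOrderHom (I 0).fst := s.toOrderHom.monotone (hIJ 0).1
  have h2 : s.toOrderHom (I 0).snd ≤ s.toOrderHom (J 0).snd := s.toOrderHom.monotone (hIJ 0).2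
  rw [h.1] at h1
  rw [h.2] at h2
  exact ⟨le_antisymm h1 (Fin.zero_le _), le_antisymm (Fin.le_last _) h2⟩

section

open Classical in
/-- The structure map `S¹ ∧ wS⁽ᵏ⁾ → wS⁽ᵏ⁺¹⁾`: an object `X` of `wS⁽ᵏ⁾` is the object of
`S_1(wS⁽ᵏ⁾)` with value `X` at `[0, 1]` and the initial object at `[0, 0]` and `[1, 1]`, and a
simplex `s : [m] → [1]` of `Δ[1]` pulls it back to degree `m` in the new, first coordinate. -/
noncomputable def suspObj {k : ℕ} {m : SimplexCategory} (s : m ⟶ ⦋1⦌) (X : Box k m.len ⥤ C)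
    (I : Box (k + 1) m.len) : C :=
  if IsActive s I then X.obj I.tail else D.zero

variable {k : ℕ} {m : SimplexCategory} (s : m ⟶ ⦋1⦌)

lemma suspObj_pos (X : Box k m.len ⥤ C) {I : Box (k + 1) m.len} (h : IsActive s I) :
    D.suspObj s X I = X.obj I.tail := if_pos h

lemma suspObj_neg (X : Box k m.len ⥤ C) {I : Box (k + 1) m.len} (h : ¬ IsActive s I) :
    D.suspObj s X I = D.zero := if_neg h

open Classical in
noncomputable def suspMap (X : Box k m.len ⥤ C) {I J : Box (k + 1) m.len} (hIJ : I ≤ J) :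
    D.suspObj s X I ⟶ D.suspObj s X J :=
  if h : IsActive s I then
    eqToHom (D.suspObj_pos s X h) ≫ X.map (homOfLE (Box.tail_mono hIJ)) ≫
      eqToHom (D.suspObj_pos s X (h.mono hIJ)).symm
  else eqToHom (D.suspObj_neg s X h) ≫ D.isInitial.to _

lemma suspMap_pos (X : Box k m.len ⥤ C) {I J : Box (k + 1) m.len} (hIJ : I ≤ J)
    (h : IsActive s I) : D.suspMap s X hIJ = eqToHom (D.suspObj_pos s X h) ≫
      X.map (homOfLE (Box.tail_mono hIJ)) ≫ eqToHom (D.suspObj_pos s X (h.mono hIJ)).symm :=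
  dif_pos h

lemma hom_ext_of_eq_zero {A B : C} (h : A = D.zero) (f g : A ⟶ B) : f = g := by
  subst h
  exact D.isInitial.hom_ext f g

lemma suspObj_hom_ext (X : Box k m.len ⥤ C) {I : Box (k + 1) m.len} (h : ¬ IsActive s I) {Y : C}
    (f g : D.suspObj s X I ⟶ Y) : f = g :=
  D.hom_ext_of_eq_zero (D.suspObj_neg s X h) f g

noncomputable def suspFunctor (X : Box k m.len ⥤ C) : Box (k + 1) m.len ⥤ C where
  obj I := D.suspObj s X I
  map f := D.suspMap s X f.le
  map_id I := by
    by_cases h : IsActive s I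
    · rw [D.suspMap_pos s X _ h]
      simp
    · exact D.suspObj_hom_ext s X h _ _
  map_comp {I J K} f g := by
    by_cases h : IsActive s I
    · rw [D.suspMap_pos s X _ h, D.suspMap_pos s X _ h, D.suspMap_pos s X _ (h.mono f.le)]
      simp [← Functor.map_comp_assoc]
    · exact D.suspObj_hom_ext s X h _ _

lemma isSub_congr {A B E A' B' E' : C} {i : A ⟶ B} {j : E ⟶ B} (h : D.IsSub i j)
    (hA : A' = A) (hB : B' = B) (hE : E' = E) {i' : A' ⟶ B'} {j' : E' ⟶ B'}
    (hi : i' = eqToHom hA ≫ i ≫ eqToHom hB.symm) (hj : j' = eqToHom hE ≫ j ≫ eqToHom hB.symm) :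
    D.IsSub i' j' := by
  subst hA hB hE
  simp only [eqToHom_refl, Category.id_comp, Category.comp_id] at hi hj
  rwa [hi, hj]

lemma isSub_zero (A B E : C) (hA : A = D.zero) (hB : B = D.zero) (hE : E = D.zero)
    (i : A ⟶ B) (j : E ⟶ B) : D.IsSub i j := by
  subst hA hB hE
  have := D.sub_id_zero D.zero
  rwa [D.isInitial.hom_ext (D.isInitial.to _) j, D.isInitial.hom_ext (𝟙 _) i] at this

noncomputable def suspSObj (X : D.SObj k m.len) : D.SObj (k + 1) m.len where
  toFunctor := D.suspFunctor s X.toFunctor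
  obj_eq_zero I a hI := by
    change D.suspObj s X.toFunctor I = _
    by_cases h : IsActive s I
    · rw [D.suspObj_pos s _ h]
      induction a using Fin.cases with
      | zero => exact absurd (h.1.symm.trans ((congrArg _ hI).trans h.2)) (by decide)
      | succ a => exact X.obj_eq_zero _ a hI
    · exact D.suspObj_neg s _ h
  isSub a P Q R hP hR hb h1 h2 h3 := by
    change D.IsSub (D.suspMap s X.toFunctor hP) (D.suspMap s X.toFunctor hR)
    by_cases hQ : IsActive s Q
    swap
    · exact D.isSub_zero _ _ _ (D.suspObj_neg s _ fun h => hQ (h.mono hP)) (D.suspObj_neg s _ hQ)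
        (D.suspObj_neg s _ fun h => hQ (h.mono hR)) _ _
    induction a using Fin.cases with
    | succ a =>
      have hP0 := (hb 0 (Fin.succ_ne_zero a).symm).1
      have hR0 := (hb 0 (Fin.succ_ne_zero a).symm).2
      have hPa : IsActive s P := by unfold IsActive; rw [hP0]; exact hQ
      have hRa : IsActive s R := by unfold IsActive; rw [hR0]; exact hQ
      refine D.isSub_congr (X.isSub a P.tail Q.tail R.tail (Box.tail_mono hP) (Box.tail_mono hR)
        (fun b hba => hb b.succ fun h => hba (Fin.succ_injective _ h)) h1 h2 h3)
        (D.suspObj_pos s _ hPa) (D.suspObj_pos s _ hQ) (D.suspObj_pos s _ hRa)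
        (D.suspMap_pos s _ hP hPa) (D.suspMap_pos s _ hR hRa)
    | zero =>
      have hPt : P.tail = Q.tail := funext fun b => (hb b.succ (Fin.succ_ne_zero b)).1
      have hRt : R.tail = Q.tail := funext fun b => (hb b.succ (Fin.succ_ne_zero b)).2
      by_cases hPa : IsActive s P
      · have hRa : ¬ IsActive s R := fun h => absurd
          (hPa.2.symm.trans ((congrArg s.toOrderHom h2).trans h.1)) (by decide)
        refine D.isSub_congr (D.sub_id_zero (X.toFunctor.obj Q.tail))
          ((D.suspObj_pos s _ hPa).trans (by rw [hPt])) (D.suspObj_pos s _ hQ)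
          (D.suspObj_neg s _ hRa) ?_ (D.suspObj_hom_ext s _ hRa _ _)
        rw [D.suspMap_pos s _ hP hPa]
        have : X.toFunctor.map (homOfLE (Box.tail_mono hP)) = eqToHom (by rw [hPt]) := by
          rw [← eqToHom_map X.toFunctor hPt]
          rfl
        simp [this]
      · have hRa : IsActive s R := by
          refine ⟨?_, (congrArg s.toOrderHom h3).trans hQ.2⟩
          by_contra hne
          refine hPa ⟨(congrArg s.toOrderHom h1).trans hQ.1, (congrArg s.toOrderHom h2).trans ?_⟩
          exact (Fin.eq_one_of_ne_zero _ hne)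
        refine D.isSub_congr (D.sub_zero_id (X.toFunctor.obj Q.tail))
          (D.suspObj_neg s _ hPa) (D.suspObj_pos s _ hQ)
          ((D.suspObj_pos s _ hRa).trans (by rw [hRt])) (D.suspObj_hom_ext s _ hPa _ _) ?_
        rw [D.suspMap_pos s _ hR hRa]
        have : X.toFunctor.map (homOfLE (Box.tail_mono hR)) = eqToHom (by rw [hRt]) := by
          rw [← eqToHom_map X.toFunctor hRt]
          rfl
        simp [this]

open Classical in
noncomputable def suspApp {X Y : Box k m.len ⥤ C} (f : X ⟶ Y) (I : Box (k + 1) m.len) :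
    D.suspObj s X I ⟶ D.suspObj s Y I :=
  if h : IsActive s I then
    eqToHom (D.suspObj_pos s X h) ≫ f.app I.tail ≫ eqToHom (D.suspObj_pos s Y h).symm
  else eqToHom ((D.suspObj_neg s X h).trans (D.suspObj_neg s Y h).symm)

lemma suspApp_pos {X Y : Box k m.len ⥤ C} (f : X ⟶ Y) {I : Box (k + 1) m.len}
    (h : IsActive s I) : D.suspApp s f I = eqToHom (D.suspObj_pos s X h) ≫ f.app I.tail ≫
      eqToHom (D.suspObj_pos s Y h).symm := dif_pos h

lemma weq_eqToHom {A B : C} (h : A = B) : D.weq (eqToHom h) := by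
  subst h
  exact D.weq_mult.id_mem _

noncomputable def suspSFunctor : D.SObj k m.len ⥤ D.SObj (k + 1) m.len where
  obj X := D.suspSObj s X
  map {X Y} f :=
    { nat :=
        { app := fun I => D.suspApp s (SHom.nat f) I
          naturality := fun I J g => by
            change D.suspMap s _ g.le ≫ _ = _ ≫ D.suspMap s _ g.le
            by_cases h : IsActive s I
            · rw [D.suspMap_pos s _ _ h, D.suspMap_pos s _ _ h, D.suspApp_pos s _ h,
                D.suspApp_pos s _ (h.mono g.le)]
              simp
            · exact D.suspObj_hom_ext s _ h _ _ }
      weq := fun I => by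
        change D.weq (D.suspApp s (SHom.nat f) I)
        by_cases h : IsActive s I
        · rw [D.suspApp_pos s _ h]
          exact D.weq_mult.comp_mem _ _ (D.weq_eqToHom _)
            (D.weq_mult.comp_mem _ _ (SHom.weq f _) (D.weq_eqToHom _))
        · rw [suspApp, dif_neg h]
          exact D.weq_eqToHom _ }
  map_id X := by
    refine SObj.hom_ext D fun I => ?_
    change D.suspApp s (𝟙 X.toFunctor) I = 𝟙 (D.suspObj s X.toFunctor I)
    by_cases h : IsActive s I
    · rw [D.suspApp_pos s _ h]
      simp
    · exact D.suspObj_hom_ext s _ h _ _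
  map_comp {X Y Z} f g := by
    refine SObj.hom_ext D fun I => ?_
    change D.suspApp s (SHom.nat f ≫ SHom.nat g) I =
      D.suspApp s (SHom.nat f) I ≫ D.suspApp s (SHom.nat g) I
    by_cases h : IsActive s I
    · rw [D.suspApp_pos s _ h, D.suspApp_pos s _ h, D.suspApp_pos s _ h]
      simp
    · exact D.suspObj_hom_ext s _ h _ _

end

lemma SObj.ext' {k m : ℕ} {X Y : D.SObj k m} (h : X.toFunctor = Y.toFunctor) : X = Y := by
  cases X; cases Y; cases h; rfl

lemma not_isActive_of_isConst {k : ℕ} {m : SimplexCategory} {s : m ⟶ ⦋1⦌} (hs : IsConst s)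
    (I : Box (k + 1) m.len) : ¬ IsActive s I := fun h =>
  absurd (h.1.symm.trans ((hs _ _).trans h.2)) (by decide)

lemma suspSObj_eq_pt {k : ℕ} {m : SimplexCategory} (s : m ⟶ ⦋1⦌) (X : D.SObj k m.len)
    (h : ∀ I, D.suspObj s X.toFunctor I = D.zero) : D.suspSObj s X = D.sPt (k + 1) m.len := by
  refine SObj.ext' D (CategoryTheory.Functor.ext h fun I J f => ?_)
  exact D.hom_ext_of_eq_zero (h I) _ _

/-- The `K`-theory spectrum: the `k`-th space is `|wS⁽ᵏ⁾|`. In particular the level `1` is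
`|wS_•|`, whose loop space is the `K`-theory space. -/
noncomputable def kSpectrum : SimplicialCatSpectrum.{v, max u v} where
  cat k := D.sCat k
  pt k m := D.sPt k m.unop.len
  map_pt k m m' θ := rfl
  susp k m s := D.suspSFunctor s
  map_susp k m m' θ s := rfl
  susp_const k m s hs := by
    refine CategoryTheory.Functor.ext
      (fun X => D.suspSObj_eq_pt s X fun I => D.suspObj_neg s _ (not_isActive_of_isConst hs I))
      fun X Y f => SObj.hom_ext D fun I => ?_
    exact D.suspObj_hom_ext s _ (not_isActive_of_isConst hs I) _ _
  susp_pt k m s := D.suspSObj_eq_pt s _ fun I => ite_self _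

end SWData

/-! ### Assemblers -/

/-- The data of an assembler that enter its `K`-theory: a category all of whose morphisms are
monomorphisms, with an initial object that is covered by the empty family, and with a Grothendieck
topology. -/
structure AssemblerData (C : Type u) [Category.{v} C] where
  top : GrothendieckTopology C
  empty : C
  isInitial : IsInitial empty
  empty_mem : (⊥ : Sieve empty) ∈ top empty
  mono : ∀ {X Y : C} (f : X ⟶ Y), Mono f

namespace AssemblerData

variable {C : Type u} [Category.{v} C] (A : AssemblerData C)

/-- Two morphisms with the same target are disjoint if their pullback is the initial object. -/
def Disjoint {X Y Z : C} (f : X ⟶ Z) (g : Y ⟶ Z) : Prop :=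
  IsPullback (A.isInitial.to X) (A.isInitial.to Y) f g

/-- Disjoint covering families: the family generates a covering sieve and its members are pairwise
disjoint. -/
structure IsDisjointCover {ι : Type} {Z : C} (X : ι → C) (f : ∀ i, X i ⟶ Z) : Prop where
  cover : Sieve.ofArrows X f ∈ A.top Z
  disjoint : ∀ i j, i ≠ j → A.Disjoint (f i) (f j)

lemma subsingleton_to_empty {T : C} (f g : T ⟶ A.empty) : f = g := by
  have := A.mono f
  have h : f ≫ A.isInitial.to T = 𝟙 T := by
    rw [← cancel_mono f, Category.assoc, A.isInitial.hom_ext (A.isInitial.to T ≫ f) (𝟙 _)]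
    simp
  have hg : g = f ≫ A.isInitial.to T ≫ g := by rw [← Category.assoc, h, Category.id_comp]
  rw [hg, A.isInitial.hom_ext (A.isInitial.to T ≫ g) (𝟙 _), Category.comp_id]

lemma to_empty_comp {T X : C} (f : T ⟶ A.empty) (g : T ⟶ X) : f ≫ A.isInitial.to X = g := by
  have := A.mono f
  have h : f ≫ A.isInitial.to T = 𝟙 T := A.mono f |>.right_cancellation _ _
    (A.subsingleton_to_empty _ _)
  rw [A.isInitial.hom_ext (A.isInitial.to X) (A.isInitial.to T ≫ g), ← Category.assoc, h,
    Category.id_comp]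

lemma disjoint_iff {X Y Z : C} (f : X ⟶ Z) (g : Y ⟶ Z) :
    A.Disjoint f g ↔
      ∀ (T : C) (a : T ⟶ X) (b : T ⟶ Y), a ≫ f = b ≫ g → Nonempty (T ⟶ A.empty) := by
  refine ⟨fun h T a b hab => ⟨h.lift a b hab⟩, fun h => ⟨⟨A.isInitial.hom_ext _ _⟩, ⟨?_⟩⟩⟩
  exact PullbackCone.IsLimit.mk _ (fun s => (h _ s.fst s.snd s.condition).some)
    (fun s => A.to_empty_comp _ _) (fun s => A.to_empty_comp _ _)
    (fun s m _ _ => A.subsingleton_to_empty _ _)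

lemma IsDisjointCover.reindex {ι κ : Type} {Z : C} {X : κ → C} {f : ∀ i, X i ⟶ Z}
    (h : A.IsDisjointCover X f) (e : ι ≃ κ) :
    A.IsDisjointCover (fun i => X (e i)) (fun i => f (e i)) where
  cover := by
    refine A.top.superset_covering ?_ h.cover
    rw [Sieve.ofArrows, Sieve.generate_le_iff]
    rintro _ _ ⟨i⟩
    obtain ⟨i, rfl⟩ := e.surjective i
    exact Sieve.ofArrows_mk (fun i => X (e i)) (fun i => f (e i)) i
  disjoint i j hij := h.disjoint _ _ (e.injective.ne hij)

lemma isDisjointCover_id {ι : Type} [Unique ι] {Z : C} (X : ι → C) (f : ∀ i, X i ⟶ Z)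
    (h : ∀ i, IsIso (f i)) : A.IsDisjointCover X f where
  cover := by
    refine A.top.superset_covering (S := ⊤) (fun Y g _ => ?_) (A.top.top_mem _)
    have := h default
    have hg := (Sieve.ofArrows X f).downward_closed (Sieve.ofArrows_mk X f default)
      (g ≫ inv (f default))
    simpa using hg
  disjoint i j hij := absurd (Subsingleton.elim i j) hij

lemma IsDisjointCover.comp {ι κ : Type} {Z : C} {X : ι → C} {Y : κ → C} (p : ι → κ)
    (f : ∀ i, X i ⟶ Y (p i)) (g : ∀ j, Y j ⟶ Z) (hg : A.IsDisjointCover Y g)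
    (hf : ∀ j, A.IsDisjointCover (fun i : {i // p i = j} => X i.1)
      (fun i => f i.1 ≫ eqToHom (congrArg Y i.2))) :
    A.IsDisjointCover X (fun i => f i ≫ g (p i)) where
  cover := by
    refine A.top.transitive hg.cover _ ?_
    rintro W _ ⟨_, a, _, ⟨j⟩, rfl⟩
    rw [Sieve.pullback_comp]
    refine A.top.pullback_stable _ (A.top.superset_covering ?_ (hf j).cover)
    rw [Sieve.ofArrows, Sieve.generate_le_iff]
    rintro _ _ ⟨i, rfl⟩
    simpa using Sieve.ofArrows_mk X (fun i => f i ≫ g (p i)) i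
  disjoint i j hij := by
    rw [disjoint_iff]
    intro T a b hab
    by_cases h : p i = p j
    · refine ((A.disjoint_iff _ _).1 ((hf (p j)).disjoint ⟨i, h⟩ ⟨j, rfl⟩
        fun e => hij (congrArg Subtype.val e))) T a b ?_
      have := A.mono (g (p j))
      rw [← cancel_mono (g (p j))]
      have hh : eqToHom (congrArg Y h) ≫ g (p j) = g (p i) := by
        generalize p i = x at h
        subst h
        simp
      simpa [hh] using hab
    · exact ((A.disjoint_iff _ _).1 (hg.disjoint _ _ h)) T (a ≫ f i) (b ≫ f j) (by simpa using hab)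

/-- Finite families of non-initial objects, labelled by the non-base points of the pointed set `E / B`.
The finite index sets are the finite sets of natural numbers. -/
structure Fam (E : Type) (B : Set E) where
  idx : Set ℕ
  finite : idx.Finite
  obj : idx → C
  not_initial : ∀ i, IsEmpty (IsInitial (obj i))
  label : idx → E
  label_notMem : ∀ i, label i ∉ B

variable {E : Type} {B : Set E}

/-- Morphisms `{X_i}_{i ∈ I} → {Y_j}_{j ∈ J}`: a map of the index sets that respects the labels, and
morphisms `X_i ⟶ Y_j` over it such that for every `j` the family of those with target `Y_j` is a
disjoint covering family. -/
structure FamHom (a b : Fam (C := C) E B) where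
  idxMap : a.idx → b.idx
  hom : ∀ i, a.obj i ⟶ b.obj (idxMap i)
  label_eq : ∀ i, b.label (idxMap i) = a.label i
  cover : ∀ j, A.IsDisjointCover (fun i : {i // idxMap i = j} => a.obj i.1)
    (fun i => hom i.1 ≫ eqToHom (congrArg b.obj i.2))

lemma FamHom.ext' {a b : Fam (C := C) E B} {f g : A.FamHom a b} (h : ∀ i, f.idxMap i = g.idxMap i)
    (h' : ∀ i, f.hom i ≫ eqToHom (congrArg b.obj (h i)) = g.hom i) : f = g := by
  obtain ⟨p, f, _, _⟩ := f
  obtain ⟨q, g, _, _⟩ := g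
  obtain rfl : p = q := funext h
  obtain rfl : f = g := funext fun i => by simpa using h' i
  rfl

/-- The category `W(X ∧ A)` for the pointed set `X = E / B`, where `X ∧ A` is the wedge of copies of the
assembler `A` indexed by the non-base points of `X`. -/
def W (_ : AssemblerData C) (E : Type) (B : Set E) : Type u := Fam (C := C) E B

instance : Category (A.W E B) where
  Hom a b := A.FamHom (a : Fam E B) b
  id a :=
    { idxMap := id
      hom := fun i => 𝟙 _
      label_eq := fun _ => rfl
      cover := fun j =>
        haveI : Unique {i // id i = j} := ⟨⟨⟨j, rfl⟩⟩, fun i => Subtype.ext i.2⟩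
        A.isDisjointCover_id _ _ fun _ => inferInstance }
  comp {a b c} f g :=
    { idxMap := g.idxMap ∘ f.idxMap
      hom := fun i => f.hom i ≫ g.hom (f.idxMap i)
      label_eq := fun i => (g.label_eq _).trans (f.label_eq i)
      cover := fun j => by
        have := IsDisjointCover.comp A
          (fun i : {i // g.idxMap (f.idxMap i) = j} => (⟨f.idxMap i.1, i.2⟩ : {i // g.idxMap i = j}))
          (fun i => f.hom i.1) _ (g.cover j) (fun k => by
            let e : {i : {i // g.idxMap (f.idxMap i) = j} //
                (⟨f.idxMap i.1, i.2⟩ : {i // g.idxMap i = j}) = k} ≃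
                {i // f.idxMap i = k.1} :=
              { toFun := fun i => ⟨i.1.1, congrArg Subtype.val i.2⟩
                invFun := fun i => ⟨⟨i.1, by rw [i.2]; exact k.2⟩, Subtype.ext i.2⟩
                left_inv := fun _ => rfl
                right_inv := fun _ => rfl }
            exact IsDisjointCover.reindex A (f.cover k.1) e)
        simpa using this }
  id_comp f := FamHom.ext' A (fun _ => rfl) (by simp)
  comp_id f := FamHom.ext' A (fun _ => rfl) (by simp)
  assoc f g h := FamHom.ext' A (fun _ => rfl) (by simp)

section

variable {E' : Type} {B' : Set E'}

/-- The functor `W(E / B ∧ A) ⥤ W(E' / B' ∧ A)` induced by a pointed map: it changes the labels and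
deletes the members of a family whose label goes to the base point. -/
def wMap (φ : E → E') : A.W E B ⥤ A.W E' B' where
  obj a :=
    { idx := {i | ∃ h : i ∈ Fam.idx a, φ (Fam.label a ⟨i, h⟩) ∉ B'}
      finite := (Fam.finite a).subset fun _ h => h.1
      obj := fun i => Fam.obj a ⟨i.1, i.2.1⟩
      not_initial := fun i => Fam.not_initial a _
      label := fun i => φ (Fam.label a ⟨i.1, i.2.1⟩)
      label_notMem := fun i => i.2.2 }
  map {a b} f :=
    { idxMap := fun i => ⟨(FamHom.idxMap f ⟨i.1, i.2.1⟩).1, (FamHom.idxMap f ⟨i.1, i.2.1⟩).2, by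
        rw [Subtype.coe_eta, FamHom.label_eq f]
        exact i.2.2⟩
      hom := fun i => FamHom.hom f ⟨i.1, i.2.1⟩
      label_eq := fun i => congrArg φ (FamHom.label_eq f ⟨i.1, i.2.1⟩)
      cover := fun j => by
        have hj (i : {i // FamHom.idxMap f i = ⟨j.1, j.2.1⟩}) : φ (Fam.label a i.1) ∉ B' := by
          rw [← FamHom.label_eq f, i.2]
          exact j.2.2
        let e : {i : {i | ∃ h : i ∈ Fam.idx a, φ (Fam.label a ⟨i, h⟩) ∉ B'} //
            (⟨(FamHom.idxMap f ⟨i.1, i.2.1⟩).1, (FamHom.idxMap f ⟨i.1, i.2.1⟩).2, by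
              rw [Subtype.coe_eta, FamHom.label_eq f]
              exact i.2.2⟩ : {i | ∃ h : i ∈ Fam.idx b, φ (Fam.label b ⟨i, h⟩) ∉ B'}) = j} ≃
            {i // FamHom.idxMap f i = ⟨j.1, j.2.1⟩} :=
          { toFun := fun i => ⟨⟨i.1.1, i.1.2.1⟩, by
              have := congrArg Subtype.val i.2
              exact Subtype.ext this⟩
            invFun := fun i => ⟨⟨i.1.1, i.1.2, hj i⟩, by
              have := congrArg Subtype.val i.2
              exact Subtype.ext this⟩
            left_inv := fun _ => rfl
            right_inv := fun _ => rfl }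
        exact IsDisjointCover.reindex A (FamHom.cover f ⟨j.1, j.2.1⟩) e }
  map_id a := rfl
  map_comp f g := rfl

lemma Fam.ext' {a b : Fam (C := C) E B} (h : a.idx = b.idx)
    (ho : ∀ i (hi : i ∈ a.idx), a.obj ⟨i, hi⟩ = b.obj ⟨i, h ▸ hi⟩)
    (hl : ∀ i (hi : i ∈ a.idx), a.label ⟨i, hi⟩ = b.label ⟨i, h ▸ hi⟩) : a = b := by
  obtain ⟨s, _, o, _, l, _⟩ := a
  obtain ⟨t, _, o', _, l', _⟩ := b
  obtain rfl : s = t := h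
  obtain rfl : o = o' := funext fun i => ho i.1 i.2
  obtain rfl : l = l' := funext fun i => hl i.1 i.2
  rfl

lemma W.functor_ext {D : Type*} [Category D] {F G : D ⥤ A.W E B} (h : ∀ x, F.obj x = G.obj x)
    (h1 : ∀ {x y : D} (f : x ⟶ y) (i : Fam.idx (F.obj x)),
      (FamHom.idxMap (F.map f) i).1 = (FamHom.idxMap (G.map f) ⟨i.1, h x ▸ i.2⟩).1)
    (h2 : ∀ {x y : D} (f : x ⟶ y) (i : Fam.idx (F.obj x)),
      HEq (FamHom.hom (F.map f) i) (FamHom.hom (G.map f) ⟨i.1, h x ▸ i.2⟩)) : F = G := by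
  have ho : F.obj = G.obj := funext h
  obtain ⟨Fo, Fm, _, _⟩ := F
  obtain ⟨Go, Gm, _, _⟩ := G
  obtain rfl : Fo = Go := ho
  obtain rfl : @Fm = @Gm := by
    funext x y f
    refine FamHom.ext' A (fun i => Subtype.ext (h1 f i)) fun i => ?_
    rw [← heq_iff_eq]
    exact (comp_eqToHom_heq _ _).trans (h2 f i)
  rfl

lemma wMap_id : A.wMap (B := B) (B' := B) (id : E → E) = 𝟭 _ := by
  refine W.functor_ext A (fun a => Fam.ext' ?_ ?_ ?_) ?_ ?_
  · exact Set.ext fun i => ⟨fun h => h.1, fun h => ⟨h, Fam.label_notMem a _⟩⟩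
  · intros; rfl
  · intros; rfl
  · intros; rfl
  · intros; rfl

lemma wMap_comp {E'' : Type} {B'' : Set E''} (φ : E → E') (ψ : E' → E'')
    (hψ : ∀ x ∈ B', ψ x ∈ B'') :
    A.wMap (B := B) (B' := B') φ ⋙ A.wMap (B' := B'') ψ = A.wMap (ψ ∘ φ) := by
  refine W.functor_ext A (fun a => Fam.ext' ?_ ?_ ?_) ?_ ?_
  · exact Set.ext fun i => ⟨fun h => ⟨h.1.1, h.2⟩, fun h => ⟨⟨h.1, fun h' => h.2 (hψ _ h')⟩, h.2⟩⟩
  · intros; rfl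
  · intros; rfl
  · intros; rfl
  · intros; rfl

/-- The base point: the empty family. -/
def wPt (E : Type) (B : Set E) : A.W E B where
  idx := ∅
  finite := Set.finite_empty
  obj i := i.2.elim
  not_initial i := i.2.elim
  label i := i.2.elim
  label_notMem i := i.2.elim

lemma wMap_pt (φ : E → E') : (A.wMap φ).obj (A.wPt E B) = A.wPt E' B' :=
  Fam.ext' (Set.ext fun i => ⟨fun h => h.1, fun h => h.elim⟩) (fun _ hi => hi.1.elim)
    (fun _ hi => hi.1.elim)

lemma wMap_const (φ : E → E') (h : ∀ x, φ x ∈ B') :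
    A.wMap (B := B) φ = (Functor.const _).obj (A.wPt E' B') := by
  refine W.functor_ext A (fun a => Fam.ext' ?_ ?_ ?_) ?_ ?_
  · exact Set.ext fun i => ⟨fun hi => hi.2 (h _), fun hi => hi.elim⟩
  · exact fun i hi => (hi.2 (h _)).elim
  · exact fun i hi => (hi.2 (h _)).elim
  · exact fun f i => (i.2.2 (h _)).elim
  · exact fun f i => (i.2.2 (h _)).elim

end

/-- The `m`-simplices of `Δ[1]ᵏ`, whose quotient by `Sphere.base` is the `k`-sphere `(S¹)^{∧ k}`. -/
def Sphere (k : ℕ) (m : SimplexCategory) : Type := Fin k → (m ⟶ ⦋1⦌)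

/-- The simplices of `Δ[1]ᵏ` that are identified to the base point of `(S¹)^{∧ k}`. -/
def Sphere.base (k : ℕ) (m : SimplexCategory) : Set (Sphere k m) :=
  {x | ∃ a, IsConst (x a)}

/-- The simplicial structure of `Δ[1]ᵏ`. -/
def Sphere.map (k : ℕ) {m m' : SimplexCategory} (θ : m ⟶ m') (x : Sphere k m') : Sphere k m :=
  fun a => θ ≫ x a

lemma Sphere.map_base (k : ℕ) {m m' : SimplexCategory} (θ : m ⟶ m') :
    ∀ x ∈ Sphere.base k m', Sphere.map k θ x ∈ Sphere.base k m := by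
  rintro x ⟨a, ha⟩
  exact ⟨a, fun i j => ha _ _⟩

/-- The map `Δ[1] × Δ[1]ᵏ → Δ[1]ᵏ⁺¹`, which induces `S¹ ∧ Sᵏ ≅ Sᵏ⁺¹`. -/
def Sphere.smash {k : ℕ} {m : SimplexCategory} (s : m ⟶ ⦋1⦌) (x : Sphere k m) :
    Sphere (k + 1) m :=
  Fin.cons s x

lemma Sphere.smash_base {k : ℕ} {m : SimplexCategory} (s : m ⟶ ⦋1⦌) :
    ∀ x ∈ Sphere.base k m, Sphere.smash s x ∈ Sphere.base (k + 1) m := by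
  rintro x ⟨a, ha⟩
  exact ⟨a.succ, ha⟩

lemma Sphere.map_smash {k : ℕ} {m m' : SimplexCategory} (θ : m ⟶ m') (s : m' ⟶ ⦋1⦌) :
    Sphere.map (k + 1) θ ∘ Sphere.smash s = Sphere.smash (θ ≫ s) ∘ Sphere.map k θ := by
  funext x a
  induction a using Fin.cases <;> rfl

/-- The simplicial category `m ↦ W((Sᵏ)_m ∧ A)`. -/
def wCat (k : ℕ) : SimplexCategoryᵒᵖ ⥤ Cat.{v, u} where
  obj m := Cat.of (A.W (Sphere k m.unop) (Sphere.base k m.unop))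
  map θ := (A.wMap (Sphere.map k θ.unop)).toCatHom
  map_id m := by
    have : Sphere.map k (𝟙 m.unop) = id := funext fun x => funext fun a => Category.id_comp _
    refine Cat.Hom.ext ?_
    change A.wMap (Sphere.map k (𝟙 m.unop)) = _
    rw [this, wMap_id]
    rfl
  map_comp {m m' m''} θ θ' :=
    Cat.Hom.ext (A.wMap_comp (Sphere.map k θ.unop) (Sphere.map k θ'.unop)
      (Sphere.map_base k θ'.unop)).symm

/-- The assembler `K`-theory spectrum: the `k`-th space is `|W(Sᵏ ∧ A)|`. -/
def kSpectrum : SimplicialCatSpectrum.{v, u} where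
  cat k := A.wCat k
  pt k m := A.wPt _ _
  map_pt k m m' θ := A.wMap_pt _
  susp k m s := A.wMap (Sphere.smash s)
  map_susp k m m' θ s :=
    (A.wMap_comp _ _ (Sphere.map_base (k + 1) θ.unop)).trans
      ((congrArg (fun φ => A.wMap φ) (Sphere.map_smash θ.unop s)).trans
        (A.wMap_comp _ _ (Sphere.smash_base (θ.unop ≫ s))).symm)
  susp_const k m s hs := A.wMap_const _ fun x => ⟨0, hs⟩
  susp_pt k m s := A.wMap_pt _

end AssemblerData

/-! ### Schemes -/

open AlgebraicGeometry

/-- Piecewise isomorphisms of reduced schemes: there is a filtration `∅ = F 0 ⊆ ⋯ ⊆ F n = Y` by closed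
subsets such that `f` restricts to an isomorphism between the locally closed subsets
`f⁻¹(F (i + 1) ∖ F i)` and `F (i + 1) ∖ F i` with their reduced subscheme structures (given as `V`
and `U`). -/
def IsPiecewiseIso {X Y : Scheme.{u}} (f : X ⟶ Y) : Prop :=
  ∃ (n : ℕ) (F : ℕ → Set Y), F 0 = ∅ ∧ F n = Set.univ ∧ Monotone F ∧ (∀ i, IsClosed (F i)) ∧
    ∀ i < n, ∃ (V U : Scheme.{u}) (v : V ⟶ X) (j : U ⟶ Y) (e : V ≅ U),
      AlgebraicGeometry.IsReduced V ∧ AlgebraicGeometry.IsReduced U ∧ IsImmersion v ∧ IsImmersion j ∧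
      Set.range v = f ⁻¹' (F (i + 1) \ F i) ∧ Set.range j = F (i + 1) \ F i ∧
      v ≫ f = e.hom ≫ j

lemma isPiecewiseIso_iff {X Y : Scheme.{u}} (f : X ⟶ Y) :
    IsPiecewiseIso f ↔ ∃ (n : ℕ) (r : Y → ℕ), (∀ y, r y < n) ∧
      (∀ i, IsClosed {y | r y < i}) ∧
      ∀ i < n, ∃ (V U : Scheme.{u}) (v : V ⟶ X) (j : U ⟶ Y) (e : V ≅ U),
        AlgebraicGeometry.IsReduced V ∧ AlgebraicGeometry.IsReduced U ∧
        IsImmersion v ∧ IsImmersion j ∧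
        Set.range v = {x | r (f x) = i} ∧ Set.range j = {y | r y = i} ∧ v ≫ f = e.hom ≫ j := by
  constructor
  · rintro ⟨n, F, h0, hn, hm, hc, h⟩
    classical
    have hex (y : Y) : ∃ i, y ∈ F (i + 1) := ⟨n, hm (Nat.le_succ n) (hn ▸ Set.mem_univ y)⟩
    have hlt (y : Y) (i : ℕ) : Nat.find (hex y) < i ↔ y ∈ F i := by
      rw [Nat.find_lt_iff]
      constructor
      · rintro ⟨k, hk, hy⟩
        exact hm hk hy
      · intro hy
        cases i with
        | zero => rw [h0] at hy; exact hy.elim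
        | succ i => exact ⟨i, Nat.lt_succ_self i, hy⟩
    have hs (y : Y) (i : ℕ) : Nat.find (hex y) = i ↔ y ∈ F (i + 1) \ F i := by
      rw [Set.mem_sdiff, ← hlt, ← hlt]
      omega
    refine ⟨n, fun y => Nat.find (hex y), fun y => (hlt y n).2 (hn ▸ Set.mem_univ y),
      fun i => ?_, fun i hi => ?_⟩
    · convert hc i using 1
      exact Set.ext fun y => hlt y i
    · obtain ⟨V, U, v, j, e, h1, h2, h3, h4, h5, h6, h7⟩ := h i hi
      refine ⟨V, U, v, j, e, h1, h2, h3, h4, h5.trans ?_, h6.trans ?_, h7⟩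
      · exact Set.ext fun x => (hs (f x) i).symm
      · exact Set.ext fun y => (hs y i).symm
  · rintro ⟨n, r, hr, hc, h⟩
    have hs (i : ℕ) : {y | r y < i + 1} \ {y | r y < i} = {y | r y = i} := by
      ext y
      simp only [Set.mem_sdiff, Set.mem_ofPred_eq]
      omega
    refine ⟨n, fun i => {y | r y < i}, by simp, by ext y; simp [hr y],
      fun a b hab y hy => lt_of_lt_of_le hy hab, hc, fun i hi => ?_⟩
    obtain ⟨V, U, v, j, e, h1, h2, h3, h4, h5, h6, h7⟩ := h i hi
    refine ⟨V, U, v, j, e, h1, h2, h3, h4, ?_, ?_, h7⟩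
    · rw [hs]; exact h5
    · rw [hs]; exact h6

lemma isPiecewiseIso_id (X : Scheme.{u}) [AlgebraicGeometry.IsReduced X] :
    IsPiecewiseIso (𝟙 X) := by
  rw [isPiecewiseIso_iff]
  refine ⟨1, fun _ => 0, fun _ => Nat.one_pos, fun i => ?_, fun i hi => ?_⟩
  · exact isClosed_const
  · obtain rfl : i = 0 := by omega
    exact ⟨X, X, 𝟙 X, 𝟙 X, Iso.refl X, inferInstance, inferInstance, inferInstance, inferInstance,
      by simp, by simp, rfl⟩

lemma isReduced_nilradical (X : Scheme.{u}) :
    AlgebraicGeometry.IsReduced X.nilradical.subscheme := by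
  have (U : X.nilradical.subschemeCover.openCover.I₀) :
      AlgebraicGeometry.IsReduced (X.nilradical.subschemeCover.openCover.X U) := by
    have : _root_.IsReduced (Γ(X, U.1) ⧸ X.nilradical.ideal U) :=
      (Ideal.isRadical_iff_quotient_reduced _).1 (Ideal.radical_isRadical _)
    exact inferInstanceAs (AlgebraicGeometry.IsReduced
      (Spec (.of (Γ(X, U.1) ⧸ X.nilradical.ideal U))))
  exact AlgebraicGeometry.IsReduced.of_openCover _ X.nilradical.subschemeCover.openCover

lemma isPiecewiseIso_comp {X Y Z : Scheme.{u}} (f : X ⟶ Y) (g : Y ⟶ Z)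
    (hf : IsPiecewiseIso f) (hg : IsPiecewiseIso g) : IsPiecewiseIso (f ≫ g) := by
  rw [isPiecewiseIso_iff] at hf hg ⊢
  obtain ⟨n, r, hr, hrc, hf⟩ := hf
  obtain ⟨N, q, hq, hqc, hg⟩ := hg
  have hinj : Function.Injective g := by
    intro y y' h
    obtain ⟨V, U, v, j, e, h1, h2, h3, h4, h5, h6, h7⟩ := hg (q (g y)) (hq _)
    obtain ⟨a, rfl⟩ : y ∈ Set.range v := by rw [h5]; rfl
    obtain ⟨b, rfl⟩ : y' ∈ Set.range v := by rw [h5, h]; rfl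
    have e1 (x : V) : g (v x) = j (e.hom x) := by
      rw [← Scheme.Hom.comp_apply, h7, Scheme.Hom.comp_apply]
    rw [e1, e1] at h
    have := j.isEmbedding.injective h
    have := e.hom.isEmbedding.injective this
    rw [this]
  have hsurj : Function.Surjective g := by
    intro z
    obtain ⟨V, U, v, j, e, h1, h2, h3, h4, h5, h6, h7⟩ := hg (q z) (hq _)
    obtain ⟨b, rfl⟩ : z ∈ Set.range j := by rw [h6]; rfl
    refine ⟨v (e.inv b), ?_⟩
    rw [← Scheme.Hom.comp_apply, h7, ← Scheme.Hom.comp_apply]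
    simp
  let s : Z → Y := Function.surjInv hsurj
  have hgs (z : Z) : g (s z) = z := Function.surjInv_eq hsurj z
  have hsg (y : Y) : s (g y) = y := hinj (hgs _)
  refine ⟨N * n, fun z => n * q z + r (s z), fun z => ?_, fun k => ?_, fun k hk => ?_⟩
  · have h1 := hq z
    have h2 := hr (s z)
    nlinarith
  · rcases Nat.eq_zero_or_pos n with rfl | hn
    · have : IsEmpty Z := ⟨fun z => absurd (hr (s z)) (Nat.not_lt_zero _)⟩
      convert isClosed_empty
      exact Set.eq_empty_of_isEmpty _
    by_cases hi : k / n < N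
    swap
    · convert isClosed_univ
      refine Set.eq_univ_of_forall fun z => ?_
      have h1 := hq z
      have h2 := hr (s z)
      have h3 : n * N ≤ k := by
        rw [mul_comm]
        exact (Nat.le_div_iff_mul_le hn).1 (not_lt.1 hi)
      have h4 : n * (q z + 1) ≤ n * N := Nat.mul_le_mul_left n h1
      have h5 : n * (q z + 1) = n * q z + n := by ring
      show n * q z + r (s z) < k
      omega
    obtain ⟨V, U, v, j, e, h1, h2, h3, h4, h5, h6, h7⟩ := hg (k / n) hi
    have hc : IsClosed ((e.inv ≫ v) ⁻¹' {y | r y < k % n}) :=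
      (hrc _).preimage (e.inv ≫ v).continuous
    obtain ⟨D, hD, hDU⟩ := j.isEmbedding.isInducing.isClosed_iff.1 hc
    have hset : ({z | n * q z + r (s z) < k} : Set Z) =
        {z | q z < k / n} ∪ ({z | q z < k / n + 1} ∩ D) := by
      ext z
      simp only [Set.mem_ofPred_eq, Set.mem_union, Set.mem_inter_iff]
      have hdiv := Nat.div_add_mod k n
      have hmod := Nat.mod_lt k hn
      have hrz := hr (s z)
      rcases lt_trichotomy (q z) (k / n) with h | h | h
      · have : n * (q z + 1) ≤ n * (k / n) := Nat.mul_le_mul_left n h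
        have h5 : n * (q z + 1) = n * q z + n := by ring
        exact iff_of_true (by omega) (Or.inl h)
      · have hz : z ∈ Set.range j := by rw [h6]; exact h
        obtain ⟨b, rfl⟩ := hz
        have hb : g ((e.inv ≫ v) b) = j b := by
          rw [← Scheme.Hom.comp_apply, Category.assoc, h7]
          simp
        have hsb : s (j b) = (e.inv ≫ v) b := by rw [← hb, hsg]
        have : j b ∈ D ↔ r (s (j b)) < k % n := by
          rw [hsb]
          exact Set.ext_iff.1 hDU b
        rw [this, h]
        omega
      · have : n * (k / n + 1) ≤ n * q z := Nat.mul_le_mul_left n h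
        have h5 : n * (k / n + 1) = n * (k / n) + n := by ring
        exact iff_of_false (by omega) (by omega)
    rw [hset]
    exact (hqc _).union ((hqc _).inter hD)
  · have hn : 0 < n := Nat.pos_of_ne_zero (by rintro rfl; simp at hk)
    obtain ⟨V, U, v, j, e, h1, h2, h3, h4, h5, h6, h7⟩ :=
      hg (k / n) ((Nat.div_lt_iff_lt_mul hn).2 hk)
    obtain ⟨V', U', v', j', e', h1', h2', h3', h4', h5', h6', h7'⟩ := hf (k % n) (Nat.mod_lt k hn)
    have hiff (z : Z) : n * q z + r (s z) = k ↔ q z = k / n ∧ r (s z) = k % n := by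
      have hrz := hr (s z)
      constructor
      · rintro rfl
        rw [Nat.mul_add_div hn, Nat.div_eq_of_lt hrz, Nat.mul_add_mod, Nat.mod_eq_of_lt hrz]
        simp
      · rintro ⟨h1, h2⟩
        rw [h1, h2, Nat.div_add_mod]
    let P := pullback v j'
    have hred := isReduced_nilradical P
    let t := P.nilradical.subschemeι
    have ht : Set.range t = Set.univ := by
      rw [Scheme.IdealSheafData.range_subschemeι]
      rfl
    refine ⟨P.nilradical.subscheme, P.nilradical.subscheme,
      t ≫ pullback.snd v j' ≫ e'.inv ≫ v', t ≫ pullback.fst v j' ≫ e.hom ≫ j, Iso.refl _,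
      hred, hred, inferInstance, inferInstance, ?_, ?_, ?_⟩
    · ext x
      rw [Set.mem_ofPred_eq, hiff, Scheme.Hom.comp_apply, hsg]
      constructor
      · rintro ⟨p, rfl⟩
        have hx : f ((t ≫ pullback.snd v j' ≫ e'.inv ≫ v') p) =
            j' ((t ≫ pullback.snd v j') p) := by
          simp only [← Scheme.Hom.comp_apply, Category.assoc]
          rw [h7', e'.inv_hom_id_assoc]
        have hx' : j' ((t ≫ pullback.snd v j') p) = v ((t ≫ pullback.fst v j') p) := by
          simp only [← Scheme.Hom.comp_apply, Category.assoc, pullback.condition]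
        rw [hx]
        refine ⟨?_, h6'.le ⟨_, rfl⟩⟩
        rw [hx']
        exact h5.le ⟨_, rfl⟩
      · rintro ⟨hx1, hx2⟩
        obtain ⟨a, rfl⟩ : x ∈ Set.range v' := h5'.ge hx2
        have ha : f (v' a) = j' (e'.hom a) := by simp only [← Scheme.Hom.comp_apply, h7']
        obtain ⟨b, hb⟩ : f (v' a) ∈ Set.range v := h5.ge hx1
        obtain ⟨p, hp⟩ : e'.hom a ∈ Set.range (pullback.snd v j') := by
          rw [Scheme.Pullback.range_snd]
          exact ⟨b, by rw [hb, ha]⟩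
        obtain ⟨p, rfl⟩ : p ∈ Set.range t := ht.ge (Set.mem_univ p)
        refine ⟨p, ?_⟩
        rw [Scheme.Hom.comp_apply, Scheme.Hom.comp_apply, hp]
        simp only [← Scheme.Hom.comp_apply, e'.hom_inv_id_assoc]
    · ext z
      rw [Set.mem_ofPred_eq, hiff]
      constructor
      · rintro ⟨p, rfl⟩
        have hz : (t ≫ pullback.fst v j' ≫ e.hom ≫ j) p = g (v ((t ≫ pullback.fst v j') p)) := by
          simp only [← Scheme.Hom.comp_apply, Category.assoc, h7]
        have hx' : v ((t ≫ pullback.fst v j') p) = j' ((t ≫ pullback.snd v j') p) := by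
          simp only [← Scheme.Hom.comp_apply, Category.assoc, pullback.condition]
        rw [hz, hsg]
        refine ⟨h5.le ⟨_, rfl⟩, ?_⟩
        rw [hx']
        exact h6'.le ⟨_, rfl⟩
      · rintro ⟨hz1, hz2⟩
        obtain ⟨y, rfl⟩ := hsurj z
        rw [hsg] at hz2
        obtain ⟨b, rfl⟩ : y ∈ Set.range v := h5.ge hz1
        obtain ⟨p, rfl⟩ : b ∈ Set.range (pullback.fst v j') := by
          rw [Scheme.Pullback.range_fst]
          exact h6'.ge hz2
        obtain ⟨p, rfl⟩ : p ∈ Set.range t := ht.ge (Set.mem_univ p)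
        refine ⟨p, ?_⟩
        simp only [← Scheme.Hom.comp_apply, Category.assoc, h7]
    · simp only [Category.assoc, Iso.refl_hom, Category.id_comp]
      rw [reassoc_of% h7', e'.inv_hom_id_assoc, ← pullback.condition_assoc, h7]

/-- Reduced schemes of finite type over `S`, of dimension at most `n`. -/
def schemeProp (S : Scheme.{u}) (n : ℕ∞) : ObjectProperty (Over S) := fun X =>
  AlgebraicGeometry.IsReduced X.left ∧ LocallyOfFiniteType X.hom ∧ QuasiCompact X.hom ∧
    topologicalKrullDim X.left ≤ (n : WithBot ℕ∞)

/-- The category of reduced schemes of finite type over `S` of dimension at most `n`, for `n ≤ ∞`. -/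
abbrev Sch (S : Scheme.{u}) (n : ℕ∞) := (schemeProp S n).FullSubcategory

/-- The empty scheme. -/
noncomputable def emptySch (S : Scheme.{u}) (n : ℕ∞) : Sch S n where
  obj := Over.mk (Scheme.emptyTo S)
  property := by
    refine ⟨?_, ?_, ?_, ?_⟩
    · change AlgebraicGeometry.IsReduced (∅ : Scheme.{u})
      exact AlgebraicGeometry.IsReduced.mk fun U => by
        have : Subsingleton Γ((∅ : Scheme.{u}), U) := by
          obtain rfl : U = ⊥ := Subsingleton.elim _ _
          infer_instance
        infer_instance
    · change LocallyOfFiniteType (Scheme.emptyTo S); infer_instance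
    · change QuasiCompact (Scheme.emptyTo S); infer_instance
    · change topologicalKrullDim (∅ : Scheme.{u}) ≤ _
      have : IsEmpty (TopologicalSpace.IrreducibleCloseds (∅ : Scheme.{u})) :=
        ⟨fun Z => isEmptyElim Z.isIrreducible.nonempty.some⟩
      rw [topologicalKrullDim, Order.krullDim_eq_bot]
      exact bot_le

/-- The empty scheme is initial. -/
noncomputable def emptySchIsInitial (S : Scheme.{u}) (n : ℕ∞) : IsInitial (emptySch S n) :=
  IsInitial.ofUniqueHom (fun X => ObjectProperty.homMk (Over.homMk (Scheme.emptyTo X.obj.left)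
      (emptyIsInitial.hom_ext _ _)))
    fun X m => by
      ext1
      ext1
      exact emptyIsInitial.hom_ext _ _

/-- Subtraction sequences `X ↪ Y ← Y ∖ X`: a closed immersion and the open immersion of its
complement. -/
def IsSubtraction {S : Scheme.{u}} {n : ℕ∞} {X Y Z : Sch S n} (i : X ⟶ Y) (j : Z ⟶ Y) : Prop :=
  IsClosedImmersion i.hom.left ∧ IsOpenImmersion j.hom.left ∧
    Set.range j.hom.left = (Set.range i.hom.left)ᶜ

/-- Reduced schemes of finite type as an SW-category, with piecewise isomorphisms as weak
equivalences. -/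
noncomputable def schSW (S : Scheme.{u}) (n : ℕ∞) : SWData (Sch S n) where
  zero := emptySch S n
  isInitial := emptySchIsInitial S n
  IsSub i j := IsSubtraction i j
  weq := fun _ _ f => IsPiecewiseIso f.hom.left
  weq_mult :=
    { id_mem := fun X => by
        have := X.property.1
        exact isPiecewiseIso_id X.obj.left
      comp_mem := fun f g hf hg => isPiecewiseIso_comp f.hom.left g.hom.left hf hg }
  sub_id_zero X := by
    refine ⟨?_, ?_, ?_⟩
    · change IsClosedImmersion (𝟙 X.obj.left)
      infer_instance
    · change IsOpenImmersion (Scheme.emptyTo X.obj.left)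
      infer_instance
    · change Set.range (Scheme.emptyTo X.obj.left) = (Set.range (𝟙 X.obj.left : _ ⟶ _))ᶜ
      rw [Set.range_eq_empty]
      simp
  sub_zero_id X := by
    refine ⟨?_, ?_, ?_⟩
    · change IsClosedImmersion (Scheme.emptyTo X.obj.left)
      infer_instance
    · change IsOpenImmersion (𝟙 X.obj.left)
      infer_instance
    · change Set.range (𝟙 X.obj.left : _ ⟶ _) = (Set.range (Scheme.emptyTo X.obj.left))ᶜ
      rw [Set.range_eq_empty (Scheme.emptyTo X.obj.left)]
      simp

/-- The locally closed immersions. -/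
def immersions (S : Scheme.{u}) (n : ℕ∞) : MorphismProperty (Sch S n) := fun _ _ f =>
  IsImmersion f.hom.left

instance (S : Scheme.{u}) (n : ℕ∞) : (immersions S n).IsMultiplicative where
  id_mem X := by change IsImmersion (𝟙 _); infer_instance
  comp_mem f g hf hg := by
    have : IsImmersion f.hom.left := hf
    have : IsImmersion g.hom.left := hg
    change IsImmersion (f.hom.left ≫ g.hom.left)
    infer_instance

/-- Reduced schemes of finite type over `S` of dimension at most `n`, and locally closed immersions. -/
abbrev ImmSch (S : Scheme.{u}) (n : ℕ∞) := WideSubcategory (immersions S n)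

/-- The families `{Z → X, X ∖ Z → X}` for closed subschemes `Z` of `X`, and the empty family over the
empty scheme. -/
def closedOpen (S : Scheme.{u}) (n : ℕ∞) : Precoverage (ImmSch S n) where
  coverings X := {R | (∃ (Z U : ImmSch S n) (i : Z ⟶ X) (j : U ⟶ X),
      IsSubtraction i.hom j.hom ∧ R = Presieve.singleton i ⊔ Presieve.singleton j) ∨
    (IsEmpty X.obj.obj.left ∧ R = ⊥)}

/-- The assembler of reduced schemes of finite type: its morphisms are the locally closed immersions,
and its topology is generated by the families `{Z → X, X ∖ Z → X}` with `Z` closed in `X`. -/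
noncomputable def schAssembler (S : Scheme.{u}) (n : ℕ∞) : AssemblerData (ImmSch S n) where
  top := (closedOpen S n).toGrothendieck
  empty := ⟨emptySch S n⟩
  isInitial := IsInitial.ofUniqueHom
    (fun X => ⟨(emptySchIsInitial S n).to X.obj, by
      change IsImmersion (Scheme.emptyTo _); infer_instance⟩)
    fun X m => by
      ext1
      exact (emptySchIsInitial S n).hom_ext _ _
  empty_mem := by
    have h : (⊥ : Presieve (⟨emptySch S n⟩ : ImmSch S n)) ∈ (closedOpen S n) ⟨emptySch S n⟩ :=
      Or.inr ⟨inferInstanceAs (IsEmpty (∅ : Scheme.{u})), rfl⟩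
    have := Precoverage.generate_mem_toGrothendieck h
    rwa [Sieve.generate_bot] at this
  mono {X Y} f := ⟨fun g h e => by
    have : IsImmersion f.hom.hom.left := f.property
    ext1
    ext1
    ext1
    have e' := congrArg (fun t => t.hom.hom.left) e
    exact (cancel_mono f.hom.hom.left).1 e'⟩

end KTheory

/-! ### Homotopies of maps of simplicial sets -/

namespace KTheory

open CategoryTheory Limits Simplicial Opposite MonoidalCategory CartesianMonoidalCategory HomotopicalAlgebra SSet SSet.modelCategoryQuillen

/-! The zigzag consists of a single map. A family of schemes labelled by non-base simplices of the
`k`-sphere gives a diagram on boxes: at `I` stands the coproduct of the members whose label is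
active at `I`, that is, carries the endpoints of every interval of `I` to 0 and 1. This is the
functor `comparison`. Coproducts are chosen once for all finite families indexed by natural numbers,
so it commutes strictly with simplicial operators, base points and structure maps. It remains to see
that for fixed level `k` and degree `m` it is an equivalence on nerves; the realization lemma
`isWeakEquiv_diagMap` then passes to diagonals.

For fixed `k` and `m`, Quillen's Theorem A (`isWeakEquiv_nerveMap`) asks that the category of
families over a diagram `Y` be contractible. All `Y_I` are locally closed pieces of one total
scheme, cut out by finitely many closed subsets, and a point of the total scheme determines a
simplex `sphereOf` that is active exactly at the boxes containing the point. A family over `Y`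
decomposes the total scheme into the images of its members, and the labels are forced
(`sphereOf_leg`). Piecewise isomorphisms are injective and monomorphisms, and members are non-empty,
so there is at most one morphism between two families over `Y` (`famHom_eq`). The strata of a fine
enough finite filtration by closed subsets form a family over `Y`, and two families are refined by a
common filtration (`wContr_fibre`). Hence the category is thin, non-empty and codirected, and
therefore contractible (`wContr_nerve_of_codirected`).

The geometry rests on reducedness: a morphism from a reduced scheme whose image lies in that of an
immersion factors through it, so reduced pieces are the same as locally closed subsets. Together
with refinement of locally closed covers by filtrations (`exists_filtration_of_cover`), this
identifies disjoint covering families with finite partitions into immersed pieces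
(`isDisjointCover_iff`).

The homotopy theory works directly with maps into Kan complexes. Its core is that a monomorphism
that is a weak equivalence has the extension property for all pushout-products with monomorphisms
(`IsWeakEquiv.trivCof`); this extends maps over the skeleta of a diagonal. -/

lemma exists_lift_pushoutProduct {A B Z Z' E X : SSet.{w}} (i : A ⟶ B) [Mono i] (j : Z ⟶ Z')
    (hj : anodyneExtensions j) (p : E ⟶ X) [Fibration p] (u : B ⊗ Z ⟶ E) (v : A ⊗ Z' ⟶ E)
    (w : B ⊗ Z' ⟶ X) (h : i ▷ Z ≫ u = A ◁ j ≫ v) (hu : u ≫ p = B ◁ j ≫ w)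
    (hv : v ≫ p = i ▷ Z' ≫ w) :
    ∃ l : B ⊗ Z' ⟶ E, B ◁ j ≫ l = u ∧ i ▷ Z' ≫ l = v ∧ l ≫ p = w := by
  -- The compatible pair `u`, `v` is one map out of the source of the pushout-product of `i` and
  -- `j`, which is anodyne because `i` is a monomorphism and `j` is anodyne.
  let sq := Functor.PushoutObjObj.ofHasPushout (curriedTensor SSet) i j
  have hsq := anodyneExtensions_pushoutObjObjι sq hj
  have h2 : HasLiftingProperty sq.ι p := hsq _ (by rwa [← HomotopicalAlgebra.fibration_iff])
  have h3 : sq.inl ≫ sq.ι = B ◁ j := sq.inl_ι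
  have h4 : sq.inr ≫ sq.ι = i ▷ Z' := sq.inr_ι
  have cs : CommSq (sq.isPushout.desc u v h) sq.ι p w := ⟨sq.hom_ext
    (by rw [reassoc_of% h3, IsPushout.inl_desc_assoc, hu])
    (by rw [reassoc_of% h4, IsPushout.inr_desc_assoc, hv])⟩
  refine ⟨cs.lift, ?_, ?_, cs.fac_right⟩
  · rw [← h3, Category.assoc, cs.fac_left, IsPushout.inl_desc]
  · rw [← h4, Category.assoc, cs.fac_left, IsPushout.inr_desc]

lemma mono_iff_injective_app {X Y : SSet.{w}} (f : X ⟶ Y) :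
    Mono f ↔ ∀ m, Function.Injective (f.app m) := by
  rw [NatTrans.mono_iff_mono_app]
  exact forall_congr' fun m => CategoryTheory.mono_iff_injective _

instance mono_whiskerLeft (Y : SSet.{w}) {A B : SSet.{w}} (f : A ⟶ B) [hf : Mono f] :
    Mono (Y ◁ f) := by
  rw [mono_iff_injective_app] at hf ⊢
  exact fun m x y h => Prod.ext (congrArg (fun t : Y.obj m × B.obj m => t.1) h)
    (hf m (congrArg (fun t : Y.obj m × B.obj m => t.2) h))

instance mono_whiskerRight (Y : SSet.{w}) {A B : SSet.{w}} (f : A ⟶ B) [hf : Mono f] :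
    Mono (f ▷ Y) := by
  rw [mono_iff_injective_app] at hf ⊢
  exact fun m x y h => Prod.ext (hf m (congrArg (fun t : B.obj m × Y.obj m => t.1) h))
    (congrArg (fun t : B.obj m × Y.obj m => t.2) h)

/-- The simplex `s` of `Δ[1]` is constant with value `b`. -/
def IsVal {m : SimplexCategoryᵒᵖ} (s : (Δ[1] : SSet.{w}).obj m) (b : Fin 2) : Prop :=
  ∀ i, (stdSimplex.objEquiv s).toOrderHom i = b

lemma IsVal.map {m m' : SimplexCategoryᵒᵖ} {s : (Δ[1] : SSet.{w}).obj m} {b : Fin 2}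
    (h : IsVal s b) (θ : m ⟶ m') : IsVal ((Δ[1] : SSet.{w}).map θ s) b := fun _ => h _

lemma IsVal.ne {m : SimplexCategoryᵒᵖ} {s : (Δ[1] : SSet.{w}).obj m}
    (h : IsVal s 1) : ¬ IsVal s 0 := fun h' => by
  have := (h 0).symm.trans (h' 0)
  simp at this

lemma isVal_of_mem_boundary {m : SimplexCategoryᵒᵖ} {s : (Δ[1] : SSet.{w}).obj m}
    (hs : s ∈ (∂Δ[1] : Subcomplex _).obj m) : IsVal s 0 ∨ IsVal s 1 := by
  by_contra! h
  simp only [IsVal, not_forall] at h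
  obtain ⟨⟨i, hi⟩, ⟨j, hj⟩⟩ := h
  refine hs (Fin.forall_fin_two.2 ⟨⟨j, ?_⟩, ⟨i, Fin.eq_one_of_ne_zero _ hi⟩⟩)
  by_contra h
  exact hj (Fin.eq_one_of_ne_zero _ h)

lemma isVal_of_mem_horn {m : SimplexCategoryᵒᵖ} {s : (Δ[1] : SSet.{w}).obj m}
    (hs : s ∈ (Λ[1, 0] : Subcomplex _).obj m) : IsVal s 0 := by
  by_contra! h
  simp only [IsVal, not_forall] at h
  obtain ⟨i, hi⟩ := h
  rw [mem_horn_iff] at hs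
  refine hs (Set.eq_univ_of_forall (Fin.forall_fin_two.2 ⟨by simp, Or.inl ⟨i, ?_⟩⟩))
  exact Fin.eq_one_of_ne_zero _ hi

lemma mem_horn_of_isVal {m : SimplexCategoryᵒᵖ} {s : (Δ[1] : SSet.{w}).obj m}
    (hs : IsVal s 0) : s ∈ (Λ[1, 0] : Subcomplex _).obj m := by
  rw [mem_horn_iff]
  intro h
  obtain ⟨i, hi⟩ | h := h.ge (Set.mem_univ 1)
  · exact absurd ((hs i).symm.trans hi) (by simp)
  · exact absurd h (by simp)

lemma mem_boundary_of_isVal {m : SimplexCategoryᵒᵖ} {s : (Δ[1] : SSet.{w}).obj m} {b : Fin 2}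
    (hs : IsVal s b) : s ∈ (∂Δ[1] : Subcomplex _).obj m := by
  intro h
  obtain ⟨i, hi⟩ := h 0
  obtain ⟨j, hj⟩ := h 1
  exact absurd (hi.symm.trans ((hs i).trans ((hs j).symm.trans hj))) (by simp)

/-- Morphisms of simplicial sets from maps that commute with the simplicial operators. -/
def homMk {X Y : SSet.{w}} (f : ∀ m, X.obj m → Y.obj m)
    (h : ∀ (m m' : SimplexCategoryᵒᵖ) (θ : m ⟶ m') (x : X.obj m),
      f m' (X.map θ x) = Y.map θ (f m x)) : X ⟶ Y where
  app m := ↾(f m)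
  naturality m m' θ := by
    ext x
    exact h m m' θ x

lemma hom_ext_apply {X Y : SSet.{w}} {f g : X ⟶ Y} (h : ∀ m (x : X.obj m), f.app m x = g.app m x) :
    f = g := by
  ext m x
  exact h m x

lemma app_map {X Y : SSet.{w}} (f : X ⟶ Y) {m m' : SimplexCategoryᵒᵖ} (θ : m ⟶ m') (x : X.obj m) :
    f.app m' (X.map θ x) = Y.map θ (f.app m x) := NatTrans.naturality_apply f θ x

lemma congr_app_apply {X Y : SSet.{w}} {f g : X ⟶ Y} (h : f = g) {m : SimplexCategoryᵒᵖ} (x : X.obj m) :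
    f.app m x = g.app m x := by rw [h]

lemma IsVal.eq {m : SimplexCategoryᵒᵖ} {s t : (Δ[1] : SSet.{w}).obj m} {b : Fin 2}
    (hs : IsVal s b) (ht : IsVal t b) : s = t := by
  apply stdSimplex.objEquiv.injective
  ext i
  rw [show _ = b from hs i, show _ = b from ht i]

lemma ι₀_app_snd_isVal {X : SSet.{w}} {m : SimplexCategoryᵒᵖ} (x : X.obj m) :
    IsVal ((ι₀ (X := X)).app m x).2 0 := fun _ => rfl

lemma ι₁_app_snd_isVal {X : SSet.{w}} {m : SimplexCategoryᵒᵖ} (x : X.obj m) :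
    IsVal ((ι₁ (X := X)).app m x).2 1 := fun _ => rfl

lemma ι₀_app_of_isVal {X : SSet.{w}} {m : SimplexCategoryᵒᵖ} (x : X.obj m)
   {s : (Δ[1] : SSet.{w}).obj m} (hs : IsVal s 0) : (ι₀ (X := X)).app m x = (x, s) :=
  Prod.ext rfl ((ι₀_app_snd_isVal x).eq hs)

lemma ι₁_app_of_isVal {X : SSet.{w}} {m : SimplexCategoryᵒᵖ} (x : X.obj m)
   {s : (Δ[1] : SSet.{w}).obj m} (hs : IsVal s 1) : (ι₁ (X := X)).app m x = (x, s) :=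
  Prod.ext rfl ((ι₁_app_snd_isVal x).eq hs)

open Classical in
/-- The map on `X ⊗ ∂Δ[1]` that is `f` over `0` and `g` over `1`. -/
noncomputable def ends {X Y : SSet.{w}} (f g : X ⟶ Y) : X ⊗ (∂Δ[1] : SSet.{w}) ⟶ Y :=
  homMk (fun m z => if IsVal z.2.1 0 then f.app m z.1 else g.app m z.1) (by
    rintro m m' θ ⟨x, s, hs⟩
    obtain h | h := isVal_of_mem_boundary hs
    · exact (if_pos (h.map θ)).trans ((app_map f θ x).trans
        (congrArg (Y.map θ) (if_pos h).symm))
    · exact (if_neg (h.map θ).ne).trans ((app_map g θ x).trans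
        (congrArg (Y.map θ) (if_neg h.ne).symm)))

lemma ends_app_zero {X Y : SSet.{w}} (f g : X ⟶ Y) {m : SimplexCategoryᵒᵖ} (x : X.obj m)
    (s : (∂Δ[1] : SSet.{w}).obj m) (h : IsVal s.1 0) : (ends f g).app m (x, s) = f.app m x :=
  if_pos h

lemma ends_app_one {X Y : SSet.{w}} (f g : X ⟶ Y) {m : SimplexCategoryᵒᵖ} (x : X.obj m)
    (s : (∂Δ[1] : SSet.{w}).obj m) (h : IsVal s.1 1) : (ends f g).app m (x, s) = g.app m x :=
  if_neg h.ne

/-- The two ends of a cylinder form `X ⊗ ∂Δ[1]`. In this form, finding a homotopy is an extension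
problem along a monomorphism. -/
lemma comp_eq_ends_iff {X Y : SSet.{w}} {f g : X ⟶ Y} {h : X ⊗ Δ[1] ⟶ Y} :
    X ◁ ∂Δ[1].ι ≫ h = ends f g ↔ ι₀ ≫ h = f ∧ ι₁ ≫ h = g := by
  constructor
  · intro e
    exact ⟨hom_ext_apply fun m x => (congr_app_apply e (m := m) (x, ⟨((ι₀ (X := X)).app m x).2,
        mem_boundary_of_isVal (ι₀_app_snd_isVal x)⟩)).trans
          (ends_app_zero _ _ x ⟨_, _⟩ (ι₀_app_snd_isVal x)),
      hom_ext_apply fun m x => (congr_app_apply e (m := m) (x, ⟨((ι₁ (X := X)).app m x).2,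
        mem_boundary_of_isVal (ι₁_app_snd_isVal x)⟩)).trans
          (ends_app_one _ _ x ⟨_, _⟩ (ι₁_app_snd_isVal x))⟩
  · rintro ⟨rfl, rfl⟩
    refine hom_ext_apply ?_
    rintro m ⟨x, s, hs⟩
    obtain h' | h' := isVal_of_mem_boundary hs
    · exact (congrArg (h.app m) (ι₀_app_of_isVal x h').symm).trans
        (ends_app_zero (ι₀ ≫ h) (ι₁ ≫ h) x ⟨s, hs⟩ h').symm
    · exact (congrArg (h.app m) (ι₁_app_of_isVal x h').symm).trans
        (ends_app_one (ι₀ ≫ h) (ι₁ ≫ h) x ⟨s, hs⟩ h').symm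

lemma ends_comp {X Y Z : SSet.{w}} (f g : X ⟶ Y) (k : Y ⟶ Z) :
    ends f g ≫ k = ends (f ≫ k) (g ≫ k) := by
  refine hom_ext_apply ?_
  rintro m ⟨x, s⟩
  obtain h | h := isVal_of_mem_boundary s.2
  · exact (congrArg (k.app m) (ends_app_zero f g x s h)).trans
      (ends_app_zero (f ≫ k) (g ≫ k) x s h).symm
  · exact (congrArg (k.app m) (ends_app_one f g x s h)).trans
      (ends_app_one (f ≫ k) (g ≫ k) x s h).symm

lemma comp_ends {X Y Z : SSet.{w}} (f g : X ⟶ Y) (k : Z ⟶ X) :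
    k ▷ _ ≫ ends f g = ends (k ≫ f) (k ≫ g) := by
  refine hom_ext_apply ?_
  rintro m ⟨x, s⟩
  obtain h | h := isVal_of_mem_boundary s.2
  · exact (ends_app_zero f g (k.app m x) s h).trans
      (ends_app_zero (k ≫ f) (k ≫ g) x s h).symm
  · exact (ends_app_one f g (k.app m x) s h).trans
      (ends_app_one (k ≫ f) (k ≫ g) x s h).symm

/-- Homotopy of maps of simplicial sets, as a relation. -/
def Htpy {X Y : SSet.{w}} (f g : X ⟶ Y) : Prop := Nonempty (SSet.Homotopy f g)

lemma htpy_iff {X Y : SSet.{w}} {f g : X ⟶ Y} :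
    Htpy f g ↔ ∃ h : X ⊗ Δ[1] ⟶ Y, ι₀ ≫ h = f ∧ ι₁ ≫ h = g :=
  ⟨fun ⟨H⟩ => ⟨H.h, H.h₀, H.h₁⟩, fun ⟨h, h0, h1⟩ => ⟨{
    h := h
    h₀ := h0
    h₁ := h1
    -- The homotopy is relative to the empty subcomplex, so there is nothing to check.
    rel := by
      ext m ⟨⟨_, h⟩, _⟩
      exact h.elim }⟩⟩

lemma Htpy.refl {X Y : SSet.{w}} (f : X ⟶ Y) : Htpy f f :=
  htpy_iff.2 ⟨fst _ _ ≫ f, rfl, rfl⟩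

lemma Htpy.postcomp {X Y Z : SSet.{w}} {f g : X ⟶ Y} (H : Htpy f g) (k : Y ⟶ Z) :
    Htpy (f ≫ k) (g ≫ k) := by
  obtain ⟨h, rfl, rfl⟩ := htpy_iff.1 H
  exact htpy_iff.2 ⟨h ≫ k, rfl, rfl⟩

lemma Htpy.precomp {X Y Z : SSet.{w}} {f g : X ⟶ Y} (H : Htpy f g) (k : Z ⟶ X) :
    Htpy (k ≫ f) (k ≫ g) := by
  obtain ⟨h, rfl, rfl⟩ := htpy_iff.1 H
  exact htpy_iff.2 ⟨k ▷ _ ≫ h, rfl, rfl⟩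

lemma anodyne_horn_zero : anodyneExtensions (Λ[1, 0] : Subcomplex (Δ[1] : SSet.{w})).ι :=
  anodyneExtensions.horn_ι (n := 1) 0

/-- The inclusion of `X` into `X ⊗ {0}`. -/
noncomputable def toHornZero (X : SSet.{w}) : X ⟶ X ⊗ (Λ[1, 0] : Subcomplex (Δ[1] : SSet.{w})).toSSet :=
  homMk (fun m x => (x, ⟨((ι₀ (X := X)).app m x).2, mem_horn_of_isVal (ι₀_app_snd_isVal x)⟩))
    fun _ _ _ _ => rfl

/-- The horn `Λ[1, 0]` is the vertex 0, so a condition over the horn is a condition at time 0. This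
turns lifting against the horn into homotopy lifting. -/
lemma fst_eq_iff {X Y : SSet.{w}} {f : X ⟶ Y} {h : X ⊗ Δ[1] ⟶ Y} :
    X ◁ Λ[1, 0].ι ≫ h = fst _ _ ≫ f ↔ ι₀ ≫ h = f := by
  constructor
  · intro e
    exact congrArg (fun t => toHornZero X ≫ t) e
  · rintro rfl
    refine hom_ext_apply ?_
    rintro m ⟨x, s, hs⟩
    exact congrArg (h.app m) (ι₀_app_of_isVal x (isVal_of_mem_horn hs)).symm

/-- The homotopy lifting and extension property. -/
lemma exists_lift_homotopy {A B E X : SSet.{w}} (i : A ⟶ B) [Mono i] (p : E ⟶ X) [Fibration p]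
    (u : B ⟶ E) (v : A ⊗ Δ[1] ⟶ E) (w : B ⊗ Δ[1] ⟶ X) (h : i ≫ u = ι₀ ≫ v)
    (hu : u ≫ p = ι₀ ≫ w) (hv : v ≫ p = i ▷ _ ≫ w) :
    ∃ l : B ⊗ Δ[1] ⟶ E, ι₀ ≫ l = u ∧ i ▷ _ ≫ l = v ∧ l ≫ p = w := by
  obtain ⟨l, h1, h2, h3⟩ := exists_lift_pushoutProduct i _ anodyne_horn_zero p (fst _ _ ≫ u) v w
    (by rw [fst_eq_iff.2 h.symm]; rfl) (by rw [fst_eq_iff.2 hu.symm]; rfl) hv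
  exact ⟨l, fst_eq_iff.1 h1, h2, h3⟩

/-- Filling of open boxes `Y ⊗ (Δ[1] ⊗ {0} ∪ ∂Δ[1] ⊗ Δ[1])`. -/
lemma exists_box_lift {Y E X : SSet.{w}} (p : E ⟶ X) [Fibration p] (a b₀ b₁ : Y ⊗ Δ[1] ⟶ E)
    (w : (Y ⊗ Δ[1]) ⊗ Δ[1] ⟶ X) (h0 : ι₀ ≫ a = ι₀ ≫ b₀) (h1 : ι₁ ≫ a = ι₀ ≫ b₁)
    (ha : a ≫ p = ι₀ ≫ w) (hb₀ : b₀ ≫ p = ι₀ ▷ _ ≫ w) (hb₁ : b₁ ≫ p = ι₁ ▷ _ ≫ w) :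
    ∃ l : (Y ⊗ Δ[1]) ⊗ Δ[1] ⟶ E, ι₀ ≫ l = a ∧ ι₀ ▷ _ ≫ l = b₀ ∧ ι₁ ▷ _ ≫ l = b₁ ∧ l ≫ p = w := by
  -- Homotopy lifting takes place in the last factor, whereas `ends` has `∂Δ[1]` as its last factor;
  -- the three maps exchange the two parameters.
  let sw : (Y ⊗ (∂Δ[1] : SSet.{w})) ⊗ Δ[1] ⟶ (Y ⊗ Δ[1]) ⊗ (∂Δ[1] : SSet.{w}) :=
    homMk (fun m z => ((z.1.1, z.2), z.1.2)) fun _ _ _ _ => rfl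
  let sw' : (Y ⊗ Δ[1]) ⊗ Δ[1] ⟶ (Y ⊗ Δ[1]) ⊗ (Δ[1] : SSet.{w}) :=
    homMk (fun m z => ((z.1.1, z.2), z.1.2)) fun _ _ _ _ => rfl
  let sb : (Y ⊗ Δ[1]) ⊗ (∂Δ[1] : SSet.{w}) ⟶ (Y ⊗ (∂Δ[1] : SSet.{w})) ⊗ Δ[1] :=
    homMk (fun m z => ((z.1.1, z.2), z.1.2)) fun _ _ _ _ => rfl
  obtain ⟨l, h1, h2, h3⟩ := exists_lift_homotopy (Y ◁ ∂Δ[1].ι) p a (sw ≫ ends b₀ b₁) w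
    ((comp_eq_ends_iff.2 ⟨h0, h1⟩).trans (comp_ends b₀ b₁ ι₀).symm) ha (by
      rw [Category.assoc, ends_comp]
      exact congrArg (fun t => sw ≫ t)
        ((comp_eq_ends_iff (h := sw' ≫ w)).2 ⟨hb₀.symm, hb₁.symm⟩).symm)
  have h4 := congrArg (fun t => sb ≫ t) h2
  have h5 : (Y ⊗ Δ[1]) ◁ ∂Δ[1].ι ≫ sw' ≫ l = ends b₀ b₁ := h4
  exact ⟨l, h1, (comp_eq_ends_iff.1 h5).1, (comp_eq_ends_iff.1 h5).2, h3⟩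

section Kan

variable {X Y K : SSet.{w}} [KanComplex K]

/-- Fill the open box with the constant homotopy at `f` as bottom and the two given homotopies as
sides; the face opposite to the bottom joins `g` to `k`. Symmetry and transitivity are special
cases. -/
lemma Htpy.of_common {f g k : X ⟶ K} (h : Htpy f g) (h' : Htpy f k) : Htpy g k := by
  obtain ⟨b₀, h0, rfl⟩ := htpy_iff.1 h
  obtain ⟨b₁, h1, rfl⟩ := htpy_iff.1 h'
  obtain ⟨l, -, e0, e1, -⟩ := exists_box_lift (terminal.from K) (fst _ _ ≫ f) b₀ b₁
    (terminal.from _) (by rw [h0]; rfl) (by rw [h1]; rfl) (by simp) (by simp) (by simp)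
  refine htpy_iff.2 ⟨ι₁ ≫ l, ?_, ?_⟩
  · rw [← e0, ι₁_comp_assoc]
  · rw [← e1, ι₁_comp_assoc]

lemma Htpy.symm {f g : X ⟶ K} (h : Htpy f g) : Htpy g f := h.of_common (.refl f)

lemma Htpy.trans {f g k : X ⟶ K} (h : Htpy f g) (h' : Htpy g k) : Htpy f k := h.symm.of_common h'

end Kan

/-! ### Weak equivalences tested on Kan complexes -/

lemma isWeakEquiv_iff {X Y : SSet.{w}} (f : X ⟶ Y) : IsWeakEquiv f ↔
    ∀ (K : SSet.{w}) [KanComplex K], (∀ g : X ⟶ K, ∃ h : Y ⟶ K, Htpy (f ≫ h) g) ∧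
      ∀ h h' : Y ⟶ K, Htpy (f ≫ h) (f ≫ h') → Htpy h h' := Iff.rfl

lemma IsWeakEquiv.comp {X Y Z : SSet.{w}} {f : X ⟶ Y} {g : Y ⟶ Z} (hf : IsWeakEquiv f)
    (hg : IsWeakEquiv g) : IsWeakEquiv (f ≫ g) := by
  rw [isWeakEquiv_iff] at *
  intro K _
  refine ⟨fun k => ?_, fun h h' e => (hg K).2 _ _ ((hf K).2 _ _ (by simpa using e))⟩
  obtain ⟨h, hh⟩ := (hf K).1 k
  obtain ⟨h', hh'⟩ := (hg K).1 h
  refine ⟨h', ?_⟩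
  rw [Category.assoc]
  exact (hh'.precomp f).trans hh

lemma IsWeakEquiv.of_comp_left {X Y Z : SSet.{w}} {f : X ⟶ Y} {g : Y ⟶ Z} (hf : IsWeakEquiv f)
    (hfg : IsWeakEquiv (f ≫ g)) : IsWeakEquiv g := by
  rw [isWeakEquiv_iff] at *
  intro K _
  refine ⟨fun k => ?_, fun h h' e => (hfg K).2 _ _ (by simpa using e.precomp f)⟩
  obtain ⟨h, hh⟩ := (hfg K).1 (f ≫ k)
  exact ⟨h, (hf K).2 _ _ (by simpa using hh)⟩

lemma IsWeakEquiv.of_comp_right {X Y Z : SSet.{w}} {f : X ⟶ Y} {g : Y ⟶ Z} (hg : IsWeakEquiv g)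
    (hfg : IsWeakEquiv (f ≫ g)) : IsWeakEquiv f := by
  rw [isWeakEquiv_iff] at *
  intro K _
  refine ⟨fun k => ?_, fun h h' e => ?_⟩
  · obtain ⟨h, hh⟩ := (hfg K).1 k
    exact ⟨g ≫ h, by simpa using hh⟩
  · obtain ⟨a, ha⟩ := (hg K).1 h
    obtain ⟨b, hb⟩ := (hg K).1 h'
    refine ha.symm.trans (Htpy.trans (Htpy.precomp ((hfg K).2 a b ?_) g) hb)
    rw [Category.assoc, Category.assoc]
    exact (ha.precomp f).trans (e.trans (hb.precomp f).symm)

/-- A map with a homotopy inverse is a weak equivalence. -/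
lemma IsWeakEquiv.of_htpyInverse {X Y : SSet.{w}} {f : X ⟶ Y} (g : Y ⟶ X)
    (h : Htpy (f ≫ g) (𝟙 X) ∨ Htpy (𝟙 X) (f ≫ g))
    (h' : Htpy (g ≫ f) (𝟙 Y) ∨ Htpy (𝟙 Y) (g ≫ f)) : IsWeakEquiv f := by
  -- Homotopy is symmetric only after composition into a Kan complex, which is where it is used;
  -- hence either direction of the given homotopies is enough.
  have key {A B : SSet.{w}} {e : A ⟶ A} (h : Htpy e (𝟙 A) ∨ Htpy (𝟙 A) e) [KanComplex B]
      (k : A ⟶ B) : Htpy (e ≫ k) k := by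
    obtain h | h := h
    · simpa using h.postcomp k
    · simpa using (h.postcomp k).symm
  rw [isWeakEquiv_iff]
  intro K _
  refine ⟨fun k => ⟨g ≫ k, by simpa using key h k⟩, fun a b e => ?_⟩
  have := e.precomp g
  rw [← Category.assoc, ← Category.assoc] at this
  exact (key h' a).symm.trans (this.trans (key h' b))

lemma isWeakEquiv_of_iso {X Y : SSet.{w}} (f : X ⟶ Y) [IsIso f] : IsWeakEquiv f :=
  .of_htpyInverse (inv f) (Or.inl (by simpa using Htpy.refl _)) (Or.inl (by simpa using Htpy.refl _))

end KTheory

/-! ### Trivial cofibrations and function complexes -/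

namespace KTheory

open CategoryTheory Limits Simplicial Opposite MonoidalCategory CartesianMonoidalCategory HomotopicalAlgebra SSet SSet.modelCategoryQuillen MonoidalClosed

/-- Trivial cofibrations, characterised by the extension of maps into Kan complexes along the
pushout-products with monomorphisms. -/
def TrivCof {A B : SSet.{w}} (i : A ⟶ B) : Prop :=
  ∀ ⦃K : SSet.{w}⦄ [KanComplex K] ⦃Z Z' : SSet.{w}⦄ (j : Z ⟶ Z') [Mono j] (u : B ⊗ Z ⟶ K)
    (v : A ⊗ Z' ⟶ K), i ▷ Z ≫ u = A ◁ j ≫ v → ∃ w : B ⊗ Z' ⟶ K, B ◁ j ≫ w = u ∧ i ▷ Z' ≫ w = v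

section

variable {A B : SSet.{w}} {i : A ⟶ B}

lemma TrivCof.exists_extension (hi : TrivCof i) {K : SSet.{w}} [KanComplex K] (v : A ⟶ K) :
    ∃ w : B ⟶ K, i ≫ w = v := by
  -- The pushout-product of `i` with the inclusion of the empty set into a point is `i` itself, up
  -- to the unitor.
  obtain ⟨w, -, h⟩ := hi (⊥ : Subcomplex (𝟙_ SSet.{w})).ι
    (homMk (fun m z => z.2.2.elim) fun _ _ _ z => z.2.2.elim) ((ρ_ A).hom ≫ v)
    (hom_ext_apply fun m z => z.2.2.elim)
  refine ⟨(ρ_ B).inv ≫ w, ?_⟩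
  rw [rightUnitor_inv_naturality_assoc, h, Iso.inv_hom_id_assoc]

/-- Plain extension along `i` gives surjectivity on homotopy classes, and extension along the
pushout-product with `∂Δ[1] ⟶ Δ[1]` gives injectivity. -/
lemma TrivCof.isWeakEquiv (hi : TrivCof i) : IsWeakEquiv i := by
  rw [isWeakEquiv_iff]
  intro K _
  refine ⟨fun g => ?_, fun h h' e => ?_⟩
  · obtain ⟨w, hw⟩ := hi.exists_extension g
    exact ⟨w, hw ▸ .refl _⟩
  · obtain ⟨H, h0, h1⟩ := htpy_iff.1 e
    obtain ⟨w, h2, -⟩ := hi ∂Δ[1].ι (ends h h') H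
      ((comp_ends h h' i).trans (comp_eq_ends_iff.2 ⟨h0, h1⟩).symm)
    exact htpy_iff.2 ⟨w, comp_eq_ends_iff.1 h2⟩

/-- Tensoring preserves the pushout square, so it suffices to solve the problem over `B` and glue.
-/
lemma TrivCof.of_isPushout {C D : SSet.{w}} {a : A ⟶ C} {i' : C ⟶ D} {b : B ⟶ D}
    (sq : IsPushout a i i' b) (hi : TrivCof i) : TrivCof i' := by
  intro K _ Z Z' j _ u v h
  obtain ⟨w, h1, h2⟩ := hi j (b ▷ Z ≫ u) (a ▷ Z' ≫ v) (by
    rw [← comp_whiskerRight_assoc, ← sq.w, comp_whiskerRight_assoc, h, whisker_exchange_assoc])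
  have sq' (Z : SSet.{w}) : IsPushout (a ▷ Z) (i ▷ Z) (i' ▷ Z) (b ▷ Z) := sq.map (tensorRight Z)
  refine ⟨(sq' Z').desc v w h2.symm, (sq' Z).hom_ext ?_ ?_, (sq' Z').inl_desc _ _ _⟩
  · rw [h, ← whisker_exchange_assoc, (sq' Z').inl_desc]
  · rw [← whisker_exchange_assoc, (sq' Z').inr_desc, h1]

/-- Exchange of the last two factors. -/
def exchange (X Y Z : SSet.{w}) : (X ⊗ Y) ⊗ Z ⟶ (X ⊗ Z) ⊗ Y :=
  homMk (fun _ z => ((z.1.1, z.2), z.1.2)) fun _ _ _ _ => rfl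

/-- The transpose of a map `A ⊗ Z ⟶ K`. -/
noncomputable def transpose {A Z K : SSet.{w}} : (A ⊗ Z ⟶ K) ≃ (A ⟶ (ihom Z).obj K) :=
  (Iso.homFromEquiv (Z := K) (β_ A Z)).trans ((ihom.adjunction Z).homEquiv A K)

lemma transpose_comp {A A' Z K : SSet.{w}} (f : A' ⟶ A) (g : A ⊗ Z ⟶ K) :
    f ≫ transpose g = transpose (f ▷ Z ≫ g) := by
  have h (A : SSet.{w}) (g : A ⊗ Z ⟶ K) : transpose g = curry ((β_ A Z).inv ≫ g) := rfl
  rw [h, h, ← curry_natural_left]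
  rfl

lemma htpy_transpose {A Z K : SSet.{w}} (f g : A ⊗ Z ⟶ K) :
    Htpy (transpose f) (transpose g) ↔ Htpy f g := by
  rw [htpy_iff, htpy_iff]
  constructor
  · rintro ⟨H, h0, h1⟩
    obtain ⟨H, rfl⟩ := transpose.surjective H
    rw [transpose_comp, transpose.apply_eq_iff_eq] at h0 h1
    refine ⟨exchange _ _ _ ≫ H, ?_, ?_⟩
    · rw [← h0]; rfl
    · rw [← h1]; rfl
  · rintro ⟨H, rfl, rfl⟩
    refine ⟨transpose (exchange _ _ _ ≫ H), ?_, ?_⟩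
    · rw [transpose_comp]; rfl
    · rw [transpose_comp]; rfl

/-- Maps `A ⊗ Z ⟶ K` are maps from `A` to the function complex `K^Z`, which is again Kan, and
transposition preserves and reflects homotopy. -/
lemma IsWeakEquiv.whiskerRight (hi : IsWeakEquiv i) (Z : SSet.{w}) : IsWeakEquiv (i ▷ Z) := by
  rw [isWeakEquiv_iff] at *
  intro K _
  refine ⟨fun g => ?_, fun h h' e => ?_⟩
  · obtain ⟨h, hh⟩ := (hi ((ihom Z).obj K)).1 (transpose g)
    obtain ⟨h, rfl⟩ := transpose.surjective h
    rw [transpose_comp, htpy_transpose] at hh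
    exact ⟨h, hh⟩
  · rw [← htpy_transpose, ← transpose_comp, ← transpose_comp] at e
    exact (htpy_transpose _ _).1 ((hi _).2 _ _ e)

/-- A weak equivalence gives an extension up to homotopy; the homotopy extension property of the
monomorphism makes it strict. -/
lemma IsWeakEquiv.exists_extension (hi : IsWeakEquiv i) [Mono i] {K : SSet.{w}} [KanComplex K]
    (v : A ⟶ K) : ∃ w : B ⟶ K, i ≫ w = v := by
  obtain ⟨h, hh⟩ := ((isWeakEquiv_iff i).1 hi K).1 v
  obtain ⟨H, h0, rfl⟩ := htpy_iff.1 hh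
  obtain ⟨l, -, h2, -⟩ := exists_lift_homotopy i (terminal.from K) h H (terminal.from _) h0.symm
    (by simp) (by simp)
  exact ⟨ι₁ ≫ l, by rw [← h2, ι₁_comp_assoc]⟩

/-- The maximum of the two parameters. -/
noncomputable def maxMap (Y : SSet.{w}) : (Y ⊗ Δ[1]) ⊗ Δ[1] ⟶ Y ⊗ Δ[1] :=
  homMk (fun _ z => (z.1.1, stdSimplex.objEquiv.symm (SimplexCategory.Hom.mk
    ((stdSimplex.objEquiv z.1.2).toOrderHom ⊔ (stdSimplex.objEquiv z.2).toOrderHom))))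
    fun _ _ _ _ => rfl

lemma ι₀_maxMap (Y : SSet.{w}) : ι₀ ≫ maxMap Y = 𝟙 _ := by
  refine hom_ext_apply ?_
  rintro m ⟨y, s⟩
  refine Prod.ext rfl (stdSimplex.objEquiv.injective ?_)
  ext i : 3
  exact sup_of_le_left (Fin.zero_le _)

lemma ι₀_whiskerRight_maxMap (Y : SSet.{w}) : ι₀ ▷ _ ≫ maxMap Y = 𝟙 _ := by
  refine hom_ext_apply ?_
  rintro m ⟨y, s⟩
  refine Prod.ext rfl (stdSimplex.objEquiv.injective ?_)
  ext i : 3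
  exact sup_of_le_right (Fin.zero_le _)

lemma ι₁_maxMap (Y : SSet.{w}) : ι₁ ≫ maxMap Y = fst _ _ ≫ ι₁ := by
  refine hom_ext_apply ?_
  rintro m ⟨y, s⟩
  refine Prod.ext rfl (stdSimplex.objEquiv.injective ?_)
  ext i : 3
  exact sup_of_le_right (Fin.le_last _)

lemma ι₁_whiskerRight_maxMap (Y : SSet.{w}) : ι₁ ▷ _ ≫ maxMap Y = fst _ _ ≫ ι₁ := by
  refine hom_ext_apply ?_
  rintro m ⟨y, s⟩
  refine Prod.ext rfl (stdSimplex.objEquiv.injective ?_)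
  ext i : 3
  exact sup_of_le_left (Fin.le_last _)

/-- A fibration with a section that is a homotopy inverse has the right lifting property with
respect to monomorphisms. -/
lemma exists_lift_of_section {E X : SSet.{w}} (p : E ⟶ X) [Fibration p] (q : X ⟶ E)
    (hq : q ≫ p = 𝟙 X) (hpq : Htpy (p ≫ q) (𝟙 E)) {Z Z' : SSet.{w}} (j : Z ⟶ Z') [Mono j]
    (e : Z ⟶ E) (x : Z' ⟶ X) (h : e ≫ p = j ≫ x) : ∃ l : Z' ⟶ E, j ≫ l = e ∧ l ≫ p = x := by
  obtain ⟨H, h0, h1⟩ := htpy_iff.1 hpq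
  -- The homotopy `H` from `p ≫ q` to the identity need not respect `p`. The box has `H` as bottom
  -- and `H ≫ p ≫ q` and the constant identity as sides. As the maximum of the parameters is
  -- constant when one of them is 1, the top face `ι₁ ≫ l` is a homotopy from `p ≫ q` to the
  -- identity lying over the constant homotopy of `p`.
  obtain ⟨l, h2, h3, h4, h5⟩ := exists_box_lift p H (H ≫ p ≫ q) (fst _ _) (maxMap E ≫ H ≫ p)
    (by rw [reassoc_of% h0, h0, reassoc_of% hq]) h1
    (by rw [reassoc_of% ι₀_maxMap E])
    (by rw [reassoc_of% ι₀_whiskerRight_maxMap E, Category.assoc, Category.assoc, hq,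
      Category.comp_id])
    (by rw [reassoc_of% ι₁_whiskerRight_maxMap E, reassoc_of% h1])
  -- The candidate `x ≫ q` lies over `x` but restricts to `e ≫ p ≫ q` instead of `e`. Moving it
  -- along the vertical homotopy, over the constant homotopy of `x`, corrects the restriction.
  obtain ⟨l', h6, h7, h8⟩ := exists_lift_homotopy j p (x ≫ q) (e ▷ _ ≫ ι₁ ≫ l) (fst _ _ ≫ x)
    (by rw [ι₀_comp_assoc, ← ι₁_comp_assoc, h3, reassoc_of% h1, reassoc_of% h])
    (by rw [Category.assoc, hq, ι₀_fst_assoc, Category.comp_id])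
    (by rw [Category.assoc, Category.assoc, h5, reassoc_of% ι₁_maxMap E, reassoc_of% h1,
      whiskerRight_fst_assoc, whiskerRight_fst_assoc, h])
  refine ⟨ι₁ ≫ l', ?_, ?_⟩
  · have h9 : ι₁ ≫ ι₁ ≫ l = 𝟙 E := (ι₁_comp_assoc (ι₁ (X := E)) l).symm.trans (by rw [h4, ι₁_fst])
    rw [← ι₁_comp_assoc, h7]
    exact (ι₁_comp_assoc e (ι₁ ≫ l)).trans (by rw [h9, Category.comp_id])
  · rw [Category.assoc, h8, ι₁_fst_assoc]

/-- A monomorphism that is a weak equivalence is a trivial cofibration. -/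
lemma IsWeakEquiv.trivCof (hi : IsWeakEquiv i) [Mono i] : TrivCof i := by
  intro K _ Z Z' j _ u v h
  -- By adjunction, the extension sought is a lift of `j` against the restriction `p : K^B ⟶ K^A`.
  let p := (MonoidalClosed.pre i).app K
  -- Extending the evaluation `A ⊗ K^A ⟶ K` over `B ⊗ K^A` gives, after currying, a section of `p`.
  obtain ⟨Q, hQ⟩ := (hi.whiskerRight ((ihom A).obj K)).exists_extension (K := K)
    ((ihom.ev A).app K : A ⊗ (ihom A).obj K ⟶ K)
  have hq : curry Q ≫ p = 𝟙 _ := by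
    rw [curry_pre_app, hQ]
    exact curry_uncurry (𝟙 _)
  have hpq : Htpy (p ≫ curry Q) (𝟙 _) := by
    -- Both uncurried maps `B ⊗ K^B ⟶ K` have the same restriction to `A ⊗ K^B`, and `i ▷ K^B` is a
    -- weak equivalence, so they are homotopic.
    have h1 : Htpy (uncurry (p ≫ curry Q)) (uncurry (𝟙 ((ihom B).obj K))) := by
      refine ((isWeakEquiv_iff _).1 (hi.whiskerRight ((ihom B).obj K)) K).2 _ _ ?_
      rw [← uncurry_pre_app, ← uncurry_pre_app, Category.assoc, hq]
      simpa using .refl _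
    obtain ⟨H, h0, h1⟩ := htpy_iff.1 h1
    refine htpy_iff.2 ⟨curry ((α_ _ _ _).inv ≫ H), ?_, ?_⟩
    · rw [← curry_natural_left, ← curry_uncurry (p ≫ curry Q), ← h0]
      rfl
    · rw [← curry_natural_left, ← curry_uncurry (𝟙 ((ihom B).obj K)), ← h1]
      rfl
  obtain ⟨l, h1, h2⟩ := exists_lift_of_section p _ hq hpq j (curry u) (curry v) (by
    rw [curry_pre_app, h, curry_natural_left])
  refine ⟨uncurry l, ?_, ?_⟩
  · rw [← uncurry_natural_left, h1, uncurry_curry]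
  · rw [← uncurry_pre_app, h2, uncurry_curry]

end

end KTheory

/-! ### The realization lemma for bisimplicial sets -/

namespace KTheory

open CategoryTheory Limits Simplicial Opposite MonoidalCategory CartesianMonoidalCategory HomotopicalAlgebra SSet SSet.modelCategoryQuillen

/-- Pushouts are computed degreewise, and in each degree `A'` is the union of `A` and the injective
image of `Y`, with intersection `S`. -/
lemma isPushout_of_subcomplex {X Y : SSet.{w}} (i : Y ⟶ X) [Mono i] {A A' : X.Subcomplex}
    {S : Y.Subcomplex} (hS : ∀ m y, y ∈ S.obj m ↔ i.app m y ∈ A.obj m) (hA : A ≤ A')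
    (hi : ∀ m y, i.app m y ∈ A'.obj m)
    (hA' : ∀ m x, x ∈ A'.obj m → x ∈ A.obj m ∨ ∃ y, i.app m y = x) :
    IsPushout (homMk (fun m y => ⟨i.app m y.1, (hS m y.1).1 y.2⟩)
      (fun _ _ θ y => Subtype.ext (app_map i θ y.1)) : S.toSSet ⟶ A.toSSet) S.ι
      (Subcomplex.homOfLE hA) (homMk (fun m y => ⟨i.app m y, hi m y⟩)
        (fun _ _ θ y => Subtype.ext (app_map i θ y))) where
  w := rfl
  isColimit' := ⟨evaluationJointlyReflectsColimits _ (fun m ↦ by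
    have hinj := (mono_iff_injective_app i).1 inferInstance
    refine (isColimitMapCoconePushoutCoconeEquiv _ _).2 (IsPushout.isColimit ?_)
    have : Mono (((evaluation SimplexCategoryᵒᵖ (Type w)).obj m).map (Subcomplex.homOfLE hA)) :=
      (CategoryTheory.mono_iff_injective _).2 fun x y h =>
        Subtype.ext (congrArg (fun t : A'.obj m => t.1) h)
    refine Types.isPushout_of_isPullback_of_mono' ?_ ?_ ?_
    · rw [Types.isPullback_iff]
      refine ⟨rfl, ?_, ?_⟩
      · rintro x y ⟨-, h⟩
        exact Subtype.ext h
      · rintro x y h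
        have h' : x.1 = i.app m y := congrArg Subtype.val h
        exact ⟨⟨y, (hS m y).2 (h' ▸ x.2)⟩, Subtype.ext h'.symm, rfl⟩
    · refine Set.eq_univ_of_forall fun x => ?_
      obtain h | ⟨y, hy⟩ := hA' m x.1 x.2
      · exact Or.inl ⟨⟨x.1, h⟩, rfl⟩
      · exact Or.inr ⟨y, Subtype.ext hy⟩
    · exact fun x y _ _ h => hinj m (congrArg Subtype.val h))⟩

lemma isIso_of_bijective_app {X Y : SSet.{w}} (f : X ⟶ Y)
    (h : ∀ m, Function.Bijective (f.app m)) : IsIso f := by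
  rw [NatTrans.isIso_iff_isIso_app]
  exact fun m => (isIso_iff_bijective _).2 (h m)

section

variable {B B' : SimplexCategoryᵒᵖ ⥤ SSet.{w}} (f : B ⟶ B')

lemma map_comp_app {p q r : SimplexCategoryᵒᵖ} (θ : p ⟶ q) (η : q ⟶ r) {n : SimplexCategoryᵒᵖ}
    (x : (B.obj p).obj n) :
    (B.map (θ ≫ η)).app n x = (B.map η).app n ((B.map θ).app n x) := by
  rw [B.map_comp]; rfl

lemma map_id_app {p : SimplexCategoryᵒᵖ} {n : SimplexCategoryᵒᵖ} (x : (B.obj p).obj n) :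
    (B.map (𝟙 p)).app n x = x := by
  rw [B.map_id]; rfl

lemma app_map_app {p q : SimplexCategoryᵒᵖ} (θ : p ⟶ q) {n : SimplexCategoryᵒᵖ}
    (x : (B.obj p).obj n) :
    (f.app q).app n ((B.map θ).app n x) = (B'.map θ).app n ((f.app p).app n x) :=
  congr_app_apply (f.naturality θ) x

/-- The union of the range of `f` and of the first `j` degeneracies. -/
def latch (m : SimplexCategoryᵒᵖ) (j : ℕ) : (B'.obj m).Subcomplex where
  obj n := {x | (∃ y, (f.app m).app n y = x) ∨ ∃ (p : SimplexCategoryᵒᵖ) (θ : p ⟶ m)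
    (y : (B'.obj p).obj n), (∃ i < j, ∃ h : i + 1 < m.unop.len + 1, θ.unop.toOrderHom
      ⟨i, (Nat.lt_succ_self i).trans h⟩ = θ.unop.toOrderHom ⟨i + 1, h⟩) ∧ (B'.map θ).app n y = x}
  map {n n'} η := by
    rintro x (⟨y, rfl⟩ | ⟨p, θ, y, h, rfl⟩)
    · exact Or.inl ⟨_, app_map _ η y⟩
    · exact Or.inr ⟨p, θ, (B'.obj p).map η y, h, app_map _ η y⟩

variable {f}

lemma map_mem_latch {m m' : SimplexCategoryᵒᵖ} (η : m ⟶ m') {j : ℕ}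
    (hη : ∀ i < j, ∃ (h : i + 1 < m'.unop.len + 1) (h' : i + 1 < m.unop.len + 1),
      η.unop.toOrderHom ⟨i, (Nat.lt_succ_self i).trans h⟩ = ⟨i, (Nat.lt_succ_self i).trans h'⟩ ∧
      η.unop.toOrderHom ⟨i + 1, h⟩ = ⟨i + 1, h'⟩) {n : SimplexCategoryᵒᵖ} {x : (B'.obj m).obj n}
    (hx : x ∈ (latch f m j).obj n) : (B'.map η).app n x ∈ (latch f m' j).obj n := by
  obtain ⟨y, rfl⟩ | ⟨p, θ, y, ⟨i, hi, h, e⟩, rfl⟩ := hx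
  · exact Or.inl ⟨_, app_map_app f η y⟩
  · obtain ⟨h', h'', e1, e2⟩ := hη i hi
    exact Or.inr ⟨p, θ ≫ η, y, ⟨i, hi, h', (congrArg θ.unop.toOrderHom e1).trans
      (e.trans (congrArg θ.unop.toOrderHom e2).symm)⟩, map_comp_app _ _ _⟩

lemma latch_mono {m : SimplexCategoryᵒᵖ} {j j' : ℕ} (h : j ≤ j') : latch f m j ≤ latch f m j' := by
  rintro n x (h1 | ⟨p, θ, y, ⟨i, hi, e⟩, rfl⟩)
  · exact Or.inl h1
  · exact Or.inr ⟨p, θ, y, ⟨i, hi.trans_le h, e⟩, rfl⟩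

/-- The factorization of `f` through `latch`. -/
def toLatch (f : B ⟶ B') (m : SimplexCategoryᵒᵖ) (j : ℕ) : B.obj m ⟶ (latch f m j).toSSet :=
  homMk (fun n y => ⟨(f.app m).app n y, Or.inl ⟨y, rfl⟩⟩)
    fun _ _ θ y => Subtype.ext (app_map (f.app m) θ y)

/-- The composite of `σ j` and `δ j.succ` moves only the vertex `j + 1`, to `j`. Hence a simplex
whose operator identifies `j` and `j + 1` is degenerate along `σ j`. -/
lemma σ_comp_δ_comp {m : ℕ} (j : Fin (m + 1)) {p : SimplexCategory} (θ : ⦋m + 1⦌ ⟶ p)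
    (h : θ.toOrderHom j.castSucc = θ.toOrderHom j.succ) :
    SimplexCategory.σ j ≫ SimplexCategory.δ j.succ ≫ θ = θ := by
  ext k : 3
  change θ.toOrderHom (j.succ.succAbove (j.predAbove k)) = _
  obtain rfl | hk := eq_or_ne k j.succ
  · rw [Fin.predAbove_succ_self, Fin.succAbove_succ_self, h]
  · rw [Fin.succ_succAbove_predAbove hk]

lemma map_δ_map_σ {m : ℕ} (j : Fin (m + 1)) {n : SimplexCategoryᵒᵖ}
    (x : (B.obj (op ⦋m⦌)).obj n) :
    (B.map (SimplexCategory.δ j.succ).op).app n ((B.map (SimplexCategory.σ j).op).app n x) = x := by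
  rw [← map_comp_app, ← op_comp, SimplexCategory.δ_comp_σ_succ]
  exact map_id_app x

lemma isWeakEquiv_toLatch_zero (m : SimplexCategoryᵒᵖ) [Mono (f.app m)] :
    IsWeakEquiv (toLatch f m 0) := by
  have : IsIso (toLatch f m 0) := isIso_of_bijective_app _ fun n =>
    ⟨fun x y h => (mono_iff_injective_app (f.app m)).1 inferInstance n (congrArg Subtype.val h), by
      rintro ⟨_, ⟨y, rfl⟩ | ⟨_, _, _, ⟨i, hi, _⟩, _⟩⟩
      · exact ⟨y, rfl⟩
      · exact absurd hi (Nat.not_lt_zero i)⟩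
  exact isWeakEquiv_of_iso _

/-- Admitting one more degeneracy `σ j` in degree `m + 1` attaches a copy of `B'_m`, embedded by `σ
j`, along the simplices already reached. These form stage `j` in degree `m`, so the inclusion is a
pushout of the one in the hypothesis. -/
lemma trivCof_latch_succ {m : ℕ} (j : Fin (m + 1))
    (h : TrivCof (latch f (op ⦋m⦌) j).ι) :
    TrivCof (Subcomplex.homOfLE (latch_mono (f := f) (m := op ⦋m + 1⦌) (Nat.le_succ j))) := by
  have hmono : Mono (B'.map (SimplexCategory.σ j).op) := by
    rw [mono_iff_injective_app]
    exact fun n => Function.LeftInverse.injective (map_δ_map_σ j)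
  refine .of_isPushout (isPushout_of_subcomplex (B'.map (SimplexCategory.σ j).op) ?_ _ ?_ ?_) h
  · intro n y
    constructor
    · refine map_mem_latch _ fun i hi => ⟨by simp; omega, by simp; omega, ?_, ?_⟩
      · exact Fin.predAbove_of_le_castSucc _ _ (Fin.mk_le_of_le_val hi.le)
      · exact Fin.predAbove_of_le_castSucc _ _ (Fin.mk_le_of_le_val hi)
    · intro hy
      rw [← map_δ_map_σ j y]
      refine map_mem_latch _ (fun i hi => ⟨by simp; omega, by simp; omega, ?_, ?_⟩) hy
      · exact Fin.succAbove_of_castSucc_lt _ _ (Fin.lt_def.2 (hi.trans (Nat.lt_succ_self _)))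
      · exact Fin.succAbove_of_castSucc_lt _ _ (Fin.lt_def.2 (Nat.succ_lt_succ hi))
  · intro n y
    refine Or.inr ⟨_, _, y, ⟨j, Nat.lt_succ_self j, by simp; omega, ?_⟩, rfl⟩
    exact (Fin.predAbove_castSucc_self j).trans (Fin.predAbove_succ_self j).symm
  · rintro n x (⟨y, hy⟩ | ⟨p, θ, y, ⟨i, hi, h, e⟩, rfl⟩)
    · exact Or.inl (Or.inl ⟨y, hy⟩)
    · obtain hi | rfl := Nat.lt_succ_iff_lt_or_eq.1 hi
      · exact Or.inl (Or.inr ⟨p, θ, y, ⟨i, hi, h, e⟩, rfl⟩)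
      · refine Or.inr ⟨(B'.map (θ ≫ (SimplexCategory.δ j.succ).op)).app n y, ?_⟩
        rw [← map_comp_app, Category.assoc]
        congr 4
        exact Quiver.Hom.unop_inj (σ_comp_δ_comp j θ.unop e)

/-- Induction on the degree and, within it, on the number of degeneracies. The map `f` in degree `m`
factors through every stage, so two-out-of-three makes the inclusion of the stage a weak
equivalence, hence a trivial cofibration, as the next degree needs. -/
lemma isWeakEquiv_toLatch (hf : ∀ m, Mono (f.app m)) (hw : ∀ m, IsWeakEquiv (f.app m)) :
    ∀ m j : ℕ, j ≤ m → IsWeakEquiv (toLatch f (op ⦋m⦌) j) := by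
  intro m
  induction m with
  | zero =>
    intro j hj
    obtain rfl : j = 0 := by omega
    exact isWeakEquiv_toLatch_zero _
  | succ m ih =>
    intro j
    induction j with
    | zero => exact fun _ => isWeakEquiv_toLatch_zero _
    | succ j ih' =>
      intro hj
      refine (ih' (by omega)).comp (trivCof_latch_succ ⟨j, by omega⟩ ?_).isWeakEquiv
      refine IsWeakEquiv.trivCof ?_
      exact (ih j (by omega)).of_comp_left (hw _)

/-- At stage `m` all degeneracies of degree `m` are present: a levelwise trivial cofibration of
bisimplicial sets is a Reedy trivial cofibration. -/
lemma trivCof_latch (hf : ∀ m, Mono (f.app m)) (hw : ∀ m, IsWeakEquiv (f.app m)) (m : ℕ) :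
    TrivCof (latch f (op ⦋m⦌) m).ι :=
  ((isWeakEquiv_toLatch hf hw m m le_rfl).of_comp_left (hw _)).trivCof

lemma exists_fac_of_not_surjective {n : SimplexCategory} {r : ℕ} (θ : n ⟶ ⦋r⦌)
    (h : ¬ Function.Surjective θ.toOrderHom) :
    ∃ (p : SimplexCategory) (a : n ⟶ p) (b : p ⟶ ⦋r⦌), p.len < r ∧ a ≫ b = θ := by
  refine ⟨image θ, factorThruImage θ, image.ι θ, lt_of_le_of_ne
    (SimplexCategory.len_le_of_mono (image.ι θ)) fun e => h ?_, image.fac θ⟩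
  have := (SimplexCategory.isIso_iff_of_mono (image.ι θ)).2 e
  rw [← SimplexCategory.epi_iff_surjective, ← image.fac θ]
  exact epi_comp _ _

lemma exists_toOrderHom_eq {r : ℕ} {p : SimplexCategory} (θ : ⦋r⦌ ⟶ p) (h : p.len < r) :
    ∃ i < r, ∃ hi : i + 1 < r + 1,
      θ.toOrderHom ⟨i, (Nat.lt_succ_self i).trans hi⟩ = θ.toOrderHom ⟨i + 1, hi⟩ := by
  by_contra! H
  have h1 : StrictMono θ.toOrderHom := Fin.strictMono_iff_lt_succ.2 fun i =>
    lt_of_le_of_ne (θ.toOrderHom.monotone i.castSucc_lt_succ.le) (H i i.2 (Nat.succ_lt_succ i.2))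
  have := Fintype.card_le_of_injective _ h1.injective
  simp at this
  omega

variable (f) in
/-- The subcomplex of the diagonal given by the range of `f` and the `p`-skeleta for `p < r` in the
first direction. -/
def diagSk (r : ℕ) : (diag B').Subcomplex where
  obj n := {x | (∃ y, (f.app n).app n y = x) ∨ ∃ (p : SimplexCategoryᵒᵖ) (θ : p ⟶ n)
    (y : (B'.obj p).obj n), p.unop.len < r ∧ (B'.map θ).app n y = x}
  map {n n'} η := by
    rintro x (⟨y, rfl⟩ | ⟨p, θ, y, h, rfl⟩)
    · exact Or.inl ⟨(diag B).map η y,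
        (app_map (f.app n') η _).trans (congrArg ((B'.obj n').map η) (app_map_app f η y))⟩
    · refine Or.inr ⟨p, θ ≫ η, (B'.obj p).map η y, h, (app_map _ η y).trans ?_⟩
      rw [map_comp_app]
      rfl

/-- Stage `r + 1` arises from stage `r` by attaching `B'_r ⊗ Δ[r]` along the pushout-product of the
latching inclusion of degree `r` with `∂Δ[r] ⟶ Δ[r]`. Since the latching inclusion is a trivial
cofibration, the map extends over the attached piece. -/
lemma exists_diagSk_extension (hf : ∀ m, Mono (f.app m)) (hw : ∀ m, IsWeakEquiv (f.app m)) {r : ℕ}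
    {K : SSet.{w}} [KanComplex K] (g : (diagSk f r).toSSet ⟶ K) :
    ∃ g' : (diagSk f (r + 1)).toSSet ⟶ K, ∀ n x hx hx', g'.app n ⟨x, hx⟩ = g.app n ⟨x, hx'⟩ := by
  -- Over `∂Δ[r]` the operator factors through a smaller degree, so the attaching map lands in stage
  -- `r`.
  have hu {n : SimplexCategoryᵒᵖ} (x : (B'.obj (op ⦋r⦌)).obj n) (s : n.unop ⟶ ⦋r⦌)
      (hs : ¬ Function.Surjective s.toOrderHom) :
      (B'.map s.op).app n x ∈ (diagSk f r).obj n := by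
    obtain ⟨p, a, b, hp, rfl⟩ := exists_fac_of_not_surjective s hs
    exact Or.inr ⟨op p, a.op, (B'.map b.op).app n x, hp, (map_comp_app _ _ _).symm⟩
  -- Over the latching part a simplex comes from `f` or is degenerate in the first direction; in
  -- both cases its image lies in stage `r`.
  have hv {n : SimplexCategoryᵒᵖ} (x : (B'.obj (op ⦋r⦌)).obj n) (s : n.unop ⟶ ⦋r⦌)
      (hx : x ∈ (latch f (op ⦋r⦌) r).obj n) :
      (B'.map s.op).app n x ∈ (diagSk f r).obj n := by
    obtain ⟨y, rfl⟩ | ⟨p, θ, y, ⟨i, hi, h, e⟩, rfl⟩ := hx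
    · exact Or.inl ⟨_, app_map_app f s.op y⟩
    · obtain ⟨r, rfl⟩ : ∃ r', r = r' + 1 := ⟨r - 1, by omega⟩
      refine Or.inr ⟨op ⦋r⦌, (s ≫ SimplexCategory.σ ⟨i, hi⟩).op,
        (B'.map (θ ≫ (SimplexCategory.δ (⟨i, hi⟩ : Fin (r + 1)).succ).op)).app n y,
        Nat.lt_succ_self r, ?_⟩
      rw [← map_comp_app, ← map_comp_app]
      congr 4
      exact Quiver.Hom.unop_inj (congrArg (fun t => s ≫ t) (σ_comp_δ_comp ⟨i, hi⟩ θ.unop e))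
  have hg {n n' : SimplexCategoryᵒᵖ} (η : n ⟶ n') (x : (B'.obj (op ⦋r⦌)).obj n) (s : n.unop ⟶ ⦋r⦌)
      (h h') : g.app n' ⟨(B'.map (η.unop ≫ s).op).app n' ((B'.obj (op ⦋r⦌)).map η x), h'⟩ =
        K.map η (g.app n ⟨(B'.map s.op).app n x, h⟩) := by
    refine Eq.trans (congrArg (g.app n') (Subtype.ext ?_)) (app_map g η ⟨_, h⟩)
    refine (map_comp_app s.op η _).trans ?_
    rw [app_map]
    exact app_map _ _ _
  let E {n : SimplexCategoryᵒᵖ} (s : (Δ[r] : SSet.{w}).obj n) : n.unop ⟶ ⦋r⦌ :=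
    stdSimplex.objEquiv s
  obtain ⟨W, hW1, hW2⟩ := trivCof_latch hf hw r ∂Δ[r].ι
    (homMk (fun n z => g.app n ⟨(B'.map (E z.2.1).op).app n z.1, hu _ _ z.2.2⟩)
      fun n n' η z => hg η z.1 (E z.2.1) _ _)
    (homMk (fun n z => g.app n ⟨(B'.map (E z.2).op).app n z.1.1, hv _ _ z.1.2⟩)
      fun n n' η z => hg η z.1.1 (E z.2) _ _) rfl
  -- The extension `W` is prescribed on the pushout-product only. If the diagonal simplex lies in
  -- stage `r` and `s` is surjective, a section of `s` recovers `y` and shows that `y` is in the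
  -- latching part, so nothing conflicts with `g`.
  have hW {n : SimplexCategoryᵒᵖ} (y : (B'.obj (op ⦋r⦌)).obj n) (s : (Δ[r] : SSet.{w}).obj n)
      (h : (B'.map (E s).op).app n y ∈ (diagSk f r).obj n) : W.app n (y, s) = g.app n ⟨_, h⟩ := by
    by_cases hs : Function.Surjective (E s).toOrderHom
    · have : Epi (E s) := SimplexCategory.epi_iff_surjective.2 hs
      obtain ⟨⟨t⟩⟩ := isSplitEpi_of_epi (E s)
      have hy : y = (B'.map t.section_.op).app n ((B'.map (E s).op).app n y) := by
        rw [← map_comp_app, ← op_comp, t.id]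
        exact (map_id_app y).symm
      have hl : y ∈ (latch f (op ⦋r⦌) r).obj n := by
        obtain ⟨z, hz⟩ | ⟨p, θ, z, hp, hz⟩ := h
        · rw [hy, ← hz]
          exact Or.inl ⟨_, app_map_app f _ z⟩
        · rw [hy, ← hz, ← map_comp_app]
          exact Or.inr ⟨p, _, z, exists_toOrderHom_eq _ hp, rfl⟩
      exact congr_app_apply hW2 (m := n) (⟨y, hl⟩, s)
    · exact congr_app_apply hW1 (m := n) (y, ⟨s, hs⟩)
  have hinj {n : SimplexCategoryᵒᵖ} (y y' : (B'.obj (op ⦋r⦌)).obj n) (s s' : (Δ[r] : SSet.{w}).obj n)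
      (e : (B'.map (E s).op).app n y = (B'.map (E s').op).app n y') :
      W.app n (y, s) = W.app n (y', s') := by
    by_cases h : (B'.map (E s).op).app n y ∈ (diagSk f r).obj n
    · rw [hW y s h, hW y' s' (e ▸ h)]
      exact congrArg (g.app n) (Subtype.ext e)
    · obtain ⟨⟨k⟩⟩ := n
      have hepi (y : (B'.obj (op ⦋r⦌)).obj (op ⦋k⦌)) (s : (Δ[r] : SSet.{w}).obj (op ⦋k⦌))
          (h : (B'.map (E s).op).app _ y ∉ (diagSk f r).obj (op ⦋k⦌)) : Epi (E s) := by
        by_contra hs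
        rw [SimplexCategory.epi_iff_surjective] at hs
        exact h (hu y _ hs)
      -- For fixed second degree `B'` is a simplicial set in the first direction. A diagonal simplex
      -- outside stage `r` presents as a surjection and a non-degenerate simplex of it, and this
      -- presentation is unique by the Eilenberg–Zilber lemma.
      let X : SSet.{w} := B' ⋙ (evaluation _ _).obj (op ⦋k⦌)
      have hnd (y : (B'.obj (op ⦋r⦌)).obj (op ⦋k⦌)) (s : (Δ[r] : SSet.{w}).obj (op ⦋k⦌))
          (h : (B'.map (E s).op).app _ y ∉ (diagSk f r).obj (op ⦋k⦌)) :
          y ∈ X.nonDegenerate r := by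
        rintro ⟨m, hm, φ, z, rfl⟩
        exact h (Or.inr ⟨op ⦋m⦌, φ.op ≫ (E s).op, z, hm, map_comp_app _ _ _⟩)
      have := hepi y s h
      have h' : (B'.map (E s').op).app _ y' ∉ (diagSk f r).obj (op ⦋k⦌) := e ▸ h
      have h1 := X.unique_nonDegenerate_simplex _ (E s) ⟨y, hnd y s h⟩ rfl (E s')
        ⟨y', hnd y' s' h'⟩ e
      have h2 := X.unique_nonDegenerate_map _ (E s) ⟨y, hnd y s h⟩ rfl (E s')
        ⟨y', hnd y' s' h'⟩ e
      obtain rfl : y = y' := congrArg Subtype.val h1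
      obtain rfl : s = s' := stdSimplex.objEquiv.injective h2
      rfl
  have hmem {n : SimplexCategoryᵒᵖ} (x : (diag B').obj n) (hx : x ∈ (diagSk f (r + 1)).obj n)
      (hx' : x ∉ (diagSk f r).obj n) : ∃ (y : (B'.obj (op ⦋r⦌)).obj n) (s : (Δ[r] : SSet.{w}).obj n),
        (B'.map (E s).op).app n y = x := by
    obtain h | ⟨⟨⟨p⟩⟩, θ, y, hp, rfl⟩ := hx
    · exact absurd (Or.inl h) hx'
    · obtain hp | rfl := Nat.lt_succ_iff_lt_or_eq.1 hp
      · exact absurd (Or.inr ⟨_, θ, y, hp, rfl⟩) hx'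
      · exact ⟨y, stdSimplex.objEquiv.symm θ.unop, rfl⟩
  have hG (n : SimplexCategoryᵒᵖ) (x : (diagSk f (r + 1)).toSSet.obj n) : ∃ k : K.obj n,
      (∀ h, k = g.app n ⟨x.1, h⟩) ∧ ∀ y s, (B'.map (E s).op).app n y = x.1 → k = W.app n (y, s) := by
    by_cases h : x.1 ∈ (diagSk f r).obj n
    · refine ⟨g.app n ⟨x.1, h⟩, fun _ => rfl, fun y s e => ?_⟩
      rw [hW y s (e ▸ h)]
      exact congrArg (g.app n) (Subtype.ext e.symm)
    · obtain ⟨y, s, e⟩ := hmem x.1 x.2 h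
      exact ⟨W.app n (y, s), fun h' => absurd h' h, fun y' s' e' => hinj _ _ _ _ (e.trans e'.symm)⟩
  choose G hG1 hG2 using hG
  refine ⟨homMk G ?_, fun n x hx hx' => hG1 n ⟨x, hx⟩ hx'⟩
  intro n n' η x
  by_cases h : x.1 ∈ (diagSk f r).obj n
  · rw [hG1 n x h]
    exact (hG1 n' ((diagSk f (r + 1)).toSSet.map η x) ((diagSk f r).map η h)).trans (app_map g η ⟨x.1, h⟩)
  · obtain ⟨y, s, e⟩ := hmem x.1 x.2 h
    rw [hG2 n x y s e]
    refine (hG2 n' _ ((B'.obj (op ⦋r⦌)).map η y) ((Δ[r] : SSet.{w}).map η s) ?_).trans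
      (app_map W η (y, s))
    refine (map_comp_app (E s).op η _).trans ?_
    rw [app_map, app_map, e]
    rfl

variable (f) in
/-- The map of diagonals induced by a map of bisimplicial sets. -/
def diagMap : diag B ⟶ diag B' :=
  homMk (fun n y => (f.app n).app n y) fun _ n' η y =>
    (app_map (f.app n') η _).trans (congrArg ((B'.obj n').map η) (app_map_app f η y))

/-- Stage 0 is the range of `f`, where injectivity determines the map; it is extended stage by
stage, and every diagonal simplex lies in some stage. -/
lemma exists_diag_extension (hf : ∀ m, Mono (f.app m)) (hw : ∀ m, IsWeakEquiv (f.app m))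
    {K : SSet.{w}} [KanComplex K] (g : diag B ⟶ K) : ∃ g' : diag B' ⟶ K, diagMap f ≫ g' = g := by
  have hinj (n : SimplexCategoryᵒᵖ) := (mono_iff_injective_app _).1 (hf n) n
  have h0 : ∃ g₀ : (diagSk f 0).toSSet ⟶ K, ∀ m y h,
      g₀.app m ⟨(f.app m).app m y, h⟩ = g.app m y := by
    have h1 (n : SimplexCategoryᵒᵖ) (x : (diagSk f 0).toSSet.obj n) : ∃ y, (f.app n).app n y = x.1 := by
      obtain h | ⟨_, _, _, h, _⟩ := x.2
      · exact h
      · exact absurd h (Nat.not_lt_zero _)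
    choose Y hY using h1
    refine ⟨homMk (fun n x => g.app n (Y n x)) fun n n' η x => ?_, fun n y h => ?_⟩
    · refine Eq.trans (congrArg (g.app n') (hinj n' ?_)) (app_map g η (Y n x))
      rw [hY]
      refine Eq.trans ?_ (app_map (diagMap f) η (Y n x)).symm
      exact congrArg ((diag B').map η) (hY n x).symm
    · exact congrArg (g.app n) (hinj n (hY n ⟨_, h⟩))
  obtain ⟨g₀, hg₀⟩ := h0
  choose N hN using fun r (g : (diagSk f r).toSSet ⟶ K) => exists_diagSk_extension hf hw g
  let G (r : ℕ) : (diagSk f r).toSSet ⟶ K := Nat.rec g₀ N r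
  have hle (r n x hx) (k) (hx') : (G (r + k)).app n ⟨x, hx'⟩ = (G r).app n ⟨x, hx⟩ := by
    induction k with
    | zero => rfl
    | succ k ih =>
      have hx'' : x ∈ (diagSk f (r + k)).obj n := by
        obtain h | ⟨p, θ, y, h, e⟩ := hx
        · exact Or.inl h
        · exact Or.inr ⟨p, θ, y, by omega, e⟩
      rw [← ih hx'']
      exact hN _ _ _ _ _ _
  -- Stages bound the first degree strictly, so a diagonal simplex of dimension `d` is reached at
  -- stage `d + 1`.
  have htop {n : SimplexCategoryᵒᵖ} (x : (diag B').obj n) :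
      x ∈ (diagSk f (n.unop.len + 1)).obj n :=
    Or.inr ⟨n, 𝟙 n, x, Nat.lt_succ_self _, map_id_app x⟩
  have hle' (r r' n x hx hx') : (G r).app n ⟨x, hx⟩ = (G r').app n ⟨x, hx'⟩ := by
    obtain ⟨k, rfl⟩ | ⟨k, rfl⟩ := (le_total r r').imp Nat.exists_eq_add_of_le
      Nat.exists_eq_add_of_le
    · exact (hle _ _ _ _ _ _).symm
    · exact hle _ _ _ _ _ _
  refine ⟨homMk (fun n x => (G (n.unop.len + 1)).app n ⟨x, htop x⟩) fun n n' η x => ?_,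
    hom_ext_apply fun n y => ?_⟩
  · refine (hle' (n'.unop.len + 1) (n.unop.len + 1) n' _ (htop _) ((diagSk f _).map η (htop x))).trans ?_
    exact app_map (G _) η ⟨x, htop x⟩
  · exact (hle' (n.unop.len + 1) 0 n ((f.app n).app n y) (htop _) (Or.inl ⟨y, rfl⟩)).trans
      (hg₀ n y _)

lemma mem_latch_zero {m n : SimplexCategoryᵒᵖ} {x : (B'.obj m).obj n}
    (h : x ∈ (latch f m 0).obj n) : ∃ y, (f.app m).app n y = x := by
  obtain h | ⟨_, _, _, ⟨i, hi, _⟩, _⟩ := h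
  · exact h
  · exact absurd hi (Nat.not_lt_zero i)

/-- The union contains `S ⊗ Y`, by a pushout of the trivial cofibration `S ⊗ T ⟶ X ⊗ T`, and the
composite to `X ⊗ Y` is `S.ι` times `Y`; two-out-of-three applies. -/
lemma isWeakEquiv_unionProd {X Y : SSet.{w}} {S : X.Subcomplex} (hS : IsWeakEquiv S.ι)
    (T : Y.Subcomplex) : IsWeakEquiv (S.unionProd T).ι :=
  (TrivCof.of_isPushout (Subcomplex.unionProd.isPushout S T).flip
    (hS.whiskerRight T.toSSet).trivCof).isWeakEquiv.of_comp_left (hS.whiskerRight Y)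

variable (f) in
/-- The bisimplicial pushout-product of `f` with the boundary of `Δ[1]`. -/
def boundaryProd : SimplexCategoryᵒᵖ ⥤ SSet.{w} where
  obj m := ((latch f m 0).unionProd (∂Δ[1] : Subcomplex Δ[1])).toSSet
  map θ := homMk (fun n z => ⟨((B'.map θ).app n z.1.1, z.1.2),
      (Subcomplex.mem_unionProd_iff _ _ _).2 (((Subcomplex.mem_unionProd_iff _ _ _).1 z.2).imp_right
        (map_mem_latch θ fun i hi => absurd hi (Nat.not_lt_zero i)))⟩)
      fun _ _ η z => Subtype.ext (Prod.ext (app_map (B'.map θ) η z.1.1) rfl)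
  map_id _ := hom_ext_apply fun _ z => Subtype.ext (Prod.ext (map_id_app z.1.1) rfl)
  map_comp θ θ' := hom_ext_apply fun _ z => Subtype.ext (Prod.ext (map_comp_app θ θ' z.1.1) rfl)

variable (f) in
/-- The inclusion of the pushout-product. -/
def boundaryProdι : boundaryProd f ⟶ B' ⋙ tensorRight Δ[1] where
  app m := ((latch f m 0).unionProd (∂Δ[1] : Subcomplex Δ[1])).ι
  naturality _ _ _ := rfl

/-- Extension along `f` gives surjectivity on homotopy classes. For injectivity the same extension
result is applied to the pushout-product with `∂Δ[1]`, which is again levelwise a monomorphism and a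
weak equivalence. -/
lemma isWeakEquiv_diagMap_of_mono (hf : ∀ m, Mono (f.app m)) (hw : ∀ m, IsWeakEquiv (f.app m)) :
    IsWeakEquiv (diagMap f) := by
  rw [isWeakEquiv_iff]
  intro K _
  refine ⟨fun g => ?_, fun h h' e => ?_⟩
  · obtain ⟨g', hg⟩ := exists_diag_extension hf hw g
    exact ⟨g', hg ▸ .refl _⟩
  · obtain ⟨H, h0, h1⟩ := htpy_iff.1 e
    have hH : _ ◁ _ ≫ H = _ := comp_eq_ends_iff.2 ⟨h0, h1⟩
    rw [← comp_ends] at hH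
    have hinj (n : SimplexCategoryᵒᵖ) := (mono_iff_injective_app _).1 (hf n) n
    -- The map to extend is the homotopy `H` over the range of `f` and `h`, `h'` over the ends; the
    -- two prescriptions agree on the overlap by `hH`.
    have hG (n : SimplexCategoryᵒᵖ) (z : (diag (boundaryProd f)).obj n) : ∃ k : K.obj n,
        (∀ y, (f.app n).app n y = z.1.1 → k = H.app n (y, z.1.2)) ∧
        ∀ hs, k = (ends h h').app n (z.1.1, ⟨z.1.2, hs⟩) := by
      by_cases hz : ∃ y, (f.app n).app n y = z.1.1
      · obtain ⟨y, hy⟩ := hz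
        refine ⟨H.app n (y, z.1.2), fun y' hy' => ?_, fun hs => ?_⟩
        · rw [hinj n (hy.trans hy'.symm)]
        · rw [← hy]
          exact congr_app_apply hH (m := n) (y, ⟨z.1.2, hs⟩)
      · obtain hs | hx := (Subcomplex.mem_unionProd_iff _ _ _).1 z.2
        · exact ⟨(ends h h').app n (z.1.1, ⟨z.1.2, hs⟩), fun y hy => absurd ⟨y, hy⟩ hz,
            fun _ => rfl⟩
        · exact absurd (mem_latch_zero hx) hz
    choose G hG1 hG2 using hG
    have hGn (n n' : SimplexCategoryᵒᵖ) (η : n ⟶ n') (z : (diag (boundaryProd f)).obj n) :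
        G n' ((diag (boundaryProd f)).map η z) = K.map η (G n z) := by
      obtain hs | hx := (Subcomplex.mem_unionProd_iff _ _ _).1 z.2
      · rw [hG2 n z hs]
        exact (hG2 n' ((diag (boundaryProd f)).map η z) ((∂Δ[1] : Subcomplex (Δ[1] : SSet.{w})).map η hs)).trans (app_map (ends h h') η (z.1.1, ⟨z.1.2, hs⟩))
      · obtain ⟨y, hy⟩ := mem_latch_zero hx
        rw [hG1 n z y hy]
        refine (hG1 n' _ ((diag B).map η y) ?_).trans (app_map H η (y, z.1.2))
        refine (app_map (diagMap f) η y).trans ?_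
        exact congrArg ((diag B').map η) hy
    obtain ⟨L, hL⟩ := exists_diag_extension (f := boundaryProdι f) (fun m => inferInstanceAs
      (Mono (Subcomplex.ι _))) (fun m => isWeakEquiv_unionProd ((isWeakEquiv_toLatch_zero
        m).of_comp_left (hw m)) _) (homMk G hGn)
    refine htpy_iff.2 ⟨(homMk (fun _ z => z) (fun _ _ _ _ => rfl) :
      diag B' ⊗ Δ[1] ⟶ diag (B' ⋙ tensorRight Δ[1])) ≫ L, comp_eq_ends_iff.1 ?_⟩
    refine hom_ext_apply fun n z => ?_
    have hz : (z.1, z.2.1) ∈ ((latch f n 0).unionProd (∂Δ[1] : Subcomplex Δ[1])).obj n :=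
      (Subcomplex.mem_unionProd_iff _ _ _).2 (Or.inl z.2.2)
    exact (congr_app_apply hL (m := n) ⟨(z.1, z.2.1), hz⟩).trans (hG2 n ⟨(z.1, z.2.1), hz⟩ z.2.2)

lemma isWeakEquiv_ι₁ (X : SSet.{w}) : IsWeakEquiv (ι₁ (X := X)) :=
  .of_htpyInverse (fst _ _) (Or.inl (by rw [ι₁_fst]; exact .refl _))
    (Or.inr (htpy_iff.2 ⟨maxMap X, ι₀_maxMap X, ι₁_maxMap X⟩))

/-- The realization lemma: a map of bisimplicial sets that is a weak equivalence in every degree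
is a weak equivalence on diagonals. -/
theorem isWeakEquiv_diagMap (hw : ∀ m, IsWeakEquiv (f.app m)) : IsWeakEquiv (diagMap f) := by
  -- The levelwise mapping cylinder: `f` is the inclusion of `B` at the free end followed by the
  -- retraction `r`, and `r` has the section `inr`. Both inclusions are levelwise monomorphisms and
  -- weak equivalences, so the case of monomorphisms suffices.
  let J := B ⋙ tensorRight Δ[1]
  let i₀ : B ⟶ J := { app := fun m => ι₀, naturality := fun _ _ θ => (ι₀_comp _).symm }
  let i₁ : B ⟶ J := { app := fun m => ι₁, naturality := fun _ _ θ => (ι₁_comp _).symm }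
  let q : J ⟶ B' := { app := fun m => fst _ _ ≫ f.app m, naturality := fun m m' θ =>
    (whiskerRight_fst_assoc _ _ _).trans (by rw [f.naturality, Category.assoc]) }
  have sq : IsPushout i₁ f (pushout.inl i₁ f) (pushout.inr i₁ f) := IsPushout.of_hasPushout _ _
  set inl := pushout.inl i₁ f
  set inr := pushout.inr i₁ f
  let r := sq.desc q (𝟙 B') (by ext m : 2; simp [i₁, q])
  have hr : inr ≫ r = 𝟙 B' := sq.inr_desc _ _ _
  have hr' : (i₀ ≫ inl) ≫ r = f := by
    rw [Category.assoc, sq.inl_desc]; ext m : 2; simp [i₀, q]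
  have sqm (m : SimplexCategoryᵒᵖ) : IsPushout ι₁ (f.app m) (inl.app m) (inr.app m) :=
    sq.map ((evaluation _ _).obj m)
  have hinr (m : SimplexCategoryᵒᵖ) : IsWeakEquiv (inr.app m) := by
    have : Mono (ι₁ (X := B.obj m)) := mono_of_mono_fac (ι₁_fst _)
    exact (TrivCof.of_isPushout (sqm m).flip (isWeakEquiv_ι₁ _).trivCof).isWeakEquiv
  have hrm (m : SimplexCategoryᵒᵖ) : IsWeakEquiv (r.app m) := by
    refine (hinr m).of_comp_left ?_
    rw [← NatTrans.comp_app, hr]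
    exact isWeakEquiv_of_iso _
  have h1 : IsWeakEquiv (diagMap inr) := by
    refine isWeakEquiv_diagMap_of_mono (fun m => ?_) hinr
    have : inr.app m ≫ r.app m = 𝟙 _ := by rw [← NatTrans.comp_app, hr]; rfl
    exact mono_of_mono_fac this
  have h2 : IsWeakEquiv (diagMap r) := by
    refine h1.of_comp_left ?_
    rw [show diagMap inr ≫ diagMap r = diagMap (inr ≫ r) from rfl, hr]
    exact isWeakEquiv_of_iso (𝟙 _)
  rw [← hr']
  refine IsWeakEquiv.comp ?_ h2 (f := diagMap (i₀ ≫ inl))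
  refine isWeakEquiv_diagMap_of_mono (fun m => ?_) fun m => ?_
  · rw [mono_iff_injective_app]
    intro n b b' e
    have sqn := (sqm m).map ((evaluation _ _).obj n)
    -- Only the end 1 of the cylinder is glued. The predicate `P` is false there and so descends to
    -- the pushout, where it tells `b'` at the free end apart from every other simplex.
    let P : (J.obj m).obj n ⟶ ULift.{w} Prop := ↾fun z => ⟨z.1 = b' ∧ IsVal z.2 0⟩
    let Q : (B'.obj m).obj n ⟶ ULift.{w} Prop := ↾fun z => ⟨False⟩
    have hPQ : (ι₁ (X := B.obj m)).app n ≫ P = (f.app m).app n ≫ Q := by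
      ext x
      exact ⟨fun h => (ι₁_app_snd_isVal x).ne h.2, False.elim⟩
    have h3 := sqn.inl_desc P Q hPQ
    have h4 : P ((ι₀ (X := B.obj m)).app n b) = P ((ι₀ (X := B.obj m)).app n b') := by
      rw [← h3]
      exact congrArg (sqn.desc P Q hPQ) e
    have h5 := congrArg ULift.down h4
    exact (h5.symm.mp ⟨rfl, ι₀_app_snd_isVal b'⟩).1
  · refine (hrm m).of_comp_right ?_
    rw [← NatTrans.comp_app, hr']
    exact hw m

end

end KTheory

/-! ### Nerves and natural transformations -/

namespace KTheory

open CategoryTheory Limits Opposite MonoidalCategory CartesianMonoidalCategory HomotopicalAlgebra SSet SSet.modelCategoryQuillen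

section

variable {D : Type u} [Category.{v} D]

/-- The object `X` for `a = 0`, and `Y` for `a = 1`. -/
def mixObj (X Y : D) : Fin 2 → D
  | 0 => X
  | 1 => Y

/-- The morphisms between the objects `mixObj` for commutative squares. -/
def mixHom {X X' Y Y' : D} (u : X ⟶ X') (d : X ⟶ Y') (v : Y ⟶ Y') :
    ∀ a b : Fin 2, a ≤ b → (mixObj X Y a ⟶ mixObj X' Y' b)
  | 0, 0, _ => u
  | 0, 1, _ => d
  | 1, 1, _ => v
  | 1, 0, h => absurd h (by simp)

lemma mixHom_id {X Y : D} (d : X ⟶ Y) :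
    ∀ (a : Fin 2) (h : a ≤ a), mixHom (𝟙 X) d (𝟙 Y) a a h = 𝟙 _
  | 0, _ => rfl
  | 1, _ => rfl

lemma mixHom_comp {X X' X'' Y Y' Y'' : D} {u : X ⟶ X'} {d : X ⟶ Y'} {v : Y ⟶ Y'} {u' : X' ⟶ X''}
    {d' : X' ⟶ Y''} {v' : Y' ⟶ Y''} {e : X ⟶ Y''} (h₁ : u ≫ d' = e) (h₂ : d ≫ v' = e) :
    ∀ (a b c : Fin 2) (h : a ≤ b) (h' : b ≤ c) (h'' : a ≤ c),
      mixHom (u ≫ u') e (v ≫ v') a c h'' = mixHom u d v a b h ≫ mixHom u' d' v' b c h'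
  | 0, 0, 0, _, _, _ => rfl
  | 0, 0, 1, _, _, _ => h₁.symm
  | 0, 1, 1, _, _, _ => h₂.symm
  | 1, 1, 1, _, _, _ => rfl
  | 0, 1, 0, _, h, _ => absurd h (by simp)
  | 1, 1, 0, _, h, _ => absurd h (by simp)
  | 1, 0, _, h, _, _ => absurd h (by simp)

/-- A chain of arrows together with a monotone map to `{0, 1}` gives a chain of objects. -/
def mix {n : ℕ} (x : Fin (n + 1) ⥤ Arrow D) (s : Fin (n + 1) →o Fin 2) : Fin (n + 1) ⥤ D where
  obj i := mixObj (x.obj i).left (x.obj i).right (s i)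
  map {i j} h := mixHom (x.map h).left ((x.map h).left ≫ (x.obj j).hom) (x.map h).right (s i) (s j)
    (s.monotone (leOfHom h))
  map_id i := by
    rw [x.map_id]
    exact mixHom_id _ _ _
  map_comp h h' := by
    rw [x.map_comp]
    refine mixHom_comp ?_ ?_ _ _ _ _ _ _
    · simp
    · simp

open Simplicial

variable (D) in
/-- The sources of a chain of arrows. -/
def nerveLeft : nerve (Arrow D) ⟶ nerve D :=
  homMk (fun m (x : Fin (m.unop.len + 1) ⥤ Arrow D) => x ⋙ Arrow.leftFunc) fun _ _ _ _ => rfl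

variable (D) in
/-- The targets of a chain of arrows. -/
def nerveRight : nerve (Arrow D) ⟶ nerve D :=
  homMk (fun m (x : Fin (m.unop.len + 1) ⥤ Arrow D) => x ⋙ Arrow.rightFunc) fun _ _ _ _ => rfl

/-- A simplex of the cylinder is a chain of arrows with a monotone map to `{0, 1}`: take sources
where its value is 0 and targets where it is 1, and cross over once along an arrow of the chain.
This is the universal case of the homotopy given by a natural transformation. -/
lemma htpy_nerveLeft_nerveRight : Htpy (nerveLeft D) (nerveRight D) := by
  refine htpy_iff.2 ⟨homMk (fun m z => mix z.1 (stdSimplex.objEquiv z.2).toOrderHom) ?_, ?_, ?_⟩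
  · intro _ _ _ _
    rfl
  · refine hom_ext_apply fun m x => ?_
    rfl
  · refine hom_ext_apply fun m x => ?_
    rfl

end

/-! ### Contractibility criteria and maps to discrete simplicial sets -/

/-- Weakly contractible simplicial sets. -/
def WContr (X : SSet.{w}) : Prop := IsWeakEquiv (toUnit X)

/-- The set `S` as a discrete simplicial set. -/
def disc (S : Type w) : SSet.{w} where
  obj _ := S
  map _ := 𝟙 S

/-- The fibre of a map to a discrete simplicial set. -/
def fibre {X : SSet.{w}} {S : Type w} (p : X ⟶ disc S) (s : S) : X.Subcomplex where
  obj n := {x | p.app n x = s}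
  map θ x hx := (app_map p θ x).trans hx

lemma htpy_nerveMap {C D : Type u} [Category.{v} C] [Category.{v} D] {G H : C ⥤ D} (τ : G ⟶ H) :
    Htpy (nerveMap G) (nerveMap H) := by
  let T : C ⥤ Arrow D :=
    { obj X := Arrow.mk (τ.app X)
      map f := Arrow.homMk (G.map f) (H.map f) }
  let t : nerve C ⟶ nerve (Arrow D) :=
    homMk (fun m (x : Fin (m.unop.len + 1) ⥤ C) => x ⋙ T) fun _ _ _ _ => rfl
  exact (htpy_nerveLeft_nerveRight (D := D)).precomp t

lemma WContr.of_retract {X N : SSet.{w}} (hN : WContr N) (i : X ⟶ N) (r : N ⟶ X) (h : i ≫ r = 𝟙 X) :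
    WContr X := by
  unfold WContr at *
  rw [isWeakEquiv_iff] at *
  intro K _
  refine ⟨fun g => ?_, fun a b e => (hN K).2 a b ?_⟩
  · obtain ⟨k, hk⟩ := (hN K).1 (r ≫ g)
    refine ⟨k, ?_⟩
    have := hk.precomp i
    rwa [reassoc_of% h] at this
  · exact e.precomp r

lemma WContr.of_isWeakEquiv {X Y : SSet.{w}} (hX : WContr X) {f : X ⟶ Y} (hf : IsWeakEquiv f) :
    WContr Y := hf.of_comp_left hX

/-- The contraction is only required after mapping to a Kan complex, so that a zigzag of homotopies
will do. -/
lemma wContr_of_point {X : SSet.{w}} (c : 𝟙_ _ ⟶ X)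
    (h : ∀ (K : SSet.{w}) [KanComplex K] (g : X ⟶ K), Htpy (toUnit X ≫ c ≫ g) g) : WContr X := by
  unfold WContr
  rw [isWeakEquiv_iff]
  intro K _
  exact ⟨fun g => ⟨c ≫ g, h K g⟩, fun a b e => e.precomp c⟩

/-- The vertex of the nerve given by an object. -/
def nervePt {C : Type u} [Category.{v} C] (c : C) : 𝟙_ _ ⟶ nerve C :=
  homMk (fun m _ => (Functor.const (Fin (m.unop.len + 1))).obj c) fun _ _ _ _ => rfl

/-- The zigzag of natural transformations from the identity through `G` to a constant functor
becomes a homotopy after mapping to a Kan complex. -/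
lemma wContr_nerve_of_span {C : Type u} [Category.{v} C] (c : C) (G : C ⥤ C) (σ : G ⟶ 𝟭 C)
    (τ : G ⟶ (Functor.const C).obj c) : WContr (nerve C) := by
  refine wContr_of_point (nervePt c) fun K _ g => ?_
  exact ((htpy_nerveMap τ).postcomp g).of_common ((htpy_nerveMap σ).postcomp g)

lemma wContr_nerve_of_isInitial {C : Type u} [Category.{v} C] {c : C} (hc : IsInitial c) :
    WContr (nerve C) :=
  wContr_nerve_of_span c ((Functor.const C).obj c) { app X := hc.to X } (𝟙 _)

/-- Over a discrete base `X` is the disjoint union of its fibres, so maps and homotopies are chosen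
on each fibre separately. -/
lemma isWeakEquiv_of_fibre {X : SSet.{w}} {S : Type w} {p : X ⟶ disc S}
    (h : ∀ s, WContr (fibre p s).toSSet) : IsWeakEquiv p := by
  rw [isWeakEquiv_iff]
  intro K _
  refine ⟨fun g => ?_, fun a b e => ?_⟩
  · choose c hc using fun s => ((isWeakEquiv_iff _).1 (h s) K).1 ((fibre p s).ι ≫ g)
    choose H h0 h1 using fun s => htpy_iff.1 (hc s)
    have aux {s s' : S} (e : s = s') {n} (x : X.obj n) (hx hx') (t) :
        (H s).app n (⟨x, hx⟩, t) = (H s').app n (⟨x, hx'⟩, t) := by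
      subst e; rfl
    refine ⟨homMk (fun n s => (c s).app n PUnit.unit) fun n n' η s => app_map (c s) η _, htpy_iff.2
      ⟨homMk (fun n z => (H (p.app n z.1)).app n (⟨z.1, rfl⟩, z.2)) ?_, hom_ext_apply fun n x => ?_,
        hom_ext_apply fun n x => ?_⟩⟩
    · intro n n' η z
      exact (aux (s' := p.app n z.1) (app_map p η z.1) (X.map η z.1) rfl
        ((fibre p _).map η rfl) _).trans (app_map (H (p.app n z.1)) η (⟨z.1, rfl⟩, z.2))
    · exact congr_app_apply (h0 (p.app n x)) ⟨x, rfl⟩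
    · exact congr_app_apply (h1 (p.app n x)) ⟨x, rfl⟩
  · have hs (s : S) : Htpy ((homMk (fun _ _ => s) fun _ _ _ _ => rfl : 𝟙_ _ ⟶ disc S) ≫ a)
        ((homMk (fun _ _ => s) fun _ _ _ _ => rfl : 𝟙_ _ ⟶ disc S) ≫ b) := by
      refine ((isWeakEquiv_iff _).1 (h s) K).2 _ _ ?_
      have e' := e.precomp (fibre p s).ι
      have h1 (a : disc S ⟶ K) : (fibre p s).ι ≫ p ≫ a =
          toUnit _ ≫ (homMk (fun _ _ => s) fun _ _ _ _ => rfl : 𝟙_ _ ⟶ disc S) ≫ a :=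
        hom_ext_apply fun n x => congrArg (a.app n) x.2
      rwa [h1, h1] at e'
    choose H h0 h1 using fun s => htpy_iff.1 (hs s)
    refine htpy_iff.2 ⟨homMk (fun n z => (H z.1).app n (PUnit.unit, z.2)) fun n n' η z =>
      app_map (H z.1) η (PUnit.unit, z.2), hom_ext_apply fun n s => ?_, hom_ext_apply fun n s => ?_⟩
    · exact (congrArg (fun t => (H s).app n (PUnit.unit, t))
        ((ι₀_app_snd_isVal (X := disc S) s).eq (ι₀_app_snd_isVal (X := 𝟙_ _) PUnit.unit))).trans
          (congr_app_apply (h0 s) PUnit.unit)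
    · exact (congrArg (fun t => (H s).app n (PUnit.unit, t))
        ((ι₁_app_snd_isVal (X := disc S) s).eq (ι₁_app_snd_isVal (X := 𝟙_ _) PUnit.unit))).trans
          (congr_app_apply (h1 s) PUnit.unit)

/-! ### Quillen's Theorem A -/

section

variable {C D : Type u} [Category.{v} C] [Category.{v} D] (F : C ⥤ D)

/-- A chain `A` in `C`, a chain `Y` in `D`, and compatible maps from `F A` to `Y`. -/
@[ext]
structure Bichain (p q : ℕ) where
  A : Fin (p + 1) ⥤ C
  Y : Fin (q + 1) ⥤ D
  hom : ∀ i j, F.obj (A.obj i) ⟶ Y.obj j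
  hom_left : ∀ {i i'} (h : i ⟶ i') j, F.map (A.map h) ≫ hom i' j = hom i j
  hom_right : ∀ i {j j'} (h : j ⟶ j'), hom i j ≫ Y.map h = hom i j'

variable {F} in
/-- Restriction of bichains. -/
def Bichain.restrict {p q p' q' : SimplexCategory} (x : Bichain F p.len q.len) (θ : p' ⟶ p)
    (η : q' ⟶ q) : Bichain F p'.len q'.len where
  A := (SimplexCategory.toCat.map θ).toFunctor ⋙ x.A
  Y := (SimplexCategory.toCat.map η).toFunctor ⋙ x.Y
  hom _ _ := x.hom _ _
  hom_left _ _ := x.hom_left _ _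
  hom_right _ _ _ _ := x.hom_right _ _

/-- Bichains as a simplicial object in the chain of `D`. -/
def bichainD : SimplexCategoryᵒᵖ ⥤ SSet.{max u v} where
  obj q :=
    { obj p := Bichain F p.unop.len q.unop.len
      map θ := ↾fun x => x.restrict θ.unop (𝟙 _) }
  map η := homMk (fun p x => x.restrict (𝟙 _) η.unop) fun _ _ _ _ => rfl

/-- Bichains as a simplicial object in the chain of `C`. -/
def bichainC : SimplexCategoryᵒᵖ ⥤ SSet.{max u v} where
  obj p :=
    { obj q := Bichain F p.unop.len q.unop.len
      map η := ↾fun x => x.restrict (𝟙 _) η.unop }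
  map θ := homMk (fun p x => x.restrict θ.unop (𝟙 _)) fun _ _ _ _ => rfl

/-- A simplicial set as a simplicial object of discrete simplicial sets. -/
def discBi (X : SSet.{w}) : SimplexCategoryᵒᵖ ⥤ SSet.{w} where
  obj m := disc (X.obj m)
  map θ := homMk (fun _ x => X.map θ x) fun _ _ _ _ => rfl
  map_id m := hom_ext_apply fun _ x => by simp; rfl
  map_comp _ _ := hom_ext_apply fun _ x => by simp; rfl

/-- The projection to the chain in `D`. -/
def bichainDProj : bichainD F ⟶ discBi (nerve D) where
  app _ := homMk (fun _ x => x.Y) fun _ _ _ _ => rfl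
  naturality _ _ _ := rfl

/-- The projection to the chain in `C`. -/
def bichainCProj : bichainC F ⟶ discBi (nerve C) where
  app _ := homMk (fun _ x => x.A) fun _ _ _ _ => rfl
  naturality _ _ _ := rfl

/-- With the chain in `D` fixed, compatible maps to it are determined by those to its first object,
so the fibre is a retract of the nerve of a comma category. -/
lemma wContr_fibre_bichainDProj (q : SimplexCategoryᵒᵖ) (Y : Fin (q.unop.len + 1) ⥤ D)
    (h : WContr (nerve (CostructuredArrow F (Y.obj 0)))) :
    WContr (fibre ((bichainDProj F).app q) Y).toSSet := by
  have e {p : SimplexCategoryᵒᵖ} (x : (fibre ((bichainDProj F).app q) Y).toSSet.obj p) :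
      x.1.Y.obj 0 = Y.obj 0 := by
    obtain ⟨x, rfl⟩ := x
    rfl
  refine h.of_retract
    (homMk (fun p x => ({
      obj i := CostructuredArrow.mk (Y := x.1.A.obj i) (x.1.hom i 0 ≫ eqToHom (e x))
      map f := CostructuredArrow.homMk (x.1.A.map f) (by
        simp [reassoc_of% x.1.hom_left f 0]) } : Fin (p.unop.len + 1) ⥤ _)) fun _ _ _ _ => rfl)
    (homMk (fun p (x : Fin (p.unop.len + 1) ⥤ CostructuredArrow F _) => ⟨{
        A := x ⋙ CostructuredArrow.proj _ _
        Y := Y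
        hom i j := (x.obj i).hom ≫ Y.map (homOfLE (Fin.zero_le j))
        hom_left := fun h j => (Category.assoc _ _ _).symm.trans
          (congrArg (· ≫ Y.map _) (CostructuredArrow.w (x.map h)))
        hom_right := fun i j j' h => (Category.assoc _ _ _).trans
          (congrArg ((x.obj i).hom ≫ ·) (Y.map_comp _ h).symm) }, rfl⟩) fun _ _ _ _ => rfl) ?_
  refine hom_ext_apply ?_
  rintro p ⟨x, rfl⟩
  refine Subtype.ext (Bichain.ext rfl rfl (heq_of_eq ?_))
  funext i j
  change (x.hom i 0 ≫ 𝟙 _) ≫ x.Y.map _ = _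
  rw [Category.comp_id, x.hom_right]
  rfl

/-- With the chain in `C` fixed, compatible maps are determined by those from the image of its last
object; the fibre is a retract of the nerve of an under category, which has an initial object. -/
lemma wContr_fibre_bichainCProj (p : SimplexCategoryᵒᵖ) (A : Fin (p.unop.len + 1) ⥤ C) :
    WContr (fibre ((bichainCProj F).app p) A).toSSet := by
  have e {q : SimplexCategoryᵒᵖ} (x : (fibre ((bichainCProj F).app p) A).toSSet.obj q) :
      A.obj (Fin.last _) = x.1.A.obj (Fin.last _) := by
    obtain ⟨x, rfl⟩ := x
    rfl
  refine (wContr_nerve_of_isInitial (Under.mkIdInitial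
    (X := F.obj (A.obj (Fin.last _))))).of_retract
    (homMk (fun q x => ({
      obj j := Under.mk (Y := x.1.Y.obj j) (eqToHom (congrArg F.obj (e x)) ≫ x.1.hom _ j)
      map f := Under.homMk (x.1.Y.map f) (by
        simp [x.1.hom_right]) } : Fin (q.unop.len + 1) ⥤ _)) fun _ _ _ _ => rfl)
    (homMk (fun p (x : Fin (p.unop.len + 1) ⥤ Under _) => ⟨{
        A := A
        Y := x ⋙ Under.forget _
        hom i j := F.map (A.map (homOfLE (Fin.le_last i))) ≫ (x.obj j).hom
        hom_left := fun h j => (Category.assoc _ _ _).symm.trans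
          (congrArg (· ≫ (x.obj j).hom) ((F.map_comp _ _).symm.trans
            (congrArg F.map (A.map_comp h _).symm)))
        hom_right := fun i j j' h => (Category.assoc _ _ _).trans
          (congrArg (F.map _ ≫ ·) (Under.w (x.map h))) }, rfl⟩) fun _ _ _ _ => rfl) ?_
  refine hom_ext_apply ?_
  rintro q ⟨x, rfl⟩
  refine Subtype.ext (Bichain.ext rfl rfl (heq_of_eq ?_))
  funext i j
  change F.map (x.A.map _) ≫ 𝟙 _ ≫ x.hom _ _ = _
  rw [Category.id_comp, x.hom_left]
  rfl

/-- Quillen's Theorem A. -/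
theorem isWeakEquiv_nerveMap (h : ∀ Y, WContr (nerve (CostructuredArrow F Y))) :
    IsWeakEquiv (nerveMap F) := by
  have hD := isWeakEquiv_diagMap (f := bichainDProj F) fun q =>
    isWeakEquiv_of_fibre fun Y => wContr_fibre_bichainDProj F q Y (h _)
  have hC := isWeakEquiv_diagMap (f := bichainCProj F) fun p =>
    isWeakEquiv_of_fibre fun A => wContr_fibre_bichainCProj F p A
  let a : diag (bichainC F) ⟶ nerve C := homMk (fun _ x => x.A) fun _ _ _ _ => rfl
  let b : diag (bichainC F) ⟶ nerve D := homMk (fun _ x => x.Y) fun _ _ _ _ => rfl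
  let i : diag (discBi (nerve C)) ⟶ nerve C := homMk (fun _ x => x) fun _ _ _ _ => rfl
  let j : diag (discBi (nerve D)) ⟶ nerve D := homMk (fun _ x => x) fun _ _ _ _ => rfl
  let k : diag (bichainC F) ⟶ diag (bichainD F) := homMk (fun _ x => x) fun _ _ _ _ => rfl
  have : IsIso i := isIso_of_bijective_app _ fun _ => Function.bijective_id
  have : IsIso j := isIso_of_bijective_app _ fun _ => Function.bijective_id
  have : IsIso k := isIso_of_bijective_app _ fun _ => Function.bijective_id
  have ha : IsWeakEquiv a := hC.comp (isWeakEquiv_of_iso i)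
  have hb : IsWeakEquiv b := (isWeakEquiv_of_iso k).comp (hD.comp (isWeakEquiv_of_iso j))
  -- On the diagonal a bichain contains the arrows from `F A_i` to `Y_i`, which give a homotopy from
  -- `a ≫ nerveMap F` to `b`. As `a` and `b` are weak equivalences, so is `nerveMap F`.
  let t : diag (bichainC F) ⟶ nerve (Arrow D) := homMk (fun m x => ({
    obj i := Arrow.mk (x.hom i i)
    map f := Arrow.homMk (F.map (x.A.map f)) (x.Y.map f) (by
      simp [x.hom_left, x.hom_right]) } : Fin (m.unop.len + 1) ⥤ Arrow D)) fun _ _ _ _ => rfl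
  have hab : IsWeakEquiv (a ≫ nerveMap F) := by
    have h1 : Htpy (a ≫ nerveMap F) b := (htpy_nerveLeft_nerveRight (D := D)).precomp t
    rw [isWeakEquiv_iff] at hb ⊢
    intro K _
    refine ⟨fun k => ?_, fun c d e => (hb K).2 c d ?_⟩
    · obtain ⟨c, hc⟩ := (hb K).1 k
      exact ⟨c, (h1.postcomp c).trans hc⟩
    · exact (h1.postcomp c).symm.trans (e.trans (h1.postcomp d))
  exact ha.of_comp_left hab

end

/-! ### Codirected thin categories -/

section

variable {C : Type u} [Category.{v} C]

variable (C) in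
/-- Finite sets of objects of `C`, ordered by reverse inclusion. -/
structure FinObj where
  set : Finset C

instance : Category.{v} (FinObj C) where
  Hom T T' := ULift.{v} (PLift (T'.set ⊆ T.set))
  id T := ⟨⟨subset_rfl⟩⟩
  comp f g := ⟨⟨g.down.down.trans f.down.down⟩⟩

lemma exists_lowerBound [Nonempty C]
    (h : ∀ X Y : C, ∃ Z, Nonempty (Z ⟶ X) ∧ Nonempty (Z ⟶ Y)) (T : Finset C) :
    ∃ Z : C, ∀ X ∈ T, Nonempty (Z ⟶ X) := by
  classical
  induction T using Finset.induction with
  | empty => exact ⟨Classical.arbitrary C, by simp⟩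
  | insert X T _ ih =>
    obtain ⟨Z, hZ⟩ := ih
    obtain ⟨Z', ⟨a⟩, ⟨b⟩⟩ := h X Z
    refine ⟨Z', fun Y hY => ?_⟩
    obtain rfl | hY := Finset.mem_insert.1 hY
    · exact ⟨a⟩
    · exact ⟨b ≫ (hZ Y hY).some⟩

/-- By recursion on finite sets: the bound for `T` is chosen below the members of `T` and also below
the bounds already chosen for all proper subsets of `T`. -/
lemma exists_monotone_lowerBound [Nonempty C]
    (h : ∀ X Y : C, ∃ Z, Nonempty (Z ⟶ X) ∧ Nonempty (Z ⟶ Y)) :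
    ∃ m : Finset C → C, (∀ T, ∀ X ∈ T, Nonempty (m T ⟶ X)) ∧
      ∀ T T', T ⊂ T' → Nonempty (m T' ⟶ m T) := by
  classical
  choose Z hZ using exists_lowerBound h
  let m : Finset C → C := fun T => T.strongInduction (p := fun _ => C) fun T ih =>
    Z (T ∪ T.ssubsets.attach.image fun T' => ih T'.1 (Finset.mem_ssubsets.1 T'.2))
  have hm (T) : m T = Z (T ∪ T.ssubsets.attach.image fun T' => m T'.1) :=
    Finset.strongInduction_eq _ _
  refine ⟨m, fun T X hX => ?_, fun T T' hT => ?_⟩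
  · rw [hm]
    exact hZ _ _ (Finset.mem_union_left _ hX)
  · rw [hm T']
    exact hZ _ _ (Finset.mem_union_right _ (Finset.mem_image.2
      ⟨⟨T, Finset.mem_ssubsets.2 hT⟩, Finset.mem_attach _ _, rfl⟩))

/-- A nonempty thin category in which any two objects have a lower bound is weakly contractible. -/
theorem wContr_nerve_of_codirected [Quiver.IsThin C] [Nonempty C]
    (h : ∀ X Y : C, ∃ Z, Nonempty (Z ⟶ X) ∧ Nonempty (Z ⟶ Y)) : WContr (nerve C) := by
  classical
  obtain ⟨m, hm, hm'⟩ := exists_monotone_lowerBound h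
  have hmono {T T' : Finset C} (hT : T ⊆ T') : Nonempty (m T' ⟶ m T) := by
    obtain rfl | hT := hT.eq_or_ssubset
    · exact ⟨𝟙 _⟩
    · exact hm' _ _ hT
  let M : FinObj C ⥤ C :=
    { obj T := m T.set
      map f := (hmono f.down.down).some
      map_id _ := Subsingleton.elim _ _
      map_comp _ _ := Subsingleton.elim _ _ }
  -- In the order by reverse inclusion the empty set is terminal.
  have h1 : WContr (nerve (FinObj C)) :=
    wContr_nerve_of_span ⟨∅⟩ (𝟭 _) (𝟙 _) { app T := ⟨⟨Finset.empty_subset _⟩⟩ }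
  refine h1.of_isWeakEquiv (isWeakEquiv_nerveMap M fun Y => ?_)
  have hY (T : Finset C) (hT : Y ∈ T) : Nonempty (M.obj ⟨T⟩ ⟶ Y) := hm T Y hT
  -- The comma category over `Y` contracts by the span from `T ∪ {Y}` to `T` and to `{Y}`; adjoining
  -- `Y` is what supplies maps to `Y`.
  let G : CostructuredArrow M Y ⥤ CostructuredArrow M Y :=
    { obj T := CostructuredArrow.mk (Y := ⟨insert Y T.left.set⟩)
        (hY _ (Finset.mem_insert_self _ _)).some
      map f := CostructuredArrow.homMk ⟨⟨Finset.insert_subset_insert _ f.left.down.down⟩⟩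
        (Subsingleton.elim _ _) }
  exact wContr_nerve_of_span (CostructuredArrow.mk (Y := ⟨{Y}⟩)
    (hY _ (Finset.mem_singleton_self _)).some) G
    { app T := CostructuredArrow.homMk ⟨⟨Finset.subset_insert _ _⟩⟩ (Subsingleton.elim _ _) }
    { app T := CostructuredArrow.homMk ⟨⟨Finset.singleton_subset_iff.2
        (Finset.mem_insert_self _ _)⟩⟩ (Subsingleton.elim _ _) }

end

end KTheory

namespace KTheory

open CategoryTheory Limits Opposite

open AlgebraicGeometry

/-! ### Reduced locally closed subschemes -/

/-- A morphism from a reduced scheme whose image lies in that of an immersion factors through it. -/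
lemma exists_lift_of_range_subset {X Y Z : Scheme.{u}} (f : X ⟶ Z) (g : Y ⟶ Z)
    [AlgebraicGeometry.IsReduced X] [IsImmersion g] (h : Set.range f ⊆ Set.range g) :
    ∃ l : X ⟶ Y, l ≫ g = f := by
  -- The base change of `g` to `X` is an immersion onto all of `X`, hence a surjective closed
  -- immersion, hence an isomorphism because `X` is reduced.
  have hs : Set.range (pullback.fst f g) = Set.univ := by
    rw [Scheme.Pullback.range_fst]
    exact Set.eq_univ_of_forall fun x => h ⟨x, rfl⟩
  have : IsClosedImmersion (pullback.fst f g) :=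
    IsClosedImmersion.of_isPreimmersion _ (hs ▸ isClosed_univ)
  have : Surjective (pullback.fst f g) := ⟨Set.range_eq_univ.1 hs⟩
  have : IsIso (pullback.fst f g) := isIso_of_isClosedImmersion_of_surjective _
  exact ⟨inv (pullback.fst f g) ≫ pullback.snd f g, by
    rw [Category.assoc, ← pullback.condition, IsIso.inv_hom_id_assoc]⟩

/-- The reduced preimage of an immersion. -/
lemma exists_reduced_pullback {X V Z : Scheme.{u}} (f : Z ⟶ X) (j : V ⟶ X) [IsImmersion j] :
    ∃ (W : Scheme.{u}) (a : W ⟶ Z) (b : W ⟶ V), AlgebraicGeometry.IsReduced W ∧ IsImmersion a ∧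
      a ≫ f = b ≫ j ∧ Set.range a = f ⁻¹' Set.range j ∧ (IsImmersion f → IsImmersion b) := by
  have hred := isReduced_nilradical (pullback f j)
  let t := (pullback f j).nilradical.subschemeι
  have ht : Set.range t = Set.univ := by
    rw [Scheme.IdealSheafData.range_subschemeι]
    rfl
  refine ⟨_, t ≫ pullback.fst f j, t ≫ pullback.snd f j, hred, inferInstance, ?_, ?_, fun _ => ?_⟩
  · rw [Category.assoc, Category.assoc, pullback.condition]
  · rw [Scheme.Hom.comp_base, TopCat.coe_comp, Set.range_comp, ht, Set.image_univ]
    exact Scheme.Pullback.range_fst f j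
  · infer_instance

lemma exists_reduced_closed (X : Scheme.{u}) {Z : Set X} (hZ : IsClosed Z) :
    ∃ (W : Scheme.{u}) (i : W ⟶ X), AlgebraicGeometry.IsReduced W ∧ IsClosedImmersion i ∧
      Set.range i = Z := by
  let I := Scheme.IdealSheafData.vanishingIdeal (X := X) ⟨Z, hZ⟩
  refine ⟨I.subscheme, I.subschemeι, ?_, inferInstance, ?_⟩
  · have (U : I.subschemeCover.openCover.I₀) :
        AlgebraicGeometry.IsReduced (I.subschemeCover.openCover.X U) := by
      have : _root_.IsReduced (Γ(X, U.1) ⧸ I.ideal U) :=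
        (Ideal.isRadical_iff_quotient_reduced _).1 (PrimeSpectrum.isRadical_vanishingIdeal _)
      exact inferInstanceAs (AlgebraicGeometry.IsReduced (Spec (.of (Γ(X, U.1) ⧸ I.ideal U))))
    exact AlgebraicGeometry.IsReduced.of_openCover _ I.subschemeCover.openCover
  · rw [Scheme.IdealSheafData.range_subschemeι]
    rfl

lemma exists_reduced_locallyClosed (X : Scheme.{u}) {A : Set X}
    (hA : IsLocallyClosed A) :
    ∃ (W : Scheme.{u}) (i : W ⟶ X), AlgebraicGeometry.IsReduced W ∧ IsImmersion i ∧
      Set.range i = A := by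
  obtain ⟨U, Z, hU, hZ, rfl⟩ := hA
  obtain ⟨W, i, h1, h2, rfl⟩ := exists_reduced_closed X hZ
  let j := Scheme.Opens.ι (X := X) ⟨U, hU⟩
  obtain ⟨T, a, b, h3, h4, h5, h6, h7⟩ := exists_reduced_pullback j i
  refine ⟨T, a ≫ j, h3, inferInstance, ?_⟩
  rw [Scheme.Hom.comp_base, TopCat.coe_comp, Set.range_comp, h6, Set.image_preimage_eq_range_inter]
  congr 1
  exact Scheme.Opens.range_ι _

/-! ### Finite closed filtrations -/

/-- A finite family of closed subsets is subordinate to a finite filtration by closed subsets. -/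
lemma exists_filtration {X : Type*} [TopologicalSpace X] (s : Finset (Set X))
    (hs : ∀ K ∈ s, IsClosed K) :
    ∃ (n : ℕ) (r : X → ℕ), (∀ x, r x < n) ∧ (∀ i, IsClosed {x | r x < i}) ∧
      ∀ K ∈ s, ∀ x y, r x = r y → x ∈ K → y ∈ K := by
  classical
  induction s using Finset.induction_on with
  | empty =>
    exact ⟨1, fun _ => 0, fun _ => Nat.one_pos, fun i => isClosed_const, by simp⟩
  | insert K s hK ih =>
    obtain ⟨n, r, h1, h2, h3⟩ := ih fun K hK => hs K (Finset.mem_insert_of_mem hK)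
    have hc : IsClosed K := hs K (Finset.mem_insert_self K s)
    -- Every stratum is split in two, with the part inside the closed set `K` placed before the
    -- rest.
    refine ⟨2 * n, fun x => 2 * r x + if x ∈ K then 0 else 1, fun x => ?_, fun i => ?_, ?_⟩
    · have := h1 x
      dsimp only
      split_ifs <;> omega
    · have : {x | (2 * r x + if x ∈ K then 0 else 1) < i} =
          {x | r x < i / 2} ∪ ({x | r x < (i + 1) / 2} ∩ K) := by
        ext x
        by_cases hx : x ∈ K <;> simp [hx] <;> omega
      rw [this]
      exact (h2 _).union ((h2 _).inter hc)
    · intro K' hK' x y hxy hx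
      rcases Finset.mem_insert.1 hK' with rfl | hK'
      · dsimp only at hxy
        rw [if_pos hx] at hxy
        by_contra hy
        rw [if_neg hy] at hxy
        omega
      · refine h3 K' hK' x y ?_ hx
        dsimp only at hxy
        split_ifs at hxy <;> omega

/-- A finite cover by locally closed subsets is refined by the strata of a finite filtration by
closed subsets. -/
lemma exists_filtration_of_cover {X : Type*} [TopologicalSpace X] {P : Type*} [Finite P]
    (A : P → Set X) (hA : ∀ p, IsLocallyClosed (A p)) (hc : ∀ x, ∃ p, x ∈ A p) :
    ∃ (n : ℕ) (r : X → ℕ), (∀ x, r x < n) ∧ (∀ i, IsClosed {x | r x < i}) ∧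
      ∀ x, ∃ p, {y | r y = r x} ⊆ A p := by
  classical
  have := Fintype.ofFinite P
  choose U Z hU hZ hUZ using hA
  -- Write `A p` as an open `U p` intersected with a closed `Z p`. If no stratum is cut by any `Z p`
  -- or complement of `U p`, then a stratum meeting `A p` lies in it.
  obtain ⟨n, r, h1, h2, h3⟩ := exists_filtration
    (Finset.univ.image (fun p => (U p)ᶜ) ∪ Finset.univ.image Z) (by
      intro K hK
      simp only [Finset.mem_union, Finset.mem_image, Finset.mem_univ, true_and] at hK
      rcases hK with ⟨p, rfl⟩ | ⟨p, rfl⟩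
      · exact (hU p).isClosed_compl
      · exact hZ p)
  refine ⟨n, r, h1, h2, fun x => ?_⟩
  obtain ⟨p, hp⟩ := hc x
  refine ⟨p, fun y hy => ?_⟩
  rw [hUZ] at hp ⊢
  refine ⟨?_, ?_⟩
  · by_contra hy'
    exact h3 (U p)ᶜ (by simp) y x hy hy' hp.1
  · exact h3 (Z p) (by simp) x y hy.symm hp.2

end KTheory

namespace KTheory

open CategoryTheory Limits Opposite

open AlgebraicGeometry

/-! ### Immersions of schemes of finite type -/

section

variable {S : Scheme.{u}} {n : ℕ∞}

/-- Immersions in the category of reduced schemes of finite type. -/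
def IsImm {X Y : Sch S n} (f : X ⟶ Y) : Prop := IsImmersion f.hom.left

instance isReduced_left (X : Sch S n) : AlgebraicGeometry.IsReduced X.obj.left := X.property.1

lemma sch_hom_ext {X Y : Sch S n} {f g : X ⟶ Y} (h : f.hom.left = g.hom.left) : f = g := by
  ext1
  ext1
  exact h

lemma apply_eq_of_eq {X Y : Sch S n} {f g : X ⟶ Y} (h : f = g) (x : X.obj.left) :
    f.hom.left x = g.hom.left x := by rw [h]

lemma IsImm.id (X : Sch S n) : IsImm (𝟙 X) := (immersions S n).id_mem X

lemma IsImm.comp {X Y Z : Sch S n} {f : X ⟶ Y} {g : Y ⟶ Z} (hf : IsImm f) (hg : IsImm g) :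
    IsImm (f ≫ g) := (immersions S n).comp_mem f g hf hg

lemma IsImm.of_comp {X Y Z : Sch S n} {f : X ⟶ Y} {g : Y ⟶ Z} (h : IsImm (f ≫ g)) : IsImm f := by
  have : IsImmersion (f.hom.left ≫ g.hom.left) := h
  exact IsImmersion.of_comp f.hom.left g.hom.left

lemma IsImm.injective {X Y : Sch S n} {f : X ⟶ Y} (h : IsImm f) :
    Function.Injective f.hom.left := by
  have : IsImmersion f.hom.left := h
  exact f.hom.left.isEmbedding.injective

lemma IsImm.eq_of_comp_eq {X Y Z : Sch S n} {g : Y ⟶ Z} (hg : IsImm g) {a b : X ⟶ Y}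
    (h : a ≫ g = b ≫ g) : a = b := by
  have : IsImmersion g.hom.left := hg
  exact sch_hom_ext ((cancel_mono g.hom.left).1 (congrArg (fun t => t.hom.left) h))

lemma IsImm.isLocallyClosed {X Y : Sch S n} {f : X ⟶ Y} (h : IsImm f) :
    IsLocallyClosed (Set.range f.hom.left) := by
  have : IsImmersion f.hom.left := h
  exact f.hom.left.isLocallyClosed_range

lemma isImm_of_isEmpty {X Y : Sch S n} (f : X ⟶ Y) [IsEmpty X.obj.left] : IsImm f := by
  change IsImmersion f.hom.left
  infer_instance

lemma exists_lift {X Y Z : Sch S n} (f : X ⟶ Z) {g : Y ⟶ Z} (hg : IsImm g)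
    (h : Set.range f.hom.left ⊆ Set.range g.hom.left) : ∃ l : X ⟶ Y, l ≫ g = f := by
  have : IsImmersion g.hom.left := hg
  obtain ⟨l, hl⟩ := exists_lift_of_range_subset f.hom.left g.hom.left h
  refine ⟨ObjectProperty.homMk (Over.homMk l ?_), sch_hom_ext hl⟩
  rw [← Over.w g.hom, ← Category.assoc, hl, Over.w f.hom]

/-- A morphism is determined by its restrictions to a jointly surjective family. -/
lemma hom_ext_of_cover {X Y : Sch S n} {g h : X ⟶ Y}
    (H : ∀ x, ∃ (V : Sch S n) (v : V ⟶ X), x ∈ Set.range v.hom.left ∧ v ≫ g = v ≫ h) : g = h := by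
  -- Joint surjectivity makes the equalizer a surjective closed immersion into the reduced scheme
  -- `X`, hence an isomorphism.
  let e := equalizer.ι g.hom.left h.hom.left
  have hs : Set.range e = Set.univ := by
    refine Set.eq_univ_of_forall fun x => ?_
    obtain ⟨V, v, ⟨y, rfl⟩, hv⟩ := H x
    refine ⟨equalizer.lift v.hom.left (congrArg (fun t => t.hom.left) hv) y, ?_⟩
    rw [← Scheme.Hom.comp_apply, equalizer.lift_ι]
  have : IsClosedImmersion e := IsClosedImmersion.of_isPreimmersion _ (hs ▸ isClosed_univ)
  have : Surjective e := ⟨Set.range_eq_univ.1 hs⟩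
  have : IsIso e := isIso_of_isClosedImmersion_of_surjective _
  exact sch_hom_ext ((cancel_epi e).1 (equalizer.condition _ _))

lemma isEmpty_of_hom {X Y : Sch S n} (f : X ⟶ Y) [h : IsEmpty Y.obj.left] : IsEmpty X.obj.left :=
  ⟨fun x => h.elim (f.hom.left x)⟩

lemma exists_hom_of_isEmpty {X : Sch S n} [IsEmpty X.obj.left] (Y : Sch S n) :
    Nonempty (X ⟶ Y) :=
  ⟨ObjectProperty.homMk (Over.homMk ((isInitialOfIsEmpty (X := X.obj.left)).to _)
    (isInitialOfIsEmpty.hom_ext _ _))⟩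

lemma mem_top_of_isEmpty (Z : ImmSch S n) (h : IsEmpty Z.obj.obj.left) (R : Sieve Z) :
    R ∈ (schAssembler S n).top Z := by
  have h : (⊥ : Presieve Z) ∈ (closedOpen S n) Z := Or.inr ⟨h, rfl⟩
  refine (schAssembler S n).top.superset_covering ?_ (Precoverage.generate_mem_toGrothendieck h)
  rw [Sieve.generate_bot]
  exact bot_le

variable [AlgebraicGeometry.IsNoetherian S]

/-- Finite type over a Noetherian base. It makes locally closed subschemes and finite disjoint
unions quasi-compact over `S`, so that they stay in the category. -/
lemma noetherianSpace_left (X : Sch S n) : TopologicalSpace.NoetherianSpace X.obj.left := by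
  have := X.property.2.1
  have := X.property.2.2.1
  have := QuasiCompact.compactSpace_of_compactSpace X.obj.hom
  have := LocallyOfFiniteType.isLocallyNoetherian X.obj.hom
  have : AlgebraicGeometry.IsNoetherian X.obj.left := {}
  infer_instance

/-- A reduced locally closed subscheme, as a scheme of finite type. -/
def subSch (X : Sch S n) {V : Scheme.{u}} [AlgebraicGeometry.IsReduced V] (v : V ⟶ X.obj.left)
    [IsImmersion v] : Sch S n where
  obj := Over.mk (v ≫ X.obj.hom)
  property := by
    have := noetherianSpace_left X
    have := v.isEmbedding.isInducing.noetherianSpace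
    have := X.property.2.1
    refine ⟨‹_›, ?_, quasiCompact_of_noetherianSpace_source (X := V) _,
      v.isEmbedding.isInducing.topologicalKrullDim_le.trans X.property.2.2.2⟩
    change LocallyOfFiniteType (v ≫ X.obj.hom)
    infer_instance

/-- The inclusion of a reduced locally closed subscheme. -/
def subSchι (X : Sch S n) {V : Scheme.{u}} [AlgebraicGeometry.IsReduced V] (v : V ⟶ X.obj.left)
    [IsImmersion v] : subSch X v ⟶ X :=
  ObjectProperty.homMk (Over.homMk v rfl)

lemma exists_pullback {X V Z : Sch S n} (f : Z ⟶ X) {j : V ⟶ X} (hj : IsImm j) :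
    ∃ (W : Sch S n) (a : W ⟶ Z) (b : W ⟶ V), IsImm a ∧ a ≫ f = b ≫ j ∧
      Set.range a.hom.left = f.hom.left ⁻¹' Set.range j.hom.left ∧ (IsImm f → IsImm b) := by
  have : IsImmersion j.hom.left := hj
  obtain ⟨W, a, b, h1, h2, h3, h4, h5⟩ := exists_reduced_pullback f.hom.left j.hom.left
  let B : subSch Z a ⟶ V := ObjectProperty.homMk (Over.homMk b (by
    change b ≫ _ = a ≫ _
    rw [← Over.w j.hom, ← Category.assoc, ← h3, Category.assoc]
    exact congrArg (a ≫ ·) (Over.w f.hom)))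
  exact ⟨subSch Z a, subSchι Z a, B, h2, sch_hom_ext h3, h4, h5⟩

lemma exists_subSch (X : Sch S n) {A : Set X.obj.left} (hA : IsLocallyClosed A) :
    ∃ (W : Sch S n) (i : W ⟶ X), IsImm i ∧ Set.range i.hom.left = A := by
  obtain ⟨W, i, h1, h2, h3⟩ := exists_reduced_locallyClosed X.obj.left hA
  exact ⟨subSch X i, subSchι X i, h2, h3⟩

lemma exists_subtraction (X : Sch S n) {A : Set X.obj.left} (hA : IsClosed A) :
    ∃ (Z U : Sch S n) (i : Z ⟶ X) (j : U ⟶ X), IsSubtraction i j ∧ Set.range i.hom.left = A := by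
  obtain ⟨W, i, h1, h2, h3⟩ := exists_reduced_closed X.obj.left hA
  let j := Scheme.Opens.ι (X := X.obj.left) ⟨Aᶜ, hA.isOpen_compl⟩
  refine ⟨subSch X i, subSch X j, subSchι X i, subSchι X j, ⟨h2, ?_, ?_⟩, h3⟩
  · change IsOpenImmersion j
    infer_instance
  · change Set.range j = (Set.range i)ᶜ
    rw [h3]
    exact Scheme.Opens.range_ι _

/-! ### Piecewise isomorphisms -/

/-- Refine the images of the pieces by a filtration of `Y`. Each stratum then lies in the image of
one piece, through which it lifts to `X`; injectivity of `f` makes the lift fill the whole preimage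
of the stratum. -/
lemma isPiecewiseIso_of_cover {X Y : Sch S n} (f : X ⟶ Y) (hf : Function.Injective f.hom.left)
    {P : Type*} [Finite P] (C : P → Sch S n) (v : ∀ p, C p ⟶ X) (hv : ∀ p, IsImm (v p ≫ f))
    (hs : ∀ y, ∃ p, y ∈ Set.range (v p ≫ f).hom.left) : IsPiecewiseIso f.hom.left := by
  rw [isPiecewiseIso_iff]
  obtain ⟨N, r, h1, h2, h3⟩ := exists_filtration_of_cover _ (fun p => (hv p).isLocallyClosed) hs
  refine ⟨N, r, h1, h2, fun i _ => ?_⟩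
  have hlc : IsLocallyClosed {y | r y = i} := by
    have : {y | r y = i} = {y | r y < i}ᶜ ∩ {y | r y < i + 1} := by
      ext y
      simp only [Set.mem_ofPred_eq, Set.mem_inter_iff, Set.mem_compl_iff]
      omega
    exact ⟨_, _, (h2 i).isOpen_compl, h2 (i + 1), this⟩
  obtain ⟨U, j, hj, hr⟩ := exists_subSch Y hlc
  obtain ⟨l, hl⟩ : ∃ l : U ⟶ X, l ≫ f = j := by
    -- The piece containing a stratum is found from a point of the stratum, so empty strata need
    -- separate treatment.
    rcases isEmpty_or_nonempty U.obj.left with hU | ⟨⟨u⟩⟩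
    · obtain ⟨l⟩ := exists_hom_of_isEmpty (X := U) X
      refine ⟨l, hom_ext_of_cover fun x => (hU.elim x)⟩
    · have hu : r (j.hom.left u) = i := hr.le ⟨u, rfl⟩
      obtain ⟨p, hp⟩ := h3 (j.hom.left u)
      rw [hu, ← hr] at hp
      obtain ⟨l, hl⟩ := exists_lift j (hv p) hp
      exact ⟨l ≫ v p, by rw [Category.assoc, hl]⟩
  have hli : IsImm l := IsImm.of_comp (g := f) (hl ▸ hj)
  refine ⟨U.obj.left, U.obj.left, l.hom.left, j.hom.left, Iso.refl _, inferInstance, inferInstance,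
    hli, hj, ?_, hr, ?_⟩
  · ext x
    constructor
    · rintro ⟨u, rfl⟩
      exact (congrArg r (apply_eq_of_eq hl u)).trans (hr.le ⟨u, rfl⟩)
    · intro hx
      obtain ⟨u, hu⟩ := hr.ge hx
      exact ⟨u, hf ((apply_eq_of_eq hl u).trans hu)⟩
  · rw [Iso.refl_hom, Category.id_comp]
    exact congrArg (fun t => t.hom.left) hl

/-- A piecewise isomorphism is an immersion on each of finitely many pieces. -/
lemma exists_cover_of_isPiecewiseIso {X Y : Sch S n} (f : X ⟶ Y) (hf : IsPiecewiseIso f.hom.left) :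
    ∃ (N : ℕ) (C : Fin N → Sch S n) (v : ∀ p, C p ⟶ X), (∀ p, IsImm (v p)) ∧
      (∀ p, IsImm (v p ≫ f)) ∧ (∀ y, ∃ p, y ∈ Set.range (v p ≫ f).hom.left) ∧
      ∀ x x', f.hom.left x = f.hom.left x' → ∃ p, x ∈ Set.range (v p).hom.left ∧
        x' ∈ Set.range (v p).hom.left := by
  rw [isPiecewiseIso_iff] at hf
  obtain ⟨N, r, h1, h2, h⟩ := hf
  choose V U v j e hV hU hv hj hrv hrj hc using h
  refine ⟨N, fun p => subSch X (v p p.2), fun p => subSchι X (v p p.2), fun p => hv p p.2,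
    fun p => ?_, fun y => ?_, fun x x' hx => ?_⟩
  · change IsImmersion (v p p.2 ≫ f.hom.left)
    rw [hc]
    infer_instance
  · refine ⟨⟨r y, h1 y⟩, ?_⟩
    change y ∈ Set.range (v _ _ ≫ f.hom.left)
    rw [hc]
    obtain ⟨z, hz⟩ := (hrj (r y) (h1 y)).ge rfl
    refine ⟨(e _ _).inv z, ?_⟩
    refine Eq.trans ?_ hz
    rw [← Scheme.Hom.comp_apply]
    exact congrArg (fun t : U (r y) (h1 y) ⟶ _ => t z) (Iso.inv_hom_id_assoc _ _)
  · exact ⟨⟨r (f.hom.left x), h1 _⟩, (hrv _ (h1 _)).ge rfl, (hrv _ (h1 _)).ge (congrArg r hx.symm)⟩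

lemma bijective_of_isPiecewiseIso {X Y : Sch S n} (f : X ⟶ Y) (hf : IsPiecewiseIso f.hom.left) :
    Function.Bijective f.hom.left := by
  obtain ⟨N, C, v, h1, h2, h3, h4⟩ := exists_cover_of_isPiecewiseIso f hf
  refine ⟨fun x x' h => ?_, fun y => ?_⟩
  · obtain ⟨p, ⟨a, rfl⟩, ⟨b, rfl⟩⟩ := h4 x x' h
    rw [(h2 p).injective h]
  · obtain ⟨p, c, hc⟩ := h3 y
    exact ⟨_, hc⟩

/-- Piecewise isomorphisms are monomorphisms. -/
lemma eq_of_comp_isPiecewiseIso {T X Y : Sch S n} {f : X ⟶ Y} (hf : IsPiecewiseIso f.hom.left)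
    {g h : T ⟶ X} (e : g ≫ f = h ≫ f) : g = h := by
  obtain ⟨N, C, v, h1, h2, h3, h4⟩ := exists_cover_of_isPiecewiseIso f hf
  have hinj := (bijective_of_isPiecewiseIso f hf).1
  have hgh (t : T.obj.left) : g.hom.left t = h.hom.left t := hinj (apply_eq_of_eq e t)
  refine hom_ext_of_cover fun t => ?_
  obtain ⟨p, hp, -⟩ := h4 (g.hom.left t) (g.hom.left t) rfl
  -- The two morphisms agree on points. Over the reduced preimage `W` of a piece both therefore
  -- factor through that piece, on which `f` is an immersion and can be cancelled.
  obtain ⟨W, a, b, ha, hab, hra, -⟩ := exists_pullback g (h1 p)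
  obtain ⟨b', hb'⟩ := exists_lift (a ≫ h) (h1 p) (by
    rintro _ ⟨w, rfl⟩
    refine ⟨b.hom.left w, (apply_eq_of_eq hab w).symm.trans (hgh _)⟩)
  refine ⟨W, a, hra.ge hp, ?_⟩
  have : b = b' := (h2 p).eq_of_comp_eq (by
    rw [← Category.assoc, ← hab, ← Category.assoc, hb', Category.assoc, Category.assoc, e])
  rw [hab, this, hb']

/-! ### Disjoint covering families -/

/-- Induction on the number of strata: the closed set `{r < N}` and its complement, the last
stratum, form a generating cover, and covers compose. -/
lemma mem_top_of_filtration (N : ℕ) : ∀ (Z : ImmSch S n) (r : Z.obj.obj.left → ℕ),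
    (∀ x, r x < N) → (∀ i, IsClosed {x | r x < i}) → ∀ R : Sieve Z,
    (∀ (T : ImmSch S n) (f : T ⟶ Z), Nonempty T.obj.obj.left → (∀ x y, r (f.hom.hom.left x) = r (f.hom.hom.left y)) → R f) →
    R ∈ (schAssembler S n).top Z := by
  induction N with
  | zero =>
    intro Z r hr _ R _
    exact mem_top_of_isEmpty Z ⟨fun x => Nat.not_lt_zero _ (hr x)⟩ R
  | succ N ih =>
    intro Z r hr hc R hR
    obtain ⟨V, U, i, j, hs, hi⟩ := exists_subtraction Z.obj (hc N)
    have hii : IsImm i := by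
      have := hs.1
      change IsImmersion i.hom.left
      infer_instance
    have hjj : IsImm j := by
      have := hs.2.1
      change IsImmersion j.hom.left
      infer_instance
    let i' : (⟨V⟩ : ImmSch S n) ⟶ Z := ⟨i, hii⟩
    let j' : (⟨U⟩ : ImmSch S n) ⟶ Z := ⟨j, hjj⟩
    have h : (Presieve.singleton i' ⊔ Presieve.singleton j') ∈ (closedOpen S n) Z :=
      Or.inl ⟨_, _, i', j', hs, rfl⟩
    refine (schAssembler S n).top.transitive (Precoverage.generate_mem_toGrothendieck h) _ ?_
    rintro Y f ⟨W, a, b, hb, rfl⟩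
    rw [Sieve.pullback_comp]
    refine (schAssembler S n).top.pullback_stable _ ?_
    rcases hb with hb | hb
    · cases hb
      refine ih _ (fun x => r (i.hom.left x)) (fun x => ?_) (fun m => ?_) _ fun T f hT hf => ?_
      · exact hi.le ⟨x, rfl⟩
      · exact (hc m).preimage i.hom.left.continuous
      · exact hR T (f ≫ i') hT hf
    · cases hb
      -- The sieve is known to contain only immersions from non-empty schemes; over an empty stratum
      -- every sieve covers.
      rcases isEmpty_or_nonempty U.obj.left with hU | hU
      · exact mem_top_of_isEmpty _ hU _
      have : R.pullback j' = ⊤ := by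
        rw [← Sieve.mem_iff_pullback_eq_top]
        refine hR _ j' hU fun x y => ?_
        have hN (x : U.obj.left) : r (j.hom.left x) = N := by
          have h1 : ¬ r (j.hom.left x) < N := fun h => (hs.2.2.le ⟨x, rfl⟩) (hi.ge h)
          have h2 := hr (j.hom.left x)
          omega
        exact (hN x).trans (hN y).symm
      rw [this]
      exact (schAssembler S n).top.top_mem _

/-- A filtration refining the images shows that every immersion from a non-empty scheme into one
stratum factors through a member of the family, which is the criterion by filtrations. -/
lemma mem_top_of_cover {ι : Type} [Finite ι] {Z : ImmSch S n} (X : ι → ImmSch S n)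
    (f : ∀ i, X i ⟶ Z) (h : ∀ z, ∃ i, z ∈ Set.range (f i).hom.hom.left) :
    Sieve.ofArrows X f ∈ (schAssembler S n).top Z := by
  obtain ⟨N, r, h1, h2, h3⟩ := exists_filtration_of_cover _
    (fun i => IsImm.isLocallyClosed (f := (f i).hom) (f i).property) h
  refine mem_top_of_filtration N Z r h1 h2 _ fun T g ⟨t⟩ hg => ?_
  obtain ⟨p, hp⟩ := h3 (g.hom.hom.left t)
  obtain ⟨l, hl⟩ := exists_lift g.hom (g := (f p).hom) (f p).property (by
    rintro _ ⟨x, rfl⟩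
    exact hp (hg x t))
  have hli : IsImm l := IsImm.of_comp (g := (f p).hom) (hl ▸ g.property)
  have : g = (⟨l, hli⟩ : T ⟶ X p) ≫ f p := by
    ext1
    exact hl.symm
  rw [this]
  exact Sieve.downward_closed _ (Sieve.ofArrows_mk X f p) _

/-- The topology of jointly surjective sieves. -/
def surjTopology (S : Scheme.{u}) [AlgebraicGeometry.IsNoetherian S] (n : ℕ∞) :
    GrothendieckTopology (ImmSch S n) where
  sieves Z := {R | ∀ z, ∃ (T : ImmSch S n) (f : T ⟶ Z), R f ∧ z ∈ Set.range f.hom.hom.left}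
  top_mem' Z z := ⟨Z, 𝟙 Z, trivial, z, rfl⟩
  pullback_stable' {X Y R} f hR y := by
    obtain ⟨T, g, hg, hy⟩ := hR (f.hom.hom.left y)
    obtain ⟨W, a, b, h1, h2, h3, h4⟩ := exists_pullback f.hom (j := g.hom) g.property
    refine ⟨⟨W⟩, ⟨a, h1⟩, ?_, h3.ge hy⟩
    have : (⟨a, h1⟩ : (⟨W⟩ : ImmSch S n) ⟶ Y) ≫ f = (⟨b, h4 f.property⟩ : _ ⟶ T) ≫ g := by
      ext1
      exact h2
    change R _
    rw [this]
    exact R.downward_closed hg _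
  transitive' {X R} hR R' h x := by
    obtain ⟨T, f, hf, t, rfl⟩ := hR x
    obtain ⟨T', f', hf', t', rfl⟩ := h hf t
    exact ⟨T', f' ≫ f, hf', t', rfl⟩

/-- The jointly surjective sieves form a Grothendieck topology that contains the generating
families, so the generated topology is no finer. -/
lemma cover_of_mem_top {Z : ImmSch S n} {R : Sieve Z} (hR : R ∈ (schAssembler S n).top Z)
    (z : Z.obj.obj.left) :
    ∃ (T : ImmSch S n) (f : T ⟶ Z), R f ∧ z ∈ Set.range f.hom.hom.left := by
  have : (closedOpen S n).toGrothendieck ≤ surjTopology S n := by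
    rw [Precoverage.toGrothendieck_le_iff_le_toPrecoverage]
    rintro X R (⟨V, U, i, j, hs, rfl⟩ | ⟨hX, rfl⟩) x
    · by_cases hx : x ∈ Set.range i.hom.hom.left
      · exact ⟨V, i, ⟨V, 𝟙 _, i, Or.inl ⟨⟩, Category.id_comp _⟩, hx⟩
      · exact ⟨U, j, ⟨U, 𝟙 _, j, Or.inr ⟨⟩, Category.id_comp _⟩, hs.2.2.ge hx⟩
    · exact hX.elim x
  exact this Z hR z

lemma isEmpty_iff_hom_empty (T : ImmSch S n) :
    Nonempty (T ⟶ (schAssembler S n).empty) ↔ IsEmpty T.obj.obj.left := by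
  constructor
  · rintro ⟨f⟩
    have : IsEmpty (emptySch S n).obj.left := inferInstanceAs (IsEmpty (∅ : Scheme.{u}))
    exact isEmpty_of_hom (Y := emptySch S n) f.hom
  · intro h
    obtain ⟨f⟩ := exists_hom_of_isEmpty (X := T.obj) (emptySch S n)
    exact ⟨⟨f, isImm_of_isEmpty f⟩⟩

lemma isEmpty_isInitial_iff (T : ImmSch S n) :
    IsEmpty (IsInitial T) ↔ Nonempty T.obj.obj.left := by
  rw [← not_iff_not, not_isEmpty_iff, not_nonempty_iff, ← isEmpty_iff_hom_empty]
  constructor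
  · rintro ⟨h⟩
    exact ⟨h.to _⟩
  · rintro ⟨f⟩
    exact ⟨IsInitial.ofUniqueHom (fun X => f ≫ (schAssembler S n).isInitial.to X)
      fun X m => ((schAssembler S n).to_empty_comp f m).symm⟩

/-- Disjoint covering families are the finite families of immersions whose images partition the
target. -/
lemma isDisjointCover_iff {ι : Type} [Finite ι] {Z : ImmSch S n} (X : ι → ImmSch S n)
    (f : ∀ i, X i ⟶ Z) :
    (schAssembler S n).IsDisjointCover X f ↔
      (∀ z, ∃ i, z ∈ Set.range (f i).hom.hom.left) ∧
      ∀ i j x y, (f i).hom.hom.left x = (f j).hom.hom.left y → i = j := by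
  constructor
  · rintro ⟨h1, h2⟩
    refine ⟨fun z => ?_, fun i j x y hxy => ?_⟩
    · obtain ⟨T, g, hg, t, rfl⟩ := cover_of_mem_top h1 z
      obtain ⟨W, a, b, ⟨i⟩, rfl⟩ := hg
      exact ⟨i, a.hom.hom.left t, rfl⟩
    · by_contra hij
      have hd := h2 i j hij
      rw [AssemblerData.disjoint_iff] at hd
      -- The reduced intersection of the two members is a test object; disjointness makes it empty,
      -- contradicting the common point.
      obtain ⟨W, a, b, h1, h2, h3, h4⟩ := exists_pullback (f i).hom (j := (f j).hom) (f j).property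
      have := (isEmpty_iff_hom_empty ⟨W⟩).1 (hd ⟨W⟩ ⟨a, h1⟩ ⟨b, h4 (f i).property⟩ (by
        ext1
        exact h2))
      obtain ⟨w, -⟩ := h3.ge ⟨y, hxy.symm⟩
      exact this.elim w
  · rintro ⟨h1, h2⟩
    refine ⟨mem_top_of_cover X f h1, fun i j hij => ?_⟩
    rw [AssemblerData.disjoint_iff]
    intro T a b hab
    rw [isEmpty_iff_hom_empty]
    exact ⟨fun t => hij (h2 i j (a.hom.hom.left t) (b.hom.hom.left t)
      (congrArg (fun g => g.hom.hom.left t) hab))⟩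

end

end KTheory

namespace KTheory

open CategoryTheory Limits Opposite

open AlgebraicGeometry

/-! ### Finite coproducts -/

/-- The dimension of a finite disjoint union of open subspaces. -/
lemma topologicalKrullDim_le_of_sigma {P : Type*} [TopologicalSpace P] {ι : Type*} {X : ι → Type*}
    [∀ i, TopologicalSpace (X i)] (f : ∀ i, X i → P)
    (hf : ∀ i, Topology.IsOpenEmbedding (f i)) (hs : ∀ p, ∃ i, p ∈ Set.range (f i))
    (hd : ∀ i j, i ≠ j → Disjoint (Set.range (f i)) (Set.range (f j)))
    {d : WithBot ℕ∞} (h : ∀ i, topologicalKrullDim (X i) ≤ d) : topologicalKrullDim P ≤ d := by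
  rw [topologicalKrullDim, Order.krullDim_eq_iSup_height]
  refine iSup_le fun Z => ?_
  obtain ⟨z, hz⟩ := Z.isIrreducible.nonempty
  obtain ⟨i, hi⟩ := hs z
  -- An irreducible set cannot meet two disjoint open sets, so `Z`, and with it every chain below
  -- `Z`, lies in a single summand.
  have hZ : (Z : Set P) ⊆ Set.range (f i) := by
    intro p hp
    obtain ⟨j, hj⟩ := hs p
    obtain ⟨q, -, hq1, hq2⟩ := Z.isIrreducible.isPreirreducible _ _ (hf i).isOpen_range
      (hf j).isOpen_range ⟨z, hz, hi⟩ ⟨p, hp, hj⟩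
    by_cases hij : i = j
    · exact hij ▸ hj
    · exact ((Set.disjoint_left.1 (hd i j hij)) hq1 hq2).elim
  rw [Order.height_eq_krullDim_Iic]
  refine le_trans ?_ (h i)
  let g : Set.Iic Z → TopologicalSpace.IrreducibleCloseds (X i) := fun W =>
    { carrier := f i ⁻¹' (W.1 : Set P)
      isIrreducible' := by
        refine ⟨?_, W.1.isIrreducible.isPreirreducible.preimage (hf i)⟩
        obtain ⟨w, hw⟩ := W.1.isIrreducible.nonempty
        obtain ⟨x, rfl⟩ := hZ (W.2 hw)
        exact ⟨x, hw⟩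
      isClosed' := W.1.isClosed.preimage (hf i).continuous }
  refine Order.krullDim_le_of_strictMono g fun W W' hW => ?_
  refine lt_of_le_not_ge (fun x hx => hW.le hx) fun hle => hW.not_ge fun w hw => ?_
  obtain ⟨x, rfl⟩ := hZ (W'.2 hw)
  exact hle hw

section

variable {S : Scheme.{u}} {n : ℕ∞} [AlgebraicGeometry.IsNoetherian S]

/-- For an empty index set the coproduct is the designated empty scheme on the nose, because the
`S`-construction requires that very object at degenerate intervals. The last clause lets open
immersions out of the coproduct be tested on summands. -/
lemma exists_coproduct (T : Set ℕ) (hT : T.Finite) (X : T → Sch S n) :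
    ∃ (P : Sch S n) (ι : ∀ i, X i ⟶ P),
      (∀ (Y : Sch S n) (f : ∀ i, X i ⟶ Y), ∃ g : P ⟶ Y, ∀ i, ι i ≫ g = f i) ∧
      (∀ i, IsOpenImmersion (ι i).hom.left) ∧
      (∀ i j x y, (ι i).hom.left x = (ι j).hom.left y → i = j) ∧
      (∀ p, ∃ i, p ∈ Set.range (ι i).hom.left) ∧ (T = ∅ → P = emptySch S n) ∧
      ∀ (Y : Sch S n) (g : P ⟶ Y), (∀ i, IsOpenImmersion (ι i ≫ g).hom.left) →
        Function.Injective g.hom.left → IsOpenImmersion g.hom.left := by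
  by_cases hT0 : T = ∅
  · subst hT0
    have he : IsEmpty (emptySch S n).obj.left := inferInstanceAs (IsEmpty (∅ : Scheme.{u}))
    exact ⟨emptySch S n, fun i => i.2.elim, fun Y f => ⟨(emptySchIsInitial S n).to Y,
      fun i => i.2.elim⟩, fun i => i.2.elim, fun i => i.2.elim, fun p => he.elim p, fun _ => rfl,
      fun Y g _ _ => inferInstance⟩
  have : Finite T := hT
  let Q : Scheme.{u} := ∐ fun i => (X i).obj.left
  let ι (i : T) : (X i).obj.left ⟶ Q := Sigma.ι (fun i => (X i).obj.left) i
  have hs (p : Q) : ∃ i, p ∈ Set.range (ι i) := by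
    obtain ⟨i, x, hx⟩ := (sigmaOpenCover fun i => (X i).obj.left).exists_eq p
    exact ⟨i, x, hx⟩
  have hd (i j : T) (x : (X i).obj.left) (y : (X j).obj.left) (h : ι i x = ι j y) : i = j :=
    congrArg Sigma.fst ((sigmaι_eq_iff (fun i : T => (X i).obj.left) i j x y).1 h)
  have hn : TopologicalSpace.NoetherianSpace Q := by
    rw [← TopologicalSpace.noetherian_univ_iff]
    have (i : T) : TopologicalSpace.NoetherianSpace (Set.range (ι i)) := by
      have := noetherianSpace_left (X i)
      exact TopologicalSpace.NoetherianSpace.range _ (ι i).continuous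
    have h := TopologicalSpace.NoetherianSpace.iUnion fun i => Set.range (ι i)
    rwa [show (⋃ i, Set.range (ι i)) = Set.univ from Set.eq_univ_of_forall fun p =>
      Set.mem_iUnion.2 (hs p)] at h
  let q : Q ⟶ S := Sigma.desc fun i => (X i).obj.hom
  have hq (i : T) : ι i ≫ q = (X i).obj.hom := Sigma.ι_desc _ _
  have hl (i : T) : LocallyOfFiniteType (ι i ≫ q) := by
    rw [hq]
    exact (X i).property.2.1
  let P : Sch S n :=
    { obj := Over.mk q
      property := by
        refine ⟨?_, ?_, quasiCompact_of_noetherianSpace_source (X := Q) _, ?_⟩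
        · have (i : (sigmaOpenCover fun i => (X i).obj.left).I₀) : AlgebraicGeometry.IsReduced
            ((sigmaOpenCover fun i => (X i).obj.left).X i) := isReduced_left (X i)
          exact AlgebraicGeometry.IsReduced.of_openCover Q
            (sigmaOpenCover fun i => (X i).obj.left)
        · have : IsZariskiLocalAtSource (@LocallyOfFiniteType.{u} : MorphismProperty Scheme.{u}) :=
            HasRingHomProperty.instIsZariskiLocalAtSource (Q := RingHom.FiniteType)
          refine (IsZariskiLocalAtSource.iff_of_openCover (P := @LocallyOfFiniteType)
            (sigmaOpenCover fun i => (X i).obj.left)).2 fun i => ?_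
          exact hl i
        · refine topologicalKrullDim_le_of_sigma (fun i => ι i) (fun i => (ι i).isOpenEmbedding) hs
            (fun i j hij => Set.disjoint_left.2 ?_) fun i => (X i).property.2.2.2
          rintro _ ⟨x, rfl⟩ ⟨y, hy⟩
          exact hij (hd i j x y hy.symm) }
  refine ⟨P, fun i => ObjectProperty.homMk (Over.homMk (ι i) (hq i)), fun Y f => ?_,
    fun i => inferInstanceAs (IsOpenImmersion (ι i)), hd, hs, fun h => (hT0 h).elim,
    fun Y g hg hi => ?_⟩
  · refine ⟨ObjectProperty.homMk (Over.homMk (Sigma.desc fun i => (f i).hom.left) ?_), fun i => ?_⟩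
    · refine Sigma.hom_ext _ _ fun i => ?_
      rw [Sigma.ι_desc_assoc]
      exact (Over.w (f i).hom).trans (hq i).symm
    · exact sch_hom_ext (Sigma.ι_desc _ _)
  · have hg' (i : T) : IsOpenImmersion (ι i ≫ g.hom.left) := hg i
    let G : Q ⟶ Y.obj.left := g.hom.left
    have : G = Sigma.desc fun i => ι i ≫ G :=
      Sigma.hom_ext _ _ fun i => (Sigma.ι_desc (fun i => ι i ≫ G) i).symm
    change IsOpenImmersion G
    rw [this]
    refine isOpenImmersion_sigmaDesc _ _ fun i j hij => Set.disjoint_left.2 ?_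
    rintro _ ⟨x, rfl⟩ ⟨y, hy⟩
    exact hij (hd i j x y (hi hy.symm))

/-- The coproduct of a finite family of schemes. -/
noncomputable def cop (T : Set ℕ) (hT : T.Finite) (X : T → Sch S n) : Sch S n :=
  (exists_coproduct T hT X).choose

/-- The inclusion of a summand. -/
noncomputable def copι (T : Set ℕ) (hT : T.Finite) (X : T → Sch S n) (i : T) :
    X i ⟶ cop T hT X :=
  (exists_coproduct T hT X).choose_spec.choose i

variable {T : Set ℕ} {hT : T.Finite} {X : T → Sch S n}

lemma exists_desc {Y : Sch S n} (f : ∀ i, X i ⟶ Y) :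
    ∃ g : cop T hT X ⟶ Y, ∀ i, copι T hT X i ≫ g = f i :=
  (exists_coproduct T hT X).choose_spec.choose_spec.1 Y f

lemma isOpenImmersion_copι (i : T) : IsOpenImmersion (copι T hT X i).hom.left :=
  (exists_coproduct T hT X).choose_spec.choose_spec.2.1 i

lemma isImm_copι (i : T) : IsImm (copι T hT X i) := by
  have := isOpenImmersion_copι (hT := hT) (X := X) i
  change IsImmersion (copι T hT X i).hom.left
  infer_instance

lemma copι_disjoint {i j : T} {x y} (h : (copι T hT X i).hom.left x = (copι T hT X j).hom.left y) :
    i = j :=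
  (exists_coproduct T hT X).choose_spec.choose_spec.2.2.1 i j x y h

lemma copι_surjective (p : (cop T hT X).obj.left) : ∃ i x, (copι T hT X i).hom.left x = p :=
  (exists_coproduct T hT X).choose_spec.choose_spec.2.2.2.1 p

lemma cop_eq_empty (h : T = ∅) : cop T hT X = emptySch S n :=
  (exists_coproduct T hT X).choose_spec.choose_spec.2.2.2.2.1 h

lemma isOpenImmersion_of_copι {Y : Sch S n} (g : cop T hT X ⟶ Y)
    (h : ∀ i, IsOpenImmersion (copι T hT X i ≫ g).hom.left) (hg : Function.Injective g.hom.left) :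
    IsOpenImmersion g.hom.left :=
  (exists_coproduct T hT X).choose_spec.choose_spec.2.2.2.2.2 Y g h hg

lemma cop_hom_ext {Y : Sch S n} {f g : cop T hT X ⟶ Y}
    (h : ∀ i, copι T hT X i ≫ f = copι T hT X i ≫ g) : f = g :=
  hom_ext_of_cover fun p => by
    obtain ⟨i, x, hx⟩ := copι_surjective p
    exact ⟨X i, _, ⟨x, hx⟩, h i⟩

variable {T' : Set ℕ} {hT' : T'.Finite} {X' : T' → Sch S n}

/-- The map of coproducts induced by a map of index sets and maps of the summands. -/
noncomputable def copMap (φ : T → T') (f : ∀ i, X i ⟶ X' (φ i)) : cop T hT X ⟶ cop T' hT' X' :=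
  (exists_desc fun i => f i ≫ copι T' hT' X' (φ i)).choose

lemma copι_copMap (φ : T → T') (f : ∀ i, X i ⟶ X' (φ i)) (i : T) :
    copι T hT X i ≫ copMap (hT' := hT') φ f = f i ≫ copι T' hT' X' (φ i) :=
  (exists_desc fun i => f i ≫ copι T' hT' X' (φ i)).choose_spec i

lemma copMap_id (φ : T → T) (f : ∀ i, X i ⟶ X (φ i)) (hφ : ∀ i, φ i = i)
    (hf : ∀ i, f i = eqToHom (by rw [hφ])) :
    copMap (hT := hT) (hT' := hT) φ f = 𝟙 _ := by
  obtain rfl : φ = id := funext hφ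
  refine cop_hom_ext fun i => ?_
  rw [copι_copMap, hf, Category.comp_id]
  exact Category.id_comp _

lemma copMap_comp {T'' : Set ℕ} {hT'' : T''.Finite} {X'' : T'' → Sch S n} (φ : T → T')
    (f : ∀ i, X i ⟶ X' (φ i)) (ψ : T' → T'') (g : ∀ i, X' i ⟶ X'' (ψ i)) :
    copMap (hT := hT) (hT' := hT') φ f ≫ copMap (hT' := hT'') ψ g =
      copMap (X' := X'') (fun i => ψ (φ i)) fun i => f i ≫ g (φ i) := by
  refine cop_hom_ext fun i => ?_
  rw [← Category.assoc, copι_copMap, Category.assoc, copι_copMap, copι_copMap, Category.assoc]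

end

section

variable {S : Scheme.{u}} {n : ℕ∞} [AlgebraicGeometry.IsNoetherian S]

/-- Coproducts are chosen as a function of the family, so equal families have equal, not just
isomorphic, coproducts. This is why index sets are sets of natural numbers, and it makes the
comparison strictly simplicial. -/
lemma cop_congr {T U : Set ℕ} {hT : T.Finite} {hU : U.Finite} {X : T → Sch S n} {Y : U → Sch S n}
    (h : T = U) (hXY : ∀ i hi hi', X ⟨i, hi⟩ = Y ⟨i, hi'⟩) : cop T hT X = cop U hU Y := by
  subst h
  obtain rfl : X = Y := funext fun i => hXY i.1 i.2 i.2
  rfl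

lemma copMap_heq {T U T' U' : Set ℕ} {hT : T.Finite} {hU : U.Finite} {hT' : T'.Finite}
    {hU' : U'.Finite} {X : T → Sch S n} {Y : U → Sch S n} {X' : T' → Sch S n} {Y' : U' → Sch S n}
    {φ : T → T'} {f : ∀ i, X i ⟶ X' (φ i)} {ψ : U → U'} {g : ∀ i, Y i ⟶ Y' (ψ i)}
    (h : T = U) (hXY : ∀ i hi hi', X ⟨i, hi⟩ = Y ⟨i, hi'⟩)
    (h' : T' = U') (hXY' : ∀ i hi hi', X' ⟨i, hi⟩ = Y' ⟨i, hi'⟩)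
    (hφ : ∀ i hi hi', (φ ⟨i, hi⟩).1 = (ψ ⟨i, hi'⟩).1)
    (hf : ∀ i hi hi', HEq (f ⟨i, hi⟩) (g ⟨i, hi'⟩)) :
    HEq (copMap (hT := hT) (hT' := hT') φ f) (copMap (hT := hU) (hT' := hU') ψ g) := by
  subst h h'
  obtain rfl : X = Y := funext fun i => hXY i.1 i.2 i.2
  obtain rfl : X' = Y' := funext fun i => hXY' i.1 i.2 i.2
  obtain rfl : φ = ψ := funext fun i => Subtype.ext (hφ i.1 i.2 i.2)
  obtain rfl : f = g := funext fun i => eq_of_heq (hf i.1 i.2 i.2)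
  rfl

end

end KTheory

namespace KTheory

open CategoryTheory Limits Opposite

open AlgebraicGeometry AssemblerData

/-! ### The comparison functor -/

/-- All intervals of the box `I` are mapped to `[0, 1]` by the components of `x`. -/
def Active {k : ℕ} {m : SimplexCategory} (x : Sphere k m) (I : Box k m.len) : Prop :=
  ∀ a, (x a).toOrderHom (I a).fst = 0 ∧ (x a).toOrderHom (I a).snd = 1

lemma Active.mono {k : ℕ} {m : SimplexCategory} {x : Sphere k m} {I J : Box k m.len}
    (h : Active x I) (hIJ : I ≤ J) : Active x J := by
  intro a
  have h1 : (x a).toOrderHom (J a).fst ≤ (x a).toOrderHom (I a).fst :=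
    (x a).toOrderHom.monotone (hIJ a).1
  have h2 : (x a).toOrderHom (I a).snd ≤ (x a).toOrderHom (J a).snd :=
    (x a).toOrderHom.monotone (hIJ a).2
  rw [(h a).1] at h1
  rw [(h a).2] at h2
  exact ⟨le_antisymm h1 (Fin.zero_le _), le_antisymm (Fin.le_last _) h2⟩

lemma Active.notMem_base {k : ℕ} {m : SimplexCategory} {x : Sphere k m} {I : Box k m.len}
    (h : Active x I) : x ∉ Sphere.base k m := by
  rintro ⟨a, ha⟩
  have := ha (I a).fst (I a).snd
  rw [(h a).1, (h a).2] at this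
  exact absurd this (by decide)

lemma eq_zero_or_one (i : Fin (SimplexCategory.len (SimplexCategory.mk 1) + 1)) :
    i = 0 ∨ i = 1 := by
  have h := i.2
  rcases i with ⟨i, hi⟩
  have : i < 2 := hi
  interval_cases i
  · exact Or.inl rfl
  · exact Or.inr rfl

section

variable {S : Scheme.{u}} {n : ℕ∞} {k : ℕ} {m : SimplexCategory}

/-- Families of schemes labelled by the simplices of a sphere. -/
abbrev SphFam (S : Scheme.{u}) (n : ℕ∞) (k : ℕ) (m : SimplexCategory) :=
  Fam (C := ImmSch S n) (Sphere k m) (Sphere.base k m)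

namespace SphFam

/-- The scheme with a given index. -/
abbrev sch (A : SphFam S n k m) (i : A.idx) : Sch S n := (A.obj i).obj

/-- The indices whose label is active at `I`. -/
def act (A : SphFam S n k m) (I : Box k m.len) : Set ℕ :=
  {i | ∃ h : i ∈ A.idx, Active (A.label ⟨i, h⟩) I}

lemma act_finite (A : SphFam S n k m) (I : Box k m.len) : (A.act I).Finite :=
  A.finite.subset fun _ h => h.1

lemma act_mono (A : SphFam S n k m) {I J : Box k m.len} (h : I ≤ J) : A.act I ⊆ A.act J :=
  fun _ hi => ⟨hi.1, hi.2.mono h⟩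

/-- The points of the members of a family. -/
abbrev Pt (A : SphFam S n k m) := Σ i, (A.sch i).obj.left

lemma sigma_eqToHom {A : SphFam S n k m} {i j : A.idx} (h : i = j) (x : (A.sch i).obj.left) :
    (⟨j, (eqToHom (congrArg A.obj h)).hom.hom.left x⟩ : A.Pt) = ⟨i, x⟩ := by
  subst h
  rfl

lemma label_active {A B : SphFam S n k m} (g : (schAssembler S n).FamHom A B) {I : Box k m.len}
    (i : A.act I) : (g.idxMap ⟨i.1, i.2.1⟩).1 ∈ B.act I :=
  ⟨(g.idxMap ⟨i.1, i.2.1⟩).2, (g.label_eq ⟨i.1, i.2.1⟩).symm ▸ i.2.2⟩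

variable [AlgebraicGeometry.IsNoetherian S]

/-- The coproduct of the schemes with active label. -/
noncomputable def box (A : SphFam S n k m) (I : Box k m.len) : Sch S n :=
  cop (A.act I) (A.act_finite I) fun i => A.sch ⟨i.1, i.2.1⟩

/-- The inclusion of a summand. -/
noncomputable def ι (A : SphFam S n k m) (I : Box k m.len) (i : A.act I) :
    A.sch ⟨i.1, i.2.1⟩ ⟶ A.box I :=
  copι (A.act I) (A.act_finite I) (fun i => A.sch ⟨i.1, i.2.1⟩) i

lemma ι_surjective {A : SphFam S n k m} {I : Box k m.len} (p : (A.box I).obj.left) :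
    ∃ i x, (A.ι I i).hom.left x = p :=
  copι_surjective p

lemma ι_disjoint {A : SphFam S n k m} {I : Box k m.len} {i j : A.act I} {x y}
    (h : (A.ι I i).hom.left x = (A.ι I j).hom.left y) : i = j :=
  copι_disjoint h

lemma isImm_ι (A : SphFam S n k m) (I : Box k m.len) (i : A.act I) : IsImm (A.ι I i) :=
  isImm_copι i

lemma isOpenImmersion_ι (A : SphFam S n k m) (I : Box k m.len) (i : A.act I) :
    IsOpenImmersion (A.ι I i).hom.left :=
  isOpenImmersion_copι i

lemma box_hom_ext {A : SphFam S n k m} {I : Box k m.len} {Y : Sch S n} {f g : A.box I ⟶ Y}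
    (h : ∀ i, A.ι I i ≫ f = A.ι I i ≫ g) : f = g :=
  cop_hom_ext h

/-- The inclusion of coproducts for an inclusion of boxes. -/
noncomputable def boxHom (A : SphFam S n k m) {I J : Box k m.len} (h : I ≤ J) :
    A.box I ⟶ A.box J :=
  copMap (fun i => ⟨i.1, A.act_mono h i.2⟩) fun _ => 𝟙 _

lemma ι_boxHom (A : SphFam S n k m) {I J : Box k m.len} (h : I ≤ J) (i : A.act I) :
    A.ι I i ≫ A.boxHom h = A.ι J ⟨i.1, A.act_mono h i.2⟩ :=
  (copι_copMap _ _ i).trans (Category.id_comp _)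

lemma boxHom_injective (A : SphFam S n k m) {I J : Box k m.len} (h : I ≤ J) :
    Function.Injective (A.boxHom h).hom.left := by
  intro p q hpq
  obtain ⟨i, x, rfl⟩ := ι_surjective p
  obtain ⟨j, y, rfl⟩ := ι_surjective q
  have e1 := apply_eq_of_eq (A.ι_boxHom h i) x
  have e2 := apply_eq_of_eq (A.ι_boxHom h j) y
  have e := e1.symm.trans (hpq.trans e2)
  have hij := ι_disjoint e
  obtain rfl : i = j := Subtype.ext (congrArg (fun t : A.act J => t.1) hij)
  rw [(A.isImm_ι J _).injective e]

lemma isOpenImmersion_boxHom (A : SphFam S n k m) {I J : Box k m.len} (h : I ≤ J) :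
    IsOpenImmersion (A.boxHom h).hom.left :=
  isOpenImmersion_of_copι _ (fun i => by
    change IsOpenImmersion (A.ι I i ≫ A.boxHom h).hom.left
    rw [ι_boxHom]
    exact A.isOpenImmersion_ι _ _) (A.boxHom_injective h)

lemma ι_mem_range_boxHom (A : SphFam S n k m) {I J : Box k m.len} (h : I ≤ J) (i : A.act J)
    (x : (A.sch ⟨i.1, i.2.1⟩).obj.left) :
    (A.ι J i).hom.left x ∈ Set.range (A.boxHom h).hom.left ↔ i.1 ∈ A.act I := by
  constructor
  · rintro ⟨p, hp⟩
    obtain ⟨j, y, rfl⟩ := ι_surjective p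
    have e := (apply_eq_of_eq (A.ι_boxHom h j) y).symm.trans hp
    have := congrArg Subtype.val (ι_disjoint e)
    exact this ▸ j.2
  · intro hi
    exact ⟨(A.ι I ⟨i.1, hi⟩).hom.left x, apply_eq_of_eq (A.ι_boxHom h ⟨i.1, hi⟩) x⟩

/-- The diagram of coproducts. -/
noncomputable def diagram (A : SphFam S n k m) : (schSW S n).SObj k m.len where
  toFunctor :=
    { obj := A.box
      map := fun h => A.boxHom h.le
      map_id := fun I => copMap_id _ _ (fun _ => rfl) fun _ => rfl
      map_comp := fun {I J K} f g => by
        refine Eq.symm ((copMap_comp _ _ _ _).trans ?_)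
        exact congrArg (copMap _) (funext fun i => Category.id_comp _) }
  -- An active label would take both values 0 and 1 at the endpoint of a degenerate interval.
  obj_eq_zero I a h := cop_eq_empty (hT := A.act_finite I) (Set.eq_empty_of_forall_notMem fun i hi => by
    have := hi.2 a
    rw [h, this.2] at this
    exact absurd this.1 (by decide))
  isSub a P Q R hP hR h h1 h2 h3 := by
    -- The box `Q` is cut in coordinate `a` at the common endpoint of `P` and `R`. A label active at
    -- `Q` is active at `P` if its value at the cut is 1, and at `R` if it is 0.
    have hc : Set.range (A.boxHom hR).hom.left = (Set.range (A.boxHom hP).hom.left)ᶜ := by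
      ext p
      obtain ⟨i, x, rfl⟩ := ι_surjective p
      rw [Set.mem_compl_iff, ι_mem_range_boxHom, ι_mem_range_boxHom]
      obtain ⟨i, hi, hQ⟩ := i
      constructor
      · rintro ⟨_, h4⟩ ⟨_, h5⟩
        have h6 := (h4 a).1
        rw [← h2, (h5 a).2] at h6
        exact absurd h6 (by decide)
      · intro h4
        refine ⟨hi, fun b => ?_⟩
        by_cases hba : b = a
        · subst hba
          rcases eq_zero_or_one (((A.label ⟨i, hi⟩ b).toOrderHom) (P b).snd) with h5 | h5
          · exact ⟨h2 ▸ h5, h3 ▸ (hQ b).2⟩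
          · refine (h4 ⟨hi, fun c => ?_⟩).elim
            by_cases hcb : c = b
            · subst hcb
              exact ⟨h1 ▸ (hQ c).1, h5⟩
            · rw [(h c hcb).1]
              exact hQ c
        · rw [(h b hba).2]
          exact hQ b
    have o1 := A.isOpenImmersion_boxHom hP
    have o2 := A.isOpenImmersion_boxHom hR
    -- Both inclusions are open immersions with complementary images, so the first is closed as
    -- well.
    refine ⟨IsClosedImmersion.of_isPreimmersion _ ?_, o2, hc⟩
    rw [← isOpen_compl_iff]
    exact hc ▸ (A.boxHom hR).hom.left.isOpenEmbedding.isOpen_range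

/-- The map on points induced by a map of families. -/
def ptMap {A B : SphFam S n k m} (φ : A.idx → B.idx) (f : ∀ i, A.obj i ⟶ B.obj (φ i))
    (p : A.Pt) : B.Pt :=
  ⟨φ p.1, (f p.1).hom.hom.left p.2⟩

/-- The covering conditions over all members of the target together say that every point of the
target has exactly one preimage. With `homMk` as converse, maps of families are label-preserving
immersions that are bijective on points. -/
lemma ptMap_bijective {A B : SphFam S n k m} (g : (schAssembler S n).FamHom A B) :
    Function.Bijective (ptMap g.idxMap g.hom) := by
  have := A.finite.to_subtype
  constructor
  · rintro ⟨i, x⟩ ⟨i', x'⟩ h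
    have hi : g.idxMap i = g.idxMap i' := congrArg Sigma.fst h
    have hd := ((isDisjointCover_iff _ _).1 (g.cover (g.idxMap i'))).2 ⟨i, hi⟩ ⟨i', rfl⟩ x x'
      (eq_of_heq (Sigma.mk.inj ((sigma_eqToHom hi _).trans h)).2)
    obtain rfl : i = i' := congrArg Subtype.val hd
    have hx := eq_of_heq (Sigma.mk.inj h).2
    exact congrArg (Sigma.mk i) (IsImm.injective (f := (g.hom i).hom) (g.hom i).property hx)
  · rintro ⟨j, y⟩
    obtain ⟨⟨i, rfl⟩, x, hx⟩ := ((isDisjointCover_iff _ _).1 (g.cover j)).1 y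
    exact ⟨⟨i, x⟩, congrArg (Sigma.mk (g.idxMap i)) hx⟩

/-- Maps of families from bijections on points. -/
def homMk {A B : SphFam S n k m} (φ : A.idx → B.idx) (f : ∀ i, A.obj i ⟶ B.obj (φ i))
    (hl : ∀ i, B.label (φ i) = A.label i) (hb : Function.Bijective (ptMap φ f)) :
    (schAssembler S n).FamHom A B where
  idxMap := φ
  hom := f
  label_eq := hl
  cover j := by
    have := A.finite.to_subtype
    refine (isDisjointCover_iff _ _).2 ⟨fun y => ?_, ?_⟩
    · obtain ⟨⟨i, x⟩, h⟩ := hb.2 ⟨j, y⟩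
      obtain ⟨rfl, h⟩ := Sigma.mk.inj h
      exact ⟨⟨i, rfl⟩, x, eq_of_heq h⟩
    · rintro ⟨i, rfl⟩ ⟨i', hi'⟩ x x' h
      refine Subtype.ext (congrArg Sigma.fst (hb.1 (a₁ := ⟨i, x⟩) (a₂ := ⟨i', x'⟩) ?_))
      refine Eq.trans ?_ (sigma_eqToHom hi' _)
      exact congrArg (Sigma.mk (φ i)) h

lemma ι_eq_iff {A : SphFam S n k m} {I : Box k m.len} {i j : A.act I} {x y} :
    (A.ι I i).hom.left x = (A.ι I j).hom.left y ↔
      (⟨⟨i.1, i.2.1⟩, x⟩ : A.Pt) = ⟨⟨j.1, j.2.1⟩, y⟩ := by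
  constructor
  · intro h
    obtain rfl := ι_disjoint h
    rw [(A.isImm_ι I i).injective h]
  · intro h
    obtain ⟨i, hi⟩ := i
    obtain ⟨j, hj⟩ := j
    obtain ⟨h1, h2⟩ := Sigma.mk.inj h
    obtain rfl : i = j := congrArg Subtype.val h1
    rw [eq_of_heq h2]

/-- The map of coproducts induced by a map of families. -/
noncomputable def famMap {A B : SphFam S n k m} (g : (schAssembler S n).FamHom A B)
    (I : Box k m.len) : A.box I ⟶ B.box I :=
  copMap (fun i => ⟨(g.idxMap ⟨i.1, i.2.1⟩).1, label_active g i⟩) fun i => (g.hom ⟨i.1, i.2.1⟩).hom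

lemma ι_famMap {A B : SphFam S n k m} (g : (schAssembler S n).FamHom A B) (I : Box k m.len)
    (i : A.act I) : A.ι I i ≫ famMap g I =
      (g.hom ⟨i.1, i.2.1⟩).hom ≫ B.ι I ⟨(g.idxMap ⟨i.1, i.2.1⟩).1, label_active g i⟩ :=
  copι_copMap _ _ i

/-- The summands are immersed in the target, and the bijection on all points restricts to the active
members because labels are preserved. -/
lemma isPiecewiseIso_famMap {A B : SphFam S n k m} (g : (schAssembler S n).FamHom A B)
    (I : Box k m.len) : IsPiecewiseIso (famMap g I).hom.left := by
  have hb := ptMap_bijective g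
  have := (A.act_finite I).to_subtype
  refine isPiecewiseIso_of_cover (famMap g I) ?_ _ (A.ι I) (fun i => ?_) fun y => ?_
  · intro p q h
    obtain ⟨i, x, rfl⟩ := ι_surjective p
    obtain ⟨j, y, rfl⟩ := ι_surjective q
    have e1 := apply_eq_of_eq (ι_famMap g I i) x
    have e2 := apply_eq_of_eq (ι_famMap g I j) y
    exact ι_eq_iff.2 (hb.1 (ι_eq_iff.1 (e1.symm.trans (h.trans e2))))
  · rw [ι_famMap]
    exact IsImm.comp (g.hom _).property (B.isImm_ι _ _)
  · obtain ⟨j, y, rfl⟩ := ι_surjective y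
    obtain ⟨⟨i, x⟩, h⟩ := hb.2 ⟨⟨j.1, j.2.1⟩, y⟩
    have hi : i.1 ∈ A.act I := ⟨i.2, by
      have h1 : g.idxMap i = ⟨j.1, j.2.1⟩ := congrArg Sigma.fst h
      have h2 := g.label_eq i
      rw [h1] at h2
      exact h2 ▸ j.2.2⟩
    refine ⟨⟨i.1, hi⟩, x, ?_⟩
    exact (apply_eq_of_eq (ι_famMap g I ⟨i.1, hi⟩) x).trans (ι_eq_iff.2 h)

lemma famMap_naturality {A B : SphFam S n k m} (g : (schAssembler S n).FamHom A B)
    {I J : Box k m.len} (h : I ≤ J) : A.boxHom h ≫ famMap g J = famMap g I ≫ B.boxHom h := by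
  refine box_hom_ext fun i => ?_
  rw [← Category.assoc, ι_boxHom, ι_famMap, ← Category.assoc, ι_famMap, Category.assoc, ι_boxHom]

lemma famMap_id (A : (schAssembler S n).W (Sphere k m) (Sphere.base k m)) (I : Box k m.len) :
    famMap (𝟙 A) I = 𝟙 (SphFam.box A I) :=
  box_hom_ext fun i =>
    ((ι_famMap (𝟙 A) I i).trans (Category.id_comp _)).trans (Category.comp_id _).symm

lemma famMap_comp {A B C : (schAssembler S n).W (Sphere k m) (Sphere.base k m)} (f : A ⟶ B)
    (g : B ⟶ C) (I : Box k m.len) : famMap (f ≫ g) I = famMap f I ≫ famMap g I :=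
  box_hom_ext fun i => (ι_famMap (f ≫ g) I i).trans (Eq.symm
    ((Category.assoc _ _ _).symm.trans ((congrArg (· ≫ famMap g I) (ι_famMap f I i)).trans
      ((Category.assoc _ _ _).trans ((congrArg (_ ≫ ·) (ι_famMap g I ⟨_, label_active f i⟩)).trans
        (Category.assoc _ _ _).symm)))))

end SphFam

open SphFam

variable [AlgebraicGeometry.IsNoetherian S]

/-- The comparison functor from labelled families to the iterated `S`-construction. -/
noncomputable def comparison (S : Scheme.{u}) [AlgebraicGeometry.IsNoetherian S] (n : ℕ∞) (k : ℕ)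
    (m : SimplexCategory) :
    (schAssembler S n).W (Sphere k m) (Sphere.base k m) ⥤ (schSW S n).SObj k m.len where
  obj A := SphFam.diagram A
  map {A B} g :=
    { nat :=
        { app := SphFam.famMap g
          naturality := fun I J h => SphFam.famMap_naturality g h.le }
      weq := SphFam.isPiecewiseIso_famMap g }
  map_id A := SWData.SObj.hom_ext _ fun I => SphFam.famMap_id A I
  map_comp f g := SWData.SObj.hom_ext _ fun I => SphFam.famMap_comp f g I

/-! ### Strict compatibility of the comparison with the spectrum structure -/

lemma sFunctor_ext {C : Type*} [Category C] {D : Type*} [Category D] {W : SWData D} {k m : ℕ}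
    {F G : C ⥤ W.SObj k m}
    (h0 : ∀ x I, (F.obj x).toFunctor.obj I = (G.obj x).toFunctor.obj I)
    (h1 : ∀ x {I J} (h : I ⟶ J), HEq ((F.obj x).toFunctor.map h) ((G.obj x).toFunctor.map h))
    (h2 : ∀ {x y} (f : x ⟶ y) I,
      HEq ((SWData.SHom.nat (F.map f)).app I) ((SWData.SHom.nat (G.map f)).app I)) : F = G := by
  have ho : F.obj = G.obj := funext fun x => SWData.SObj.ext' _
    (Functor.hext (h0 x) fun I J h => h1 x h)
  obtain ⟨Fo, Fm, _, _⟩ := F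
  obtain ⟨Go, Gm, _, _⟩ := G
  obtain rfl : Fo = Go := ho
  obtain rfl : @Fm = @Gm := by
    funext x y f
    exact SWData.SObj.hom_ext _ fun I => eq_of_heq (h2 f I)
  rfl

/-- A label `x` is active at the image of `I` under `θ` exactly if `θ ≫ x` is active at `I`. Members
deleted on the assembler side have base labels, which are never active, so both sides are coproducts
over the same index sets. -/
lemma comparison_restrict {m m' : SimplexCategory} (θ : m ⟶ m') :
    comparison S n k m' ⋙ (schSW S n).restrict k θ =
      (schAssembler S n).wMap (Sphere.map k θ) ⋙ comparison S n k m := by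
  have hact (A : SphFam S n k m') (I : Box k m.len) : A.act ((boxMap k θ).obj I) =
      SphFam.act (((schAssembler S n).wMap (B' := Sphere.base k m) (Sphere.map k θ)).obj A) I :=
    Set.ext fun i => ⟨fun h => ⟨⟨h.1, Active.notMem_base (I := I) h.2⟩, h.2⟩,
      fun h => ⟨h.1.1, h.2⟩⟩
  refine sFunctor_ext (fun A I => ?_) (fun A I J h => ?_) fun {A B} g I => ?_
  · exact cop_congr (hT := SphFam.act_finite A _) (hU := SphFam.act_finite _ I) (hact A I) fun _ _ _ => rfl
  · exact copMap_heq (hact A I) (fun _ _ _ => rfl) (hact A J) (fun _ _ _ => rfl)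
      (fun _ _ _ => rfl) fun _ _ _ => HEq.rfl
  · exact copMap_heq (hact A I) (fun _ _ _ => rfl) (hact B I) (fun _ _ _ => rfl)
      (fun _ _ _ => rfl) fun _ _ _ => HEq.rfl

lemma SWData.heq_of_eq_zero {C : Type*} [Category C] (D : SWData C) {A B A' B' : C} (hA : A = D.zero)
    (hA' : A' = D.zero) (hB : B = B') (f : A ⟶ B) (g : A' ⟶ B') : HEq f g := by
  subst hB hA
  subst hA'
  exact heq_of_eq (D.isInitial.hom_ext f g)

lemma comparison_pt (m : SimplexCategory) :
    (comparison S n k m).obj ((schAssembler S n).wPt _ _) = (schSW S n).sPt k m.len := by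
  let A : SphFam S n k m := (schAssembler S n).wPt _ _
  have h0 (I : Box k m.len) : A.box I = (schSW S n).zero :=
    cop_eq_empty (hT := A.act_finite I) (Set.eq_empty_of_forall_notMem fun i hi => hi.1.elim)
  exact SWData.SObj.ext' _ (Functor.hext h0 fun I J h =>
    (schSW S n).heq_of_eq_zero (h0 I) rfl (h0 J) _ _)

lemma active_smash {s : m ⟶ SimplexCategory.mk 1} {x : Sphere k m} {I : Box (k + 1) m.len} :
    Active (Sphere.smash s x) I ↔ SWData.IsActive s I ∧ Active x I.tail := by
  constructor
  · exact fun h => ⟨h 0, fun a => h a.succ⟩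
  · rintro ⟨h1, h2⟩ a
    induction a using Fin.cases with
    | zero => exact h1
    | succ a => exact h2 a

/-- The label `Sphere.smash s x` is active at `I` exactly if `s` is active on the first interval and
`x` on the remaining ones. Where `s` is inactive both sides are the chosen initial object. -/
lemma comparison_susp (s : m ⟶ SimplexCategory.mk 1) :
    comparison S n k m ⋙ (schSW S n).suspSFunctor s =
      (schAssembler S n).wMap (Sphere.smash s) ⋙ comparison S n (k + 1) m := by
  let F (A : SphFam S n k m) : SphFam S n (k + 1) m :=
    ((schAssembler S n).wMap (B' := Sphere.base (k + 1) m) (Sphere.smash s)).obj A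
  have hact (A : SphFam S n k m) (I : Box (k + 1) m.len) (hI : SWData.IsActive s I) :
      A.act I.tail = (F A).act I :=
    Set.ext fun i => ⟨fun h => ⟨⟨h.1, Active.notMem_base (I := I) (active_smash.2 ⟨hI, h.2⟩)⟩,
      active_smash.2 ⟨hI, h.2⟩⟩, fun h => ⟨h.1.1, (active_smash.1 h.2).2⟩⟩
  have hpos (A : SphFam S n k m) (I : Box (k + 1) m.len) (hI : SWData.IsActive s I) :
      A.box I.tail = (F A).box I := cop_congr (hact A I hI) fun _ _ _ => rfl
  have hneg (A : SphFam S n k m) (I : Box (k + 1) m.len) (hI : ¬ SWData.IsActive s I) :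
      (F A).box I = (schSW S n).zero :=
    cop_eq_empty (hT := (F A).act_finite I) (Set.eq_empty_of_forall_notMem fun i hi =>
      hI (active_smash.1 hi.2).1)
  have hobj (A : SphFam S n k m) (I : Box (k + 1) m.len) :
      (schSW S n).suspObj s A.diagram.toFunctor I = (F A).box I := by
    by_cases hI : SWData.IsActive s I
    · exact ((schSW S n).suspObj_pos s _ hI).trans (hpos A I hI)
    · exact ((schSW S n).suspObj_neg s _ hI).trans (hneg A I hI).symm
  refine sFunctor_ext hobj (fun A I J h => ?_) fun {A B} g I => ?_
  · change HEq ((schSW S n).suspMap s (SphFam.diagram A).toFunctor h.le) _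
    by_cases hI : SWData.IsActive s I
    · rw [SWData.suspMap_pos _ _ _ _ hI]
      refine (eqToHom_comp_heq _ _).trans ((comp_eqToHom_heq _ _).trans ?_)
      exact copMap_heq (hact A I hI) (fun _ _ _ => rfl) (hact A J (hI.mono h.le))
        (fun _ _ _ => rfl) (fun _ _ _ => rfl) fun _ _ _ => HEq.rfl
    · exact (schSW S n).heq_of_eq_zero ((schSW S n).suspObj_neg s _ hI) (hneg A I hI)
        (hobj A J) _ _
  · change HEq ((schSW S n).suspApp s _ I) _
    by_cases hI : SWData.IsActive s I
    · rw [SWData.suspApp_pos _ _ _ hI]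
      refine (eqToHom_comp_heq _ _).trans ((comp_eqToHom_heq _ _).trans ?_)
      exact copMap_heq (hact A I hI) (fun _ _ _ => rfl) (hact B I hI)
        (fun _ _ _ => rfl) (fun _ _ _ => rfl) fun _ _ _ => HEq.rfl
    · exact (schSW S n).heq_of_eq_zero ((schSW S n).suspObj_neg s _ hI) (hneg A I hI)
        (hobj B I) _ _

end

end KTheory

namespace KTheory

open CategoryTheory Limits Opposite

open AlgebraicGeometry AssemblerData

/-! ### Maps of spectra from functors -/

section

open Simplicial

variable {T U : SimplicialCatSpectrum.{v, u}} (F : ∀ k m, (T.cat k).obj m ⥤ (U.cat k).obj m)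

/-- The map of levelwise nerves induced by compatible functors. -/
def nerveNatTrans (k : ℕ)
    (hF : ∀ {m m' : SimplexCategoryᵒᵖ} (θ : m ⟶ m'), F k m ⋙ ((U.cat k).map θ).toFunctor =
      ((T.cat k).map θ).toFunctor ⋙ F k m') :
    T.cat k ⋙ nerveFunctor ⟶ U.cat k ⋙ nerveFunctor where
  app m := nerveMap (F k m)
  naturality m m' θ := congrArg nerveMap (hF θ).symm

/-- The map of spectra induced by functors that are compatible with the simplicial structure, the base
points and the structure functors. -/
def spectrumHom
    (hF : ∀ k {m m' : SimplexCategoryᵒᵖ} (θ : m ⟶ m'), F k m ⋙ ((U.cat k).map θ).toFunctor =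
      ((T.cat k).map θ).toFunctor ⋙ F k m')
    (hpt : ∀ k m, (F k m).obj (T.pt k m) = U.pt k m)
    (hsusp : ∀ k {m : SimplexCategoryᵒᵖ} (s : m.unop ⟶ ⦋1⦌),
      F k m ⋙ U.susp k s = T.susp k s ⋙ F (k + 1) m) :
    T.toSpectrum.Hom U.toSpectrum where
  map k := diagMap (nerveNatTrans F k (hF k))
  map_pt k m := const_comp_eq (J := Fin (m.unop.len + 1)) (F k m) (hpt k m)
  map_susp k m s x :=
    congrArg (fun G => Functor.comp (C := Fin (m.unop.len + 1)) x G) (hsusp k s).symm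

end

/-- Theorem A applies in every simplicial degree, and the realization lemma then applies to the
diagonals. The map goes from the assembler spectrum to the Waldhausen one, so the zigzag has one
reversed arrow. -/
lemma levelEquivalent_of_comparison (S : Scheme.{u}) [AlgebraicGeometry.IsNoetherian S] (n : ℕ∞)
    (h : ∀ k m (Y : (schSW S n).SObj k m.len),
      WContr (nerve (CostructuredArrow (comparison S n k m) Y))) :
    Spectrum.LevelEquivalent (schSW S n).kSpectrum.toSpectrum
      (schAssembler S n).kSpectrum.toSpectrum :=
  Relation.EqvGen.symm _ _ (Relation.EqvGen.rel _ _
    ⟨spectrumHom (T := (schAssembler S n).kSpectrum) (U := (schSW S n).kSpectrum)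
      (fun k m => comparison S n k m.unop) (fun _ _ _ θ => comparison_restrict θ.unop)
      (fun _ m => comparison_pt m.unop) (fun _ _ s => comparison_susp s),
    fun k => isWeakEquiv_diagMap fun m => isWeakEquiv_nerveMap _ (h k m.unop)⟩)

end KTheory

namespace KTheory

open CategoryTheory Limits Opposite

open AlgebraicGeometry AssemblerData

/-! ### The pieces of a diagram -/

/-- The largest box. -/
def topBox (k m : ℕ) : Box k m := fun _ => ⟨(0, Fin.last m), Fin.zero_le _⟩

lemma le_topBox {k m : ℕ} (I : Box k m) : I ≤ topBox k m :=
  fun _ => ⟨Fin.zero_le _, Fin.le_last _⟩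

/-- Replace one of the intervals of a box. -/
def setBox {k m : ℕ} (Q : Box k m) (a : Fin k) (J : NonemptyInterval (Fin (m + 1))) : Box k m :=
  Function.update (β := fun _ => NonemptyInterval (Fin (m + 1))) Q a J

lemma setBox_self {k m : ℕ} (Q : Box k m) (a : Fin k) (J : NonemptyInterval (Fin (m + 1))) :
    setBox Q a J a = J :=
  Function.update_self _ _ _

lemma setBox_of_ne {k m : ℕ} (Q : Box k m) {a b : Fin k} (h : b ≠ a)
    (J : NonemptyInterval (Fin (m + 1))) : setBox Q a J b = Q b :=
  Function.update_of_ne h _ _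

lemma setBox_mono {k m : ℕ} {Q Q' : Box k m} (h : Q ≤ Q') (a : Fin k)
    {J J' : NonemptyInterval (Fin (m + 1))} (hJ : J ≤ J') : setBox Q a J ≤ setBox Q' a J' := by
  intro b
  by_cases hb : b = a
  · subst hb
    rw [setBox_self, setBox_self]
    exact hJ
  · rw [setBox_of_ne _ hb, setBox_of_ne _ hb]
    exact h b

lemma setBox_le {k m : ℕ} {Q Q' : Box k m} (h : Q ≤ Q') (a : Fin k)
    {J : NonemptyInterval (Fin (m + 1))} (hJ : J ≤ Q' a) : setBox Q a J ≤ Q' := by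
  have := setBox_mono h a hJ
  rwa [show setBox Q' a (Q' a) = Q' from Function.update_eq_self _ _] at this

lemma le_setBox {k m : ℕ} {Q Q' : Box k m} (h : Q ≤ Q') (a : Fin k)
    {J : NonemptyInterval (Fin (m + 1))} (hJ : Q a ≤ J) : Q ≤ setBox Q' a J := by
  have := setBox_mono h a hJ
  rwa [show setBox Q a (Q a) = Q from Function.update_eq_self _ _] at this

/-- The boxes that are full in all coordinates but one, where they are `[c, m]`. -/
def highSlab {k m : ℕ} (a : Fin k) (c : Fin (m + 1)) : Box k m :=
  setBox (topBox k m) a ⟨(c, Fin.last m), Fin.le_last c⟩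

/-- The boxes that are full in all coordinates but one, where they are `[0, c]`. -/
def lowSlab {k m : ℕ} (a : Fin k) (c : Fin (m + 1)) : Box k m :=
  setBox (topBox k m) a ⟨(0, c), Fin.zero_le c⟩

section

variable {k : ℕ} {m : SimplexCategory}

lemma apply_zero_of_notMem_base {x : Sphere k m} (hx : x ∉ Sphere.base k m) (a : Fin k) :
    (x a).toOrderHom 0 = 0 ∧ (x a).toOrderHom (Fin.last _) = 1 := by
  have h1 (c) : (x a).toOrderHom 0 ≤ (x a).toOrderHom c := (x a).toOrderHom.monotone (Fin.zero_le c)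
  have h2 (c) : (x a).toOrderHom c ≤ (x a).toOrderHom (Fin.last _) :=
    (x a).toOrderHom.monotone (Fin.le_last c)
  constructor
  · refine (eq_zero_or_one _).resolve_right fun h => hx ⟨a, ?_⟩
    have h3 (c) : (x a).toOrderHom c = 1 := by
      have := h1 c
      rw [h] at this
      exact le_antisymm (Fin.le_last _) this
    exact fun i j => (h3 i).trans (h3 j).symm
  · refine (eq_zero_or_one _).resolve_left fun h => hx ⟨a, ?_⟩
    have h3 (c) : (x a).toOrderHom c = 0 := by
      have := h2 c
      rw [h] at this
      exact le_antisymm this (Fin.zero_le _)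
    exact fun i j => (h3 i).trans (h3 j).symm

lemma active_topBox {x : Sphere k m} (hx : x ∉ Sphere.base k m) : Active x (topBox k m.len) :=
  apply_zero_of_notMem_base hx

lemma active_highSlab_iff {x : Sphere k m} (hx : x ∉ Sphere.base k m) (a : Fin k)
    (c : Fin (m.len + 1)) : Active x (highSlab a c) ↔ (x a).toOrderHom c = 0 := by
  constructor
  · intro h
    have := (h a).1
    rwa [highSlab, setBox_self] at this
  · intro h b
    by_cases hb : b = a
    · subst hb
      rw [highSlab, setBox_self]
      exact ⟨h, (apply_zero_of_notMem_base hx b).2⟩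
    · rw [highSlab, setBox_of_ne _ hb]
      exact apply_zero_of_notMem_base hx b

/-- A simplex of the sphere is determined by the boxes at which it is active. -/
lemma sphere_ext {x y : Sphere k m} (hx : x ∉ Sphere.base k m) (hy : y ∉ Sphere.base k m)
    (h : ∀ I, Active x I ↔ Active y I) : x = y := by
  funext a
  ext c : 3
  have := h (highSlab a c)
  rw [active_highSlab_iff hx, active_highSlab_iff hy] at this
  rcases eq_zero_or_one ((x a).toOrderHom c) with h1 | h1
  · exact h1.trans (this.1 h1).symm
  · rcases eq_zero_or_one ((y a).toOrderHom c) with h2 | h2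
    · exact absurd ((this.2 h2).symm.trans h1) (by decide)
    · exact h1.trans h2.symm

end

namespace SWData.SObj

variable {S : Scheme.{u}} {n : ℕ∞} {k m : ℕ} (Y : (schSW S n).SObj k m)

/-- The total scheme of a diagram. -/
def total : Sch S n := Y.toFunctor.obj (topBox k m)

/-- The map to the total scheme. -/
def incl (I : Box k m) : Y.toFunctor.obj I ⟶ Y.total := Y.toFunctor.map (homOfLE (le_topBox I))

lemma map_incl {I J : Box k m} (h : I ≤ J) : Y.toFunctor.map (homOfLE h) ≫ Y.incl J = Y.incl I :=
  (Y.toFunctor.map_comp _ _).symm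

/-- The image in the total scheme. -/
def rng (I : Box k m) : Set Y.total.obj.left := Set.range (Y.incl I).hom.left

lemma rng_mono {I J : Box k m} (h : I ≤ J) : Y.rng I ⊆ Y.rng J := by
  rintro _ ⟨x, rfl⟩
  exact ⟨_, apply_eq_of_eq (Y.map_incl h) x⟩

lemma isSub_cut (Q : Box k m) (a : Fin k) (c : Fin (m + 1)) (h1 : (Q a).fst ≤ c)
    (h2 : c ≤ (Q a).snd) :
    IsSubtraction
      (Y.toFunctor.map (homOfLE (setBox_le (le_refl Q) a (J := ⟨((Q a).fst, c), h1⟩)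
        ⟨le_refl _, h2⟩)))
      (Y.toFunctor.map (homOfLE (setBox_le (le_refl Q) a (J := ⟨(c, (Q a).snd), h2⟩)
        ⟨h1, le_refl _⟩))) := by
  refine Y.isSub a _ _ _ _ _ (fun b hb => ⟨setBox_of_ne _ hb _, setBox_of_ne _ hb _⟩) ?_ ?_ ?_ <;>
    simp only [setBox_self]

lemma rng_cut (Q : Box k m) (a : Fin k) (c : Fin (m + 1)) (h1 : (Q a).fst ≤ c)
    (h2 : c ≤ (Q a).snd) {y} (hy : y ∈ Y.rng Q) :
    y ∈ Y.rng (setBox Q a ⟨((Q a).fst, c), h1⟩) ∨ y ∈ Y.rng (setBox Q a ⟨(c, (Q a).snd), h2⟩) := by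
  obtain ⟨x, rfl⟩ := hy
  have h := Y.isSub_cut Q a c h1 h2
  by_cases hx : x ∈ Set.range (Y.toFunctor.map (homOfLE (setBox_le (le_refl Q) a
      (J := ⟨((Q a).fst, c), h1⟩) ⟨le_refl _, h2⟩))).hom.left
  · obtain ⟨z, rfl⟩ := hx
    exact Or.inl ⟨z, (apply_eq_of_eq (Y.map_incl _) z).symm⟩
  · obtain ⟨z, rfl⟩ := h.2.2.ge hx
    exact Or.inr ⟨z, (apply_eq_of_eq (Y.map_incl _) z).symm⟩

lemma isImm_cut (Q : Box k m) (a : Fin k) (c : Fin (m + 1)) (h1 : (Q a).fst ≤ c)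
    (h2 : c ≤ (Q a).snd) (hQ : IsImm (Y.incl Q)) :
    IsImm (Y.incl (setBox Q a ⟨((Q a).fst, c), h1⟩)) ∧
      IsImm (Y.incl (setBox Q a ⟨(c, (Q a).snd), h2⟩)) := by
  have h := Y.isSub_cut Q a c h1 h2
  have i1 := h.1
  have i2 := h.2.1
  constructor
  · rw [← Y.map_incl (setBox_le (le_refl Q) a (J := ⟨((Q a).fst, c), h1⟩) ⟨le_refl _, h2⟩)]
    exact IsImm.comp (IsImmersion.instOfIsClosedImmersion _) hQ
  · rw [← Y.map_incl (setBox_le (le_refl Q) a (J := ⟨(c, (Q a).snd), h2⟩) ⟨h1, le_refl _⟩)]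
    exact IsImm.comp (IsImmersion.instOfIsOpenImmersion _) hQ

lemma mem_highSlab_iff (a : Fin k) (c : Fin (m + 1)) (y : Y.total.obj.left) :
    y ∈ Y.rng (highSlab a c) ↔ y ∉ Y.rng (lowSlab a c) := by
  have h := (Y.isSub_cut (topBox k m) a c (Fin.zero_le _) (Fin.le_last _)).2.2
  exact Set.ext_iff.1 h y

lemma isClosed_rng_lowSlab (a : Fin k) (c : Fin (m + 1)) : IsClosed (Y.rng (lowSlab a c)) := by
  have : IsClosedImmersion (Y.incl (lowSlab a c)).hom.left :=
    (Y.isSub_cut (topBox k m) a c (Fin.zero_le _) (Fin.le_last _)).1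
  exact (Y.incl (lowSlab a c)).hom.left.isClosedEmbedding.isClosed_range

/-- The intervals of `I` in the coordinates in `s`, and full intervals in the other ones. -/
def partialBox (I : Box k m) (s : Finset (Fin k)) : Box k m :=
  fun a => if a ∈ s then I a else topBox k m a

lemma partialBox_insert (I : Box k m) (s : Finset (Fin k)) (a : Fin k) :
    partialBox I (insert a s) = setBox (partialBox I s) a (I a) := by
  funext b
  by_cases hb : b = a
  · subst hb
    rw [setBox_self, partialBox, if_pos (Finset.mem_insert_self _ _)]
  · rw [setBox_of_ne _ hb, partialBox, partialBox]
    simp only [Finset.mem_insert, hb, false_or]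

lemma setBox_setBox (Q : Box k m) (a : Fin k) (J J' : NonemptyInterval (Fin (m + 1))) :
    setBox (setBox Q a J) a J' = setBox Q a J' :=
  Function.update_idem _ _ _

/-- Starting from the total scheme, one coordinate at a time is shrunk from the full interval to
that of `I`. This takes two cuts, each a subtraction sequence, so immersions and the description of
points are passed along. -/
lemma partialBox_spec (I : Box k m) (s : Finset (Fin k)) : IsImm (Y.incl (partialBox I s)) ∧
    ∀ y, (∀ a ∈ s, y ∈ Y.rng (highSlab a (I a).fst) ∧ y ∉ Y.rng (highSlab a (I a).snd)) →
      y ∈ Y.rng (partialBox I s) := by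
  classical
  induction s using Finset.induction_on with
  | empty =>
    have h : Y.incl (topBox k m) = 𝟙 _ := Y.toFunctor.map_id _
    have e : partialBox I ∅ = topBox k m := funext fun a => if_neg (Finset.notMem_empty a)
    rw [e, rng, h]
    exact ⟨IsImm.id _, fun y _ => ⟨y, rfl⟩⟩
  | insert a s ha ih =>
    rw [partialBox_insert]
    set Q := partialBox I s with hQ
    have hQa : Q a = topBox k m a := if_neg ha
    have f1 : (Q a).fst ≤ (I a).fst := by rw [hQa]; exact Fin.zero_le _
    have f2 : (I a).fst ≤ (Q a).snd := by rw [hQa]; exact Fin.le_last _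
    -- The intermediate box after cutting off the part of the interval left of `I a`; the second cut
    -- removes the part to the right.
    let R := setBox Q a ⟨((I a).fst, (Q a).snd), f2⟩
    have hRa : R a = ⟨((I a).fst, (Q a).snd), f2⟩ := setBox_self _ _ _
    have g1 : (R a).fst ≤ (I a).snd := by rw [hRa]; exact (I a).fst_le_snd
    have g2 : (I a).snd ≤ (R a).snd := by
      rw [hRa]
      change _ ≤ (Q a).snd
      rw [hQa]
      exact Fin.le_last _
    have hfin : setBox R a ⟨((R a).fst, (I a).snd), g1⟩ = setBox Q a (I a) := by
      rw [setBox_setBox]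
      congr 1
      ext <;> simp [hRa]
    have i1 := (Y.isImm_cut Q a (I a).fst f1 f2 ih.1).2
    have i2 := (Y.isImm_cut R a (I a).snd g1 g2 i1).1
    rw [hfin] at i2
    refine ⟨i2, fun y hy => ?_⟩
    have hya := hy a (Finset.mem_insert_self a s)
    have hyQ := ih.2 y fun b hb => hy b (Finset.mem_insert_of_mem hb)
    have hyR : y ∈ Y.rng R := by
      refine (Y.rng_cut Q a (I a).fst f1 f2 hyQ).resolve_left fun h => ?_
      refine (Y.mem_highSlab_iff a _ y).1 hya.1 (Y.rng_mono (setBox_mono (le_topBox Q) a ?_) h)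
      exact ⟨Fin.zero_le _, le_refl _⟩
    have := (Y.rng_cut R a (I a).snd g1 g2 hyR).resolve_right fun h => ?_
    · rwa [hfin] at this
    · refine hya.2 (Y.rng_mono (setBox_mono (le_topBox R) a ?_) h)
      exact ⟨le_refl _, Fin.le_last _⟩

lemma partialBox_univ (I : Box k m) : partialBox I Finset.univ = I :=
  funext fun a => if_pos (Finset.mem_univ a)

lemma isImm_incl (I : Box k m) : IsImm (Y.incl I) := by
  have := (Y.partialBox_spec I Finset.univ).1
  rwa [partialBox_univ] at this

/-- Each coordinate contributes its own two cuts of the total scheme. So the slabs, finitely many,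
decide which `Y_I` contain a point, and the answer has the shape of activity of a simplex of the
sphere. -/
lemma mem_rng_iff (I : Box k m) (y : Y.total.obj.left) :
    y ∈ Y.rng I ↔ ∀ a, y ∈ Y.rng (highSlab a (I a).fst) ∧ y ∉ Y.rng (highSlab a (I a).snd) := by
  constructor
  · intro hy a
    refine ⟨Y.rng_mono (le_setBox (le_topBox I) a
      (J := ⟨((I a).fst, Fin.last m), Fin.le_last _⟩) ⟨le_refl _, Fin.le_last _⟩) hy, ?_⟩
    rw [mem_highSlab_iff, not_not]
    exact Y.rng_mono (le_setBox (le_topBox I) a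
      (J := ⟨(0, (I a).snd), Fin.zero_le _⟩) ⟨Fin.zero_le _, le_refl _⟩) hy
  · intro h
    have := (Y.partialBox_spec I Finset.univ).2 y fun a _ => h a
    rwa [partialBox_univ] at this

end SWData.SObj

end KTheory

namespace KTheory

open CategoryTheory Limits Opposite

open AlgebraicGeometry AssemblerData

/-! ### Stratifications of a diagram -/

lemma SphFam.exists_box_desc {S : Scheme.{u}} {n : ℕ∞} {k : ℕ} {m : SimplexCategory}
    [AlgebraicGeometry.IsNoetherian S] {A : SphFam S n k m} {I : Box k m.len} {Y : Sch S n}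
    (f : ∀ i : A.act I, A.sch ⟨i.1, i.2.1⟩ ⟶ Y) : ∃ g : A.box I ⟶ Y, ∀ i, A.ι I i ≫ g = f i :=
  exists_desc f

lemma highSlab_anti {k m : ℕ} (a : Fin k) {c d : Fin (m + 1)} (h : c ≤ d) :
    highSlab a d ≤ highSlab a c := by
  refine setBox_mono (le_refl (topBox k m)) a ?_
  exact ⟨h, le_refl (Fin.last m)⟩

section

variable {S : Scheme.{u}} {n : ℕ∞} {k : ℕ} {m : SimplexCategory} (Y : (schSW S n).SObj k m.len)

open Classical in
/-- The simplex of the sphere that is active at exactly those boxes whose scheme contains the given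
point. -/
noncomputable def sphereOf (y : Y.total.obj.left) : Sphere k m := fun a =>
  SimplexCategory.Hom.mk (b := SimplexCategory.mk 1)
    ⟨fun c => if y ∈ Y.rng (highSlab a c) then 0 else 1, fun c d hcd => by
      by_cases hd : y ∈ Y.rng (highSlab a d)
      · have hc : y ∈ Y.rng (highSlab a c) :=
          Y.rng_mono (highSlab_anti a hcd) hd
        beta_reduce
        rw [if_pos hd, if_pos hc]
      · beta_reduce
        rw [if_neg hd]
        exact Fin.le_last _⟩

lemma sphereOf_apply_eq_zero_iff (y : Y.total.obj.left) (a : Fin k) (c : Fin (m.len + 1)) :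
    (sphereOf Y y a).toOrderHom c = 0 ↔ y ∈ Y.rng (highSlab a c) := by
  classical
  change (if y ∈ Y.rng (highSlab a c) then (0 : Fin 2) else 1) = 0 ↔ _
  split_ifs with h
  · exact iff_of_true rfl h
  · exact iff_of_false (by decide) h

lemma sphereOf_apply_eq_one_iff (y : Y.total.obj.left) (a : Fin k) (c : Fin (m.len + 1)) :
    (sphereOf Y y a).toOrderHom c = 1 ↔ y ∉ Y.rng (highSlab a c) := by
  classical
  change (if y ∈ Y.rng (highSlab a c) then (0 : Fin 2) else 1) = 1 ↔ _
  split_ifs with h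
  · exact iff_of_false (by decide) (not_not.2 h)
  · exact iff_of_true rfl h

lemma active_sphereOf_iff (y : Y.total.obj.left) (I : Box k m.len) :
    Active (sphereOf Y y) I ↔ y ∈ Y.rng I := by
  rw [Y.mem_rng_iff]
  exact forall_congr' fun a =>
    and_congr (sphereOf_apply_eq_zero_iff Y y a _) (sphereOf_apply_eq_one_iff Y y a _)

lemma mem_rng_topBox (y : Y.total.obj.left) : y ∈ Y.rng (topBox k m.len) :=
  ⟨y, apply_eq_of_eq (Y.toFunctor.map_id _) y⟩

lemma sphereOf_notMem_base (y : Y.total.obj.left) : sphereOf Y y ∉ Sphere.base k m :=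
  Active.notMem_base ((active_sphereOf_iff Y y _).2 (mem_rng_topBox Y y))

/-- A finite filtration of the total scheme by closed subsets on whose strata the associated simplex of
the sphere is constant. -/
structure Strat where
  bound : ℕ
  r : Y.total.obj.left → ℕ
  r_lt : ∀ y, r y < bound
  isClosed : ∀ i, IsClosed {y | r y < i}
  sphereOf_eq : ∀ y z, r y = r z → sphereOf Y y = sphereOf Y z

/-- The associated simplex depends only on membership in the finitely many low slabs, which are
closed; a filtration that cuts none of them works. -/
lemma exists_strat : Nonempty (Strat Y) := by
  classical
  obtain ⟨N, r, h1, h2, h3⟩ := exists_filtration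
    (Finset.univ.image fun p : Fin k × Fin (m.len + 1) => Y.rng (lowSlab p.1 p.2)) (by
      intro K hK
      obtain ⟨p, -, rfl⟩ := Finset.mem_image.1 hK
      exact Y.isClosed_rng_lowSlab _ _)
  refine ⟨⟨N, r, h1, h2, fun y z hyz => ?_⟩⟩
  refine sphere_ext (sphereOf_notMem_base Y y) (sphereOf_notMem_base Y z) fun I => ?_
  rw [active_sphereOf_iff, active_sphereOf_iff, Y.mem_rng_iff, Y.mem_rng_iff]
  have h (a : Fin k) (c : Fin (m.len + 1)) :
      y ∈ Y.rng (highSlab a c) ↔ z ∈ Y.rng (highSlab a c) := by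
    rw [Y.mem_highSlab_iff, Y.mem_highSlab_iff, not_iff_not]
    have hm : Y.rng (lowSlab a c) ∈ Finset.univ.image
        fun p : Fin k × Fin (m.len + 1) => Y.rng (lowSlab p.1 p.2) :=
      Finset.mem_image.2 ⟨(a, c), Finset.mem_univ _, rfl⟩
    exact ⟨h3 _ hm y z hyz, h3 _ hm z y hyz.symm⟩
  simp only [h]

namespace Strat

variable {Y} (st : Strat Y)

lemma isLocallyClosed_stratum (i : ℕ) : IsLocallyClosed {y | st.r y = i} := by
  have : {y | st.r y = i} = {y | st.r y < i}ᶜ ∩ {y | st.r y < i + 1} := by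
    ext y
    simp only [Set.mem_ofPred_eq, Set.mem_inter_iff, Set.mem_compl_iff]
    omega
  exact ⟨_, _, (st.isClosed i).isOpen_compl, st.isClosed (i + 1), this⟩

variable [AlgebraicGeometry.IsNoetherian S]

/-- The strata. -/
noncomputable def piece (i : ℕ) : Sch S n :=
  (exists_subSch Y.total (st.isLocallyClosed_stratum i)).choose

/-- The inclusions of the strata. -/
noncomputable def emb (i : ℕ) : st.piece i ⟶ Y.total :=
  (exists_subSch Y.total (st.isLocallyClosed_stratum i)).choose_spec.choose

lemma isImm_emb (i : ℕ) : IsImm (st.emb i) :=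
  (exists_subSch Y.total (st.isLocallyClosed_stratum i)).choose_spec.choose_spec.1

lemma range_emb (i : ℕ) : Set.range (st.emb i).hom.left = {y | st.r y = i} :=
  (exists_subSch Y.total (st.isLocallyClosed_stratum i)).choose_spec.choose_spec.2

lemma r_emb {i : ℕ} (x : (st.piece i).obj.left) : st.r ((st.emb i).hom.left x) = i :=
  (st.range_emb i).le ⟨x, rfl⟩

lemma exists_emb_eq (y : Y.total.obj.left) : ∃ x, (st.emb (st.r y)).hom.left x = y :=
  (st.range_emb (st.r y)).ge rfl

/-- The family of non-empty strata. -/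
noncomputable def fam : SphFam S n k m where
  idx := Set.range st.r
  finite := (Set.finite_Iio st.bound).subset (by
    rintro _ ⟨y, rfl⟩
    exact st.r_lt y)
  obj i := ⟨st.piece i.1⟩
  not_initial i := by
    rw [isEmpty_isInitial_iff]
    obtain ⟨_, y, rfl⟩ := i
    exact ⟨(st.exists_emb_eq y).choose⟩
  label i := sphereOf Y i.2.choose
  label_notMem i := sphereOf_notMem_base Y _

lemma label_eq (i : st.fam.idx) {y : Y.total.obj.left} (hy : st.r y = i.1) :
    st.fam.label i = sphereOf Y y :=
  st.sphereOf_eq _ _ (i.2.choose_spec.trans hy.symm)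

lemma exists_boxHom (I : Box k m.len) : ∃ g : st.fam.box I ⟶ Y.toFunctor.obj I,
    ∀ i, st.fam.ι I i ≫ g ≫ Y.incl I = st.emb i.1 := by
  have hl (i : st.fam.act I) : ∃ l : st.piece i.1 ⟶ Y.toFunctor.obj I,
      l ≫ Y.incl I = st.emb i.1 := by
    refine exists_lift _ (Y.isImm_incl I) ?_
    rintro _ ⟨x, rfl⟩
    refine (active_sphereOf_iff Y _ I).1 ?_
    rw [← st.label_eq ⟨i.1, i.2.1⟩ (st.r_emb x)]
    exact i.2.2
  choose l hl using hl
  obtain ⟨g, hg⟩ := SphFam.exists_box_desc (A := st.fam) l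
  refine ⟨g, fun i => ?_⟩
  rw [← Category.assoc, hg]
  exact hl i

/-- The map from the coproduct of the strata. -/
noncomputable def boxHom (I : Box k m.len) : st.fam.box I ⟶ Y.toFunctor.obj I :=
  (st.exists_boxHom I).choose

lemma ι_boxHom (I : Box k m.len) (i : st.fam.act I) :
    st.fam.ι I i ≫ st.boxHom I ≫ Y.incl I = st.emb i.1 :=
  (st.exists_boxHom I).choose_spec i

lemma boxHom_naturality {I J : Box k m.len} (h : I ≤ J) :
    st.fam.boxHom h ≫ st.boxHom J = st.boxHom I ≫ Y.toFunctor.map (homOfLE h) := by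
  refine SphFam.box_hom_ext fun i => (Y.isImm_incl J).eq_of_comp_eq ?_
  simp only [Category.assoc]
  rw [Y.map_incl, ι_boxHom, ← Category.assoc, SphFam.ι_boxHom]
  exact st.ι_boxHom J _

lemma isPiecewiseIso_boxHom (I : Box k m.len) : IsPiecewiseIso (st.boxHom I).hom.left := by
  have := (st.fam.act_finite I).to_subtype
  refine isPiecewiseIso_of_cover _ ?_ _ (st.fam.ι I) (fun i => ?_) fun y => ?_
  · intro p q h
    obtain ⟨i, x, rfl⟩ := SphFam.ι_surjective p
    obtain ⟨j, y, rfl⟩ := SphFam.ι_surjective q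
    have e1 := apply_eq_of_eq (st.ι_boxHom I i) x
    have e2 := apply_eq_of_eq (st.ι_boxHom I j) y
    have e := e1.symm.trans ((congrArg (Y.incl I).hom.left h).trans e2)
    have hij : i.1 = j.1 := (st.r_emb x).symm.trans ((congrArg st.r e).trans (st.r_emb y))
    obtain rfl : i = j := Subtype.ext hij
    rw [(st.isImm_emb i.1).injective e]
  · refine IsImm.of_comp (g := Y.incl I) ?_
    rw [Category.assoc, ι_boxHom]
    exact st.isImm_emb _
  · let z := (Y.incl I).hom.left y
    let i : st.fam.idx := ⟨st.r z, z, rfl⟩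
    have hi : i.1 ∈ st.fam.act I := ⟨i.2, by
      change Active (st.fam.label i) I
      rw [st.label_eq i (y := z) rfl, active_sphereOf_iff]
      exact ⟨y, rfl⟩⟩
    obtain ⟨x, hx⟩ := st.exists_emb_eq z
    refine ⟨⟨i.1, hi⟩, x, (Y.isImm_incl I).injective ?_⟩
    exact (apply_eq_of_eq (st.ι_boxHom I ⟨i.1, hi⟩) x).trans hx

/-- The family of strata over the diagram. -/
noncomputable def toDiagram : (comparison S n k m).obj st.fam ⟶ Y where
  nat :=
    { app := st.boxHom
      naturality := fun _ _ h => st.boxHom_naturality h.le }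
  weq := st.isPiecewiseIso_boxHom

end Strat

end

end KTheory

namespace KTheory

open CategoryTheory Limits Opposite

open AlgebraicGeometry AssemblerData

/-! ### The fibres of the comparison functor -/

lemma SphFam.mem_act_topBox {S : Scheme.{u}} {n : ℕ∞} {k : ℕ} {m : SimplexCategory}
    (A : SphFam S n k m) (i : A.idx) :
    i.1 ∈ A.act (topBox k m.len) :=
  ⟨i.2, active_topBox (A.label_notMem i)⟩

section

variable {S : Scheme.{u}} {n : ℕ∞} [AlgebraicGeometry.IsNoetherian S] {k : ℕ} {m : SimplexCategory}
  {Y : (schSW S n).SObj k m.len} {A : SphFam S n k m} (g : (schSW S n).SHom A.diagram Y)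

/-- The map from a member of the family to the total scheme. -/
noncomputable def leg (i : A.idx) : A.sch i ⟶ Y.total :=
  A.ι (topBox k m.len) ⟨i.1, A.mem_act_topBox i⟩ ≫ g.nat.app (topBox k m.len)

lemma ι_comp_app (I : Box k m.len) (i : A.act I) :
    A.ι I i ≫ g.nat.app I ≫ Y.incl I = leg g ⟨i.1, i.2.1⟩ := by
  have h : A.boxHom (le_topBox I) ≫ g.nat.app (topBox k m.len) = g.nat.app I ≫ Y.incl I :=
    g.nat.naturality (homOfLE (le_topBox I))
  have h' := congrArg (A.ι I i ≫ ·) h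
  refine h'.symm.trans ((Category.assoc _ _ _).symm.trans ?_)
  exact congrArg (· ≫ g.nat.app (topBox k m.len)) (A.ι_boxHom (le_topBox I) i)

/-- Non-base labels are active at the top box, so all members appear there, and the component at the
top box is a piecewise isomorphism, hence bijective. -/
lemma leg_bijective :
    Function.Bijective fun p : A.Pt => (leg g p.1).hom.left p.2 := by
  have hb := bijective_of_isPiecewiseIso _ (g.weq (topBox k m.len))
  constructor
  · rintro ⟨i, x⟩ ⟨j, y⟩ h
    exact SphFam.ι_eq_iff.1 (hb.1 h)
  · intro z
    obtain ⟨p, rfl⟩ := hb.2 z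
    obtain ⟨i, x, rfl⟩ := SphFam.ι_surjective p
    exact ⟨⟨⟨i.1, i.2.1⟩, x⟩, rfl⟩

lemma leg_mono {i : A.idx} {T : Sch S n} {a b : T ⟶ A.sch i} (h : a ≫ leg g i = b ≫ leg g i) :
    a = b := by
  refine (A.isImm_ι (topBox k m.len) ⟨i.1, A.mem_act_topBox i⟩).eq_of_comp_eq ?_
  refine eq_of_comp_isPiecewiseIso (g.weq (topBox k m.len)) ?_
  exact (Category.assoc _ _ _).trans (h.trans (Category.assoc _ _ _).symm)

/-- Components at all boxes are bijective and compatible with the legs, so a point of a member lands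
in `Y_I` exactly if its label is active at `I`. Labels are therefore forced by the diagram. -/
lemma sphereOf_leg (i : A.idx) (x : (A.sch i).obj.left) :
    sphereOf Y ((leg g i).hom.left x) = A.label i := by
  refine sphere_ext (sphereOf_notMem_base Y _) (A.label_notMem i) fun I => ?_
  rw [active_sphereOf_iff]
  constructor
  · rintro ⟨y, hy⟩
    obtain ⟨p, rfl⟩ := (bijective_of_isPiecewiseIso _ (g.weq I)).2 y
    obtain ⟨j, z, rfl⟩ := SphFam.ι_surjective p
    have e := (apply_eq_of_eq (ι_comp_app g I j) z).symm.trans hy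
    have hij := congrArg Sigma.fst ((leg_bijective g).1 (a₁ := ⟨⟨j.1, j.2.1⟩, z⟩)
      (a₂ := ⟨i, x⟩) e)
    have : A.label ⟨j.1, j.2.1⟩ = A.label i := congrArg A.label hij
    rw [← this]
    exact j.2.2
  · intro h
    exact ⟨_, apply_eq_of_eq (ι_comp_app g I ⟨i.1, i.2, h⟩) x⟩

/-- A leg need not be an immersion, since the component at the top box is only a piecewise
isomorphism. Intersecting its pieces with the summands gives immersed pieces of the total scheme
through which factorization over a leg can be read off from images. -/
lemma exists_finite_cover : ∃ (Q : Type) (_ : Finite Q) (T : Q → Set Y.total.obj.left)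
    (i : Q → A.idx), (∀ q, IsLocallyClosed (T q)) ∧ (∀ y, ∃ q, y ∈ T q) ∧
      (∀ q, T q ⊆ Set.range (leg g (i q)).hom.left) ∧
      ∀ q (V : Sch S n) (j : V ⟶ Y.total), Set.range j.hom.left ⊆ T q →
        ∃ b : V ⟶ A.sch (i q), b ≫ leg g (i q) = j := by
  obtain ⟨N, C, v, h1, h2, h3, -⟩ := exists_cover_of_isPiecewiseIso _ (g.weq (topBox k m.len))
  have hp (q : Fin N × A.act (topBox k m.len)) :=
    exists_pullback (v q.1) (A.isImm_ι (topBox k m.len) q.2)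
  choose W a b ha hab hra hb using hp
  have := (A.act_finite (topBox k m.len)).to_subtype
  let t (q) : W q ⟶ Y.total := a q ≫ v q.1 ≫ g.nat.app (topBox k m.len)
  have ht (q) : IsImm (t q) := (ha q).comp (h2 q.1)
  have hbt (q) : b q ≫ leg g ⟨q.2.1, q.2.2.1⟩ = t q := by
    refine (Category.assoc _ _ _).symm.trans (Eq.trans ?_ (Category.assoc _ _ _))
    exact congrArg (· ≫ g.nat.app (topBox k m.len)) (hab q).symm
  refine ⟨Fin N × A.act (topBox k m.len), inferInstance, fun q => Set.range (t q).hom.left,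
    fun q => ⟨q.2.1, q.2.2.1⟩, fun q => (ht q).isLocallyClosed, fun y => ?_, fun q => ?_,
    fun q V j hj => ?_⟩
  · obtain ⟨p, c, rfl⟩ := h3 y
    obtain ⟨i, x, hx⟩ := SphFam.ι_surjective ((v p).hom.left c)
    obtain ⟨w, hw⟩ := (hra (p, i)).ge ⟨x, hx⟩
    exact ⟨(p, i), w, congrArg (v p ≫ g.nat.app (topBox k m.len)).hom.left hw⟩
  · rintro _ ⟨w, rfl⟩
    exact ⟨_, apply_eq_of_eq (hbt q) w⟩
  · obtain ⟨l, hl⟩ := exists_lift j (ht q) hj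
    exact ⟨l ≫ b q, by rw [Category.assoc, hbt, hl]⟩

lemma Strat.emb_bijective (st : Strat Y) :
    Function.Bijective fun p : st.fam.Pt => (st.emb p.1.1).hom.left p.2 := by
  constructor
  · rintro ⟨i, x⟩ ⟨j, y⟩ h
    have hij : i.1 = j.1 := (st.r_emb x).symm.trans ((congrArg st.r h).trans (st.r_emb y))
    obtain rfl : i = j := Subtype.ext hij
    exact congrArg (Sigma.mk i) ((st.isImm_emb i.1).injective h)
  · intro z
    obtain ⟨x, hx⟩ := st.exists_emb_eq z
    exact ⟨⟨⟨st.r z, z, rfl⟩, x⟩, hx⟩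

/-- The lifts of the strata form a map of families: labels agree because both are `sphereOf` of a
common point, and the map on points is bijective because the strata and the legs both biject onto
the total scheme. -/
lemma Strat.exists_hom (st : Strat Y)
    (h : ∀ i : st.fam.idx, ∃ (j : A.idx) (b : st.piece i.1 ⟶ A.sch j), b ≫ leg g j = st.emb i.1) :
    ∃ f : (schAssembler S n).FamHom st.fam A,
      ∀ I, SphFam.famMap f I ≫ g.nat.app I = st.boxHom I := by
  choose φ b hb using h
  have hbi (i) : IsImm (b i) := IsImm.of_comp (g := leg g (φ i)) (hb i ▸ st.isImm_emb i.1)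
  have hpt (i : st.fam.idx) (x : (st.piece i.1).obj.left) :
      (leg g (φ i)).hom.left ((b i).hom.left x) = (st.emb i.1).hom.left x :=
    apply_eq_of_eq (hb i) x
  let f : (schAssembler S n).FamHom st.fam A := SphFam.homMk φ (fun i => ⟨b i, hbi i⟩)
    (fun i => by
      obtain ⟨_, z, rfl⟩ := i
      obtain ⟨x, hx⟩ := st.exists_emb_eq z
      rw [← sphereOf_leg g _ ((b ⟨_, z, rfl⟩).hom.left x), hpt,
        st.label_eq ⟨_, z, rfl⟩ (st.r_emb x)])
    ((Function.Bijective.of_comp_iff' (leg_bijective g) _).1 (by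
      convert st.emb_bijective using 1
      exact funext fun p => hpt p.1 p.2))
  refine ⟨f, fun I => SphFam.box_hom_ext fun i => (Y.isImm_incl I).eq_of_comp_eq ?_⟩
  have h1 : st.fam.ι I i ≫ SphFam.famMap f I =
      b ⟨i.1, i.2.1⟩ ≫ A.ι I ⟨_, SphFam.label_active f i⟩ := SphFam.ι_famMap f I i
  have h2 := ι_comp_app g I ⟨_, SphFam.label_active f i⟩
  have h3 := st.ι_boxHom I i
  have h4 : (st.fam.ι I i ≫ SphFam.famMap f I) ≫ g.nat.app I ≫ Y.incl I =
      b ⟨i.1, i.2.1⟩ ≫ leg g (φ ⟨i.1, i.2.1⟩) :=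
    (congrArg (· ≫ g.nat.app I ≫ Y.incl I) h1).trans
      ((Category.assoc _ _ _).trans (congrArg (b ⟨i.1, i.2.1⟩ ≫ ·) h2))
  have h5 : (st.fam.ι I i ≫ SphFam.famMap f I ≫ g.nat.app I) ≫ Y.incl I =
      (st.fam.ι I i ≫ SphFam.famMap f I) ≫ g.nat.app I ≫ Y.incl I :=
    (congrArg (· ≫ Y.incl I) (Category.assoc _ _ _).symm).trans (Category.assoc _ _ _)
  exact h5.trans (h4.trans ((hb ⟨i.1, i.2.1⟩).trans (h3.symm.trans (Category.assoc _ _ _).symm)))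

lemma comp_eqToHom_eq_of_leg {X : ImmSch S n} {i j : A.idx} (e : i = j) (a : X ⟶ A.obj i)
    (b : X ⟶ A.obj j) (h : a.hom ≫ leg g i = b.hom ≫ leg g j) :
    a ≫ eqToHom (congrArg A.obj e) = b := by
  subst e
  rw [eqToHom_refl, Category.comp_id]
  ext1
  exact leg_mono g h

lemma hom_comp_leg {B : SphFam S n k m} (f : (schAssembler S n).FamHom B A) (i : B.idx)
    (g' : (schSW S n).SHom B.diagram Y)
    (h : ∀ I, SphFam.famMap f I ≫ g.nat.app I = g'.nat.app I) :
    (f.hom i).hom ≫ leg g (f.idxMap i) = leg g' i := by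
  have h1 := SphFam.ι_famMap f (topBox k m.len) ⟨i.1, B.mem_act_topBox i⟩
  have h2 := congrArg (B.ι (topBox k m.len) ⟨i.1, B.mem_act_topBox i⟩ ≫ ·) (h (topBox k m.len))
  refine Eq.trans ?_ h2
  refine ((Category.assoc _ _ _).symm.trans ?_).trans (Category.assoc _ _ _)
  exact congrArg (· ≫ g.nat.app (topBox k m.len)) h1.symm

/-- Members are non-empty and distinct legs have disjoint images, so one point determines the target
index; then the morphisms agree because legs are monomorphisms. -/
lemma famHom_eq {B : SphFam S n k m} (f f' : (schAssembler S n).FamHom B A)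
    (h : ∀ I, SphFam.famMap f I ≫ g.nat.app I = SphFam.famMap f' I ≫ g.nat.app I)
    (g' : (schSW S n).SHom B.diagram Y)
    (hg : ∀ I, SphFam.famMap f I ≫ g.nat.app I = g'.nat.app I) : f = f' := by
  have h1 (i) := hom_comp_leg g f i g' hg
  have h2 (i) := hom_comp_leg g f' i g' fun I => (h I).symm.trans (hg I)
  have hidx (i) : f.idxMap i = f'.idxMap i := by
    obtain ⟨x⟩ := (isEmpty_isInitial_iff _).1 (B.not_initial i)
    exact congrArg Sigma.fst ((leg_bijective g).1
      (a₁ := ⟨f.idxMap i, (f.hom i).hom.hom.left x⟩)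
      (a₂ := ⟨f'.idxMap i, (f'.hom i).hom.hom.left x⟩)
      (apply_eq_of_eq ((h1 i).trans (h2 i).symm) x))
  exact FamHom.ext' _ hidx fun i =>
    comp_eqToHom_eq_of_leg g (hidx i) _ _ ((h1 i).trans (h2 i).symm)

end

section

variable {S : Scheme.{u}} {n : ℕ∞} [AlgebraicGeometry.IsNoetherian S] {k : ℕ} {m : SimplexCategory}
  (Y : (schSW S n).SObj k m.len)

lemma comp_app_eq {Φ Ψ : CostructuredArrow (comparison S n k m) Y} (f : Φ ⟶ Ψ)
    (I : Box k m.len) : SphFam.famMap f.left I ≫ (SWData.SHom.nat Ψ.hom).app I =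
      (SWData.SHom.nat Φ.hom).app I :=
  congrArg (fun t : (comparison S n k m).obj Φ.left ⟶ Y => (SWData.SHom.nat t).app I)
    (CostructuredArrow.w f)

lemma isThin_fibre : Quiver.IsThin (CostructuredArrow (comparison S n k m) Y) := fun Φ Ψ =>
  ⟨fun f f' => CostructuredArrow.hom_ext _ _ (famHom_eq Ψ.hom f.left f'.left
    (fun I => (comp_app_eq Y f I).trans (comp_app_eq Y f' I).symm) Φ.hom (comp_app_eq Y f))⟩

/-- The fibre object of a stratification. -/
noncomputable def Strat.arrow {Y : (schSW S n).SObj k m.len} (st : Strat Y) :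
    CostructuredArrow (comparison S n k m) Y :=
  let A : (schAssembler S n).W (Sphere k m) (Sphere.base k m) := st.fam
  CostructuredArrow.mk (S := comparison S n k m) (Y := A) st.toDiagram

lemma Strat.nonempty_hom (st : Strat Y) (Φ : CostructuredArrow (comparison S n k m) Y)
    (h : ∀ i : st.fam.idx, ∃ (j : Fam.idx Φ.left) (b : st.piece i.1 ⟶ SphFam.sch Φ.left j),
      b ≫ leg (A := Φ.left) Φ.hom j = st.emb i.1) : Nonempty (st.arrow ⟶ Φ) := by
  obtain ⟨f, hf⟩ := st.exists_hom (A := Φ.left) Φ.hom h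
  exact ⟨CostructuredArrow.homMk (show st.arrow.left ⟶ Φ.left from f) (SWData.SObj.hom_ext _ hf)⟩

/-- The stratifications give objects, and two objects are dominated by a stratification whose strata
each lie in one piece of both finite covers; thinness then reduces contractibility to
codirectedness. -/
theorem wContr_fibre : WContr (nerve (CostructuredArrow (comparison S n k m) Y)) := by
  have := isThin_fibre Y
  have : Nonempty (CostructuredArrow (comparison S n k m) Y) := ⟨(exists_strat Y).some.arrow⟩
  refine wContr_nerve_of_codirected fun Φ Ψ => ?_
  obtain ⟨Q, _, T, i, h1, h2, h3, h4⟩ := exists_finite_cover (A := Φ.left) Φ.hom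
  obtain ⟨Q', _, T', i', h1', h2', h3', h4'⟩ := exists_finite_cover (A := Ψ.left) Ψ.hom
  obtain ⟨N, r, hr, hc, hs⟩ := exists_filtration_of_cover (fun q : Q × Q' => T q.1 ∩ T' q.2)
    (fun q => (h1 q.1).inter (h1' q.2)) fun y => by
      obtain ⟨q, hq⟩ := h2 y
      obtain ⟨q', hq'⟩ := h2' y
      exact ⟨(q, q'), hq, hq'⟩
  let st : Strat Y :=
    { bound := N
      r := r
      r_lt := hr
      isClosed := hc
      -- A stratum lies in the image of a single leg, along which the associated simplex is the
      -- label of that member.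
      sphereOf_eq := fun y z hyz => by
        obtain ⟨q, hq⟩ := hs y
        obtain ⟨a, rfl⟩ := h3 _ (hq rfl).1
        obtain ⟨b, rfl⟩ := h3 _ (hq hyz.symm).1
        exact (sphereOf_leg (A := Φ.left) Φ.hom _ a).trans
          (sphereOf_leg (A := Φ.left) Φ.hom _ b).symm }
  refine ⟨st.arrow, st.nonempty_hom Y Φ ?_, st.nonempty_hom Y Ψ ?_⟩
  · rintro ⟨_, y, rfl⟩
    obtain ⟨q, hq⟩ := hs y
    exact ⟨i q.1, h4 q.1 _ _ ((st.range_emb _).le.trans (hq.trans Set.inter_subset_left))⟩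
  · rintro ⟨_, y, rfl⟩
    obtain ⟨q, hq⟩ := hs y
    exact ⟨i' q.2, h4' q.2 _ _ ((st.range_emb _).le.trans (hq.trans Set.inter_subset_right))⟩

end

end KTheory

theorem mainTheorem9 (S : AlgebraicGeometry.Scheme.{u}) [AlgebraicGeometry.IsNoetherian S]
    (n : ℕ∞) :
    KTheory.Spectrum.LevelEquivalent
      (KTheory.schSW S n).kSpectrum.toSpectrum
      (KTheory.schAssembler S n).kSpectrum.toSpectrum :=
  KTheory.levelEquivalent_of_comparison S n fun _ _ Y => KTheory.wContr_fibre Y
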